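/- Let $n\ge 1$, $s\in(0,1)$, $p\ge 2$ with $ps<n<2ps$, and put $p_s^*=\frac{np}{n-ps}$. Let $1<q<p$, $2p<r<p_s^*$, $a,b>0$ and $M(t)=a+bt$, $\widehat M(t)=\int_0^tM(\tau)\,d\tau$. Let $\Omega\subset\mathbb R^n$ be a bounded domain with smooth boundary, $f\in L^{r/(r-q)}(\Omega)$ and $g\in L^\infty(\Omega)$ (possibly sign changing), such that neither $f^+=\max\{f,0\}$ nor $g^+=\max\{g,0\}$ vanishes almost everywhere in $\Omega$. Let $Q=\mathbb R^{2n}\setminus(\Omega^c\times\Omega^c)$ and let $X$ be the space of measurable $u:\mathbb R^n\to\mathbb R$ (identified when equal almost everywhere) with $u|_\Omega\in L^p(\Omega)$ and $\frac{u(x)-u(y)}{|x-y|^{n/p+s}}\in L^p(Q)$, with the norm $\big(\|u\|_{L^p(\Omega)}^p+\int_Q\frac{|u(x)-u(y)|^p}{|x-y|^{n+ps}}\,dx\,dy\big)^{1/p}$. Let $X_0$ be the closure of $C_c^\infty(\Omega)$ in $X$, with the norm $\|u\|_{X_0}=\big(\int_Q\frac{|u(x)-u(y)|^p}{|x-y|^{n+ps}}\,dx\,dy\big)^{1/p}$.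 For $\lambda>0$, a solution of $$(P_\lambda)\qquad M(\|u\|_{X_0}^p)\,(-\Delta)_p^su=\lambda f|u|^{q-2}u+g|u|^{r-2}u,\quad u\ge0,\ u\not\equiv0\ \text{ in }\Omega,\qquad u=0\ \text{ in }\mathbb R^n\setminus\Omega$$ is a function $u\in X_0$ with $u\ge 0$ a.e. in $\Omega$, not a.e. zero in $\Omega$, such that for all $\varphi\in X_0$ $$M(\|u\|_{X_0}^p)\int_{\mathbb R^{2n}}\frac{|u(x)-u(y)|^{p-2}(u(x)-u(y))(\varphi(x)-\varphi(y))}{|x-y|^{n+ps}}\,dx\,dy=\lambda\int_\Omega f|u|^{q-2}u\varphi\,dx+\int_\Omega g|u|^{r-2}u\varphi\,dx .$$ On $X_0$ let $J_\lambda(u)=\frac1p\widehat M(\|u\|_{X_0}^p)-\frac\lambda q\int_\Omega f|u|^q\,dx-\frac1r\int_\Omega g|u|^r\,dx$, let $\phi_u(t)=J_\lambda(tu)$ and $$\mathcal N_\lambda=\{u\in X_0\setminus\{0\}:\langle J_\lambda'(u),u\rangle=0\},\qquad \mathcal N_\lambda^{+}=\{u\in\mathcal N_\lambda:\phi_u''(1)>0\},\qquad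 \mathcal N_\lambda^{-}=\{u\in\mathcal N_\lambda:\phi_u''(1)<0\}.$$ Let $S_r=\inf\{\|u\|_{X_0}/\|u\|_{L^r(\Omega)}:u\in X_0\setminus\{0\}\}$ and $$\lambda_0=\frac{(r-p)\,S_r^{q}}{\|f\|_{L^{r/(r-q)}(\Omega)}}\Big(\frac a{r-q}\Big)^{\frac{r-q}{r-p}}\Big(\frac{(p-q)\,S_r^{r}}{\|g\|_{L^\infty(\Omega)}}\Big)^{\frac{p-q}{r-p}} .$$ **Theorem.** One has $\lambda_0>0$, and for every $\lambda\in(0,\lambda_0)$ problem $(P_\lambda)$ has at least two distinct (non-negative, nontrivial) solutions $u_\lambda^+$ and $u_\lambda^-$, such that $u_\lambda^+\in\mathcal N_\lambda^+$ minimizes $J_\lambda$ on $\mathcal N_\lambda^+$ and $u_\lambda^-\in\mathcal N_\lambda^-$ minimizes $J_\lambda$ on $\mathcal N_\lambda^-$. -/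

import Mathlib

open Real Set Filter Topology MeasureTheory
open scoped ENNReal ContDiff

noncomputable section

namespace FracKirchhoff

/-- `ℝⁿ` with the Euclidean norm. -/
abbrev E (n : ℕ) : Type := EuclideanSpace ℝ (Fin n)

/-- The boundary of the open set `Ω` is smooth: near each boundary point, `Ω` is the set where a
`C^∞` function with non-vanishing differential at that point is negative. -/
def HasSmoothBoundary {n : ℕ} (Ω : Set (E n)) : Prop :=
  ∀ x ∈ frontier Ω, ∃ U : Set (E n), IsOpen U ∧ x ∈ U ∧ ∃ ρ : E n → ℝ,
    ContDiff ℝ ∞ ρ ∧ ρ x = 0 ∧ fderiv ℝ ρ x ≠ 0 ∧ Ω ∩ U = {y | ρ y < 0} ∩ U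

/-- `Q = ℝ²ⁿ \ (Ωᶜ × Ωᶜ)`. -/
def Q {n : ℕ} (Ω : Set (E n)) : Set (E n × E n) := (Ωᶜ ×ˢ Ωᶜ)ᶜ

/-- The space `X`: measurable `u : ℝⁿ → ℝ` with `u|_Ω ∈ L^p(Ω)` and
`(u(x) - u(y)) / |x - y|^(n/p + s) ∈ L^p(Q)`. As usual, its elements are considered up to equality
almost everywhere. -/
def MemX {n : ℕ} (Ω : Set (E n)) (p s : ℝ) (u : E n → ℝ) : Prop :=
  AEStronglyMeasurable u volume ∧
  MemLp u (ENNReal.ofReal p) (volume.restrict Ω) ∧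
  MemLp (fun z : E n × E n => (u z.1 - u z.2) / ‖z.1 - z.2‖ ^ ((n : ℝ) / p + s))
    (ENNReal.ofReal p) (volume.restrict (Q Ω))

/-- The norm of `X₀`: `(∫_Q |u(x) - u(y)|^p / |x - y|^(n+ps) dx dy)^(1/p)`. -/
def normX0 {n : ℕ} (Ω : Set (E n)) (p s : ℝ) (u : E n → ℝ) : ℝ :=
  (∫ z in Q Ω, |u z.1 - u z.2| ^ p / ‖z.1 - z.2‖ ^ ((n : ℝ) + p * s)) ^ (1 / p)

/-- The norm of `X`: `(∫_Ω |u|^p + ∫_Q |u(x) - u(y)|^p / |x - y|^(n+ps) dx dy)^(1/p)`. -/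
def normX {n : ℕ} (Ω : Set (E n)) (p s : ℝ) (u : E n → ℝ) : ℝ :=
  ((∫ x in Ω, |u x| ^ p) +
    ∫ z in Q Ω, |u z.1 - u z.2| ^ p / ‖z.1 - z.2‖ ^ ((n : ℝ) + p * s)) ^ (1 / p)

/-- `φ ∈ C_c^∞(Ω)`, extended by zero to `ℝⁿ`. -/
def IsTest {n : ℕ} (Ω : Set (E n)) (φ : E n → ℝ) : Prop :=
  ContDiff ℝ ∞ φ ∧ HasCompactSupport φ ∧ tsupport φ ⊆ Ω

/-- The space `X₀`: the closure of `C_c^∞(Ω)` in `X`. -/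
def X0 {n : ℕ} (Ω : Set (E n)) (p s : ℝ) : Set (E n → ℝ) :=
  {u | MemX Ω p s u ∧ ∀ ε > 0, ∃ φ, IsTest Ω φ ∧ normX Ω p s (u - φ) < ε}

/-- The Kirchhoff function `M(t) = a + b t`. -/
def M (a b t : ℝ) : ℝ := a + b * t

/-- The primitive `M̂(t) = ∫₀ᵗ M`. -/
def Mhat (a b t : ℝ) : ℝ := ∫ τ in (0 : ℝ)..t, M a b τ

/-- The energy functional `J_λ`. -/
def J {n : ℕ} (Ω : Set (E n)) (p s a b q r : ℝ) (f g : E n → ℝ) (lam : ℝ) (u : E n → ℝ) : ℝ :=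
  (1 / p) * Mhat a b (normX0 Ω p s u ^ p) - (lam / q) * (∫ x in Ω, f x * |u x| ^ q)
    - (1 / r) * (∫ x in Ω, g x * |u x| ^ r)

/-- Weak solutions of the equation with zero exterior condition, tested with all of `X₀`. -/
def IsWeakSolution {n : ℕ} (Ω : Set (E n)) (p s a b q r : ℝ) (f g : E n → ℝ) (lam : ℝ)
    (u : E n → ℝ) : Prop :=
  u ∈ X0 Ω p s ∧ ∀ φ ∈ X0 Ω p s,
    M a b (normX0 Ω p s u ^ p) *
      (∫ z : E n × E n, |u z.1 - u z.2| ^ (p - 2) * (u z.1 - u z.2) * (φ z.1 - φ z.2) *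
        ‖z.1 - z.2‖ ^ (-(n : ℝ) - p * s))
    = lam * (∫ x in Ω, f x * |u x| ^ (q - 2) * u x * φ x)
      + ∫ x in Ω, g x * |u x| ^ (r - 2) * u x * φ x

/-- Solutions of `(P_λ)`: weak solutions with `u ≥ 0` and `u ≢ 0` in `Ω`. -/
def IsSolution {n : ℕ} (Ω : Set (E n)) (p s a b q r : ℝ) (f g : E n → ℝ) (lam : ℝ)
    (u : E n → ℝ) : Prop :=
  IsWeakSolution Ω p s a b q r f g lam u ∧
  (∀ᵐ x ∂(volume.restrict Ω), 0 ≤ u x) ∧ ¬ (∀ᵐ x ∂(volume.restrict Ω), u x = 0)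

/-- The Nehari set: `u ∈ X₀ \ {0}` with `⟨J_λ'(u), u⟩ = 0`, the derivative of `J_λ` at `u` in
the direction `u`. -/
def Nehari {n : ℕ} (Ω : Set (E n)) (p s a b q r : ℝ) (f g : E n → ℝ) (lam : ℝ) :
    Set (E n → ℝ) :=
  {u | u ∈ X0 Ω p s ∧ ¬ (u =ᵐ[volume] 0) ∧ lineDeriv ℝ (J Ω p s a b q r f g lam) u u = 0}

/-- The fiber map `φ_u(t) = J_λ(t u)`. -/
def fiber {n : ℕ} (Ω : Set (E n)) (p s a b q r : ℝ) (f g : E n → ℝ) (lam : ℝ)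
    (u : E n → ℝ) (t : ℝ) : ℝ :=
  J Ω p s a b q r f g lam (t • u)

/-- `N_λ⁺`: the elements of the Nehari set with `φ_u''(1) > 0`. -/
def NehariPlus {n : ℕ} (Ω : Set (E n)) (p s a b q r : ℝ) (f g : E n → ℝ) (lam : ℝ) :
    Set (E n → ℝ) :=
  {u | u ∈ Nehari Ω p s a b q r f g lam ∧
    0 < iteratedDeriv 2 (fiber Ω p s a b q r f g lam u) 1}

/-- `N_λ⁻`: the elements of the Nehari set with `φ_u''(1) < 0`. -/
def NehariMinus {n : ℕ} (Ω : Set (E n)) (p s a b q r : ℝ) (f g : E n → ℝ) (lam : ℝ) :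
    Set (E n → ℝ) :=
  {u | u ∈ Nehari Ω p s a b q r f g lam ∧
    iteratedDeriv 2 (fiber Ω p s a b q r f g lam u) 1 < 0}

/-- The norm of `L^m(Ω)`. -/
def normL {n : ℕ} (Ω : Set (E n)) (m : ℝ≥0∞) (u : E n → ℝ) : ℝ :=
  (eLpNorm u m (volume.restrict Ω)).toReal

/-- The best constant `S_r` of the embedding `X₀ ⊆ L^r(Ω)`:
the infimum of `‖u‖_{X₀} / ‖u‖_{L^r(Ω)}` over `u ∈ X₀ \ {0}`. -/
def S {n : ℕ} (Ω : Set (E n)) (p s r : ℝ) : ℝ :=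
  sInf {c | ∃ u ∈ X0 Ω p s, ¬ (u =ᵐ[volume] 0) ∧
    c = normX0 Ω p s u / normL Ω (ENNReal.ofReal r) u}

/-- The threshold
`λ₀ = (r-p) S_r^q / ‖f‖ * (a/(r-q))^((r-q)/(r-p)) * ((p-q) S_r^r / ‖g‖_∞)^((p-q)/(r-p))`,
with the norm of `f` taken in `L^(r/(r-q))(Ω)`. -/
def lambda0 {n : ℕ} (Ω : Set (E n)) (p s a q r : ℝ) (f g : E n → ℝ) : ℝ :=
  ((r - p) * S Ω p s r ^ q / normL Ω (ENNReal.ofReal (r / (r - q))) f) *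
    (a / (r - q)) ^ ((r - q) / (r - p)) *
    ((p - q) * S Ω p s r ^ r / normL Ω ∞ g) ^ ((p - q) / (r - p))

end FracKirchhoff

end

/-! The energy of `u` depends on three numbers only: `N = ‖u‖^p`, `F = λ ∫ f|u|^q` and `G = ∫
g|u|^r`, which are homogeneous of degrees `p`, `q`, `r`. Along the ray `t ↦ t u` its derivative is
`t^(q-1) (level(t) - F)` with `level(t) = a N t^(p-q) + b N² t^(2p-q) - G t^(r-q)`. Since `r - p >
p`, the slope of `level` changes sign at most once, from positive to negative (`slope_pos_of_lt`).
The Nehari condition says `level(1) = F`, and the two parts of the Nehari set record the sign of the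
slope at one (`mem_nehariPlus_iff`, `mem_nehariMinus_iff`).

At a peak of `level` the Sobolev bound on `G` forces `N` to be large; for `λ < λ₀` the Sobolev bound
on `F` then puts the peak strictly above `F` (`Params.nondegenerate`). So no degenerate points
exist. A ray with `F > 0` meets the positive part on the rising branch, a ray with `G > 0` meets the
negative part on the falling branch, and nontriviality of `f⁺` and `g⁺` supplies such rays.

Minimizing sequences on either part are bounded by coercivity (`exists_bound_of_energy_le`). Along a
subsequence they converge in `L^r`, so `F` and `G` pass to the limit while `N` can only drop
(`exists_limit`). Strong convergence is not needed: the triple made of the limit of the norms and of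
`F`, `G` at the limit function `v` still satisfies the constraint and has the infimum as its energy.
Passing to `|v|` keeps `F` and `G` and does not raise `N`, and after such a drop a suitable dilation
returns to the same part without raising the energy (`exists_triplePlus_le_of_le`,
`exists_tripleMinus_le_of_le`). This gives nonnegative minimizers (`exists_nonneg_minimizer`).

No Lagrange multiplier is used to see that minimizers are critical. Near a minimizer of the positive
part, projection along rays does not increase the energy, so the minimizer is a local minimum on
every line. On the negative part the minimizer is a local maximum along its own ray, nearby points
project with factors close to one, and comparing energies at equal factors gives a one-sided
derivative inequality, used for both directions (`deriv_energy_nonneg_of_tripleMinus`).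

The function space is first replaced by `Adm`, where all integrals run over the whole space
(`X0_eq_adm`). The analytic inputs are the fractional Sobolev inequality (`sobolev_critical`),
compactness in `L^p` through local averages (`exists_subseq_tendsto_pint`), and weak closedness of
`Adm` through convex combinations and Clarkson's inequality (`adm_of_tendsto`). -/

noncomputable section

namespace FracKirchhoff

/-! ### Gagliardo energy over the whole space: basic estimates, lower semicontinuity, Clarkson's
inequality. -/

section

variable {n : ℕ} {p s m : ℝ} {Ω : Set (E n)}

/-- The kernel `‖z‖^(-(n+ps))` as an extended nonnegative real. -/
def kern (p s : ℝ) (z : E n) : ℝ≥0∞ := ENNReal.ofReal (‖z‖ ^ (-((n : ℝ) + p * s)))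

/-- The `p`-th power of the Gagliardo seminorm over the whole space. -/
def gag (p s : ℝ) (u : E n → ℝ) : ℝ≥0∞ :=
  ∫⁻ z : E n × E n, ‖u z.1 - u z.2‖ₑ ^ p * kern p s (z.1 - z.2)

/-- The integral of `|u|^m` over the whole space. -/
def pint (m : ℝ) (u : E n → ℝ) : ℝ≥0∞ := ∫⁻ x, ‖u x‖ₑ ^ m

/-- Functions vanishing outside `Ω` that are approximated by test functions in the `L^p` norm and
the Gagliardo seminorm over the whole space. -/
def Adm (Ω : Set (E n)) (p s : ℝ) : Set (E n → ℝ) :=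
  {u | AEStronglyMeasurable u volume ∧ (∀ᵐ x, x ∉ Ω → u x = 0) ∧
    ∀ ε : ℝ≥0∞, 0 < ε → ∃ φ, IsTest Ω φ ∧ pint p (u - φ) + gag p s (u - φ) ≤ ε}

@[fun_prop]
lemma measurable_kern : Measurable (kern (n := n) p s) := by
  unfold kern
  fun_prop

lemma aemeasurable_diff {u : E n → ℝ} (hu : AEStronglyMeasurable u volume) :
    AEMeasurable (fun z : E n × E n => u z.1 - u z.2) volume := by
  have h1 : AEMeasurable (fun z : E n × E n => u z.1) volume := hu.aemeasurable.comp_fst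
  have h2 : AEMeasurable (fun z : E n × E n => u z.2) volume := hu.aemeasurable.comp_snd
  exact h1.sub h2

lemma aemeasurable_gag {u : E n → ℝ} (hu : AEStronglyMeasurable u volume) :
    AEMeasurable (fun z : E n × E n => ‖u z.1 - u z.2‖ₑ ^ p * kern p s (z.1 - z.2)) volume := by
  have := aemeasurable_diff hu
  have h2 : Measurable (fun z : E n × E n => kern p s (z.1 - z.2)) := by fun_prop
  exact (this.enorm.pow_const p).mul h2.aemeasurable

lemma enorm_add_rpow_le (hp : 1 ≤ p) (x y : ℝ) :
    ‖x + y‖ₑ ^ p ≤ 2 ^ (p - 1) * (‖x‖ₑ ^ p + ‖y‖ₑ ^ p) :=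
  (ENNReal.rpow_le_rpow (enorm_add_le x y) (by linarith)).trans
    (ENNReal.rpow_add_le_mul_rpow_add_rpow _ _ hp)

lemma gag_add_le (hp : 1 ≤ p) {u v : E n → ℝ} (hu : AEStronglyMeasurable u volume) :
    gag p s (u + v) ≤ 2 ^ (p - 1) * (gag p s u + gag p s v) := by
  unfold gag
  have h2 : (2 : ℝ≥0∞) ^ (p - 1) ≠ ⊤ := ENNReal.rpow_ne_top_of_nonneg (by linarith) (by simp)
  rw [← lintegral_add_left' (aemeasurable_gag hu), ← lintegral_const_mul' _ _ h2]
  refine lintegral_mono fun z => ?_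
  rw [← add_mul, ← mul_assoc]
  gcongr
  refine le_trans (le_of_eq ?_) (enorm_add_rpow_le hp _ _)
  simp only [Pi.add_apply]
  congr 2
  ring

lemma pint_add_le (hp : 1 ≤ p) {u v : E n → ℝ} (hu : AEStronglyMeasurable u volume) :
    pint p (u + v) ≤ 2 ^ (p - 1) * (pint p u + pint p v) := by
  unfold pint
  have h2 : (2 : ℝ≥0∞) ^ (p - 1) ≠ ⊤ := ENNReal.rpow_ne_top_of_nonneg (by linarith) (by simp)
  rw [← lintegral_add_left' (hu.enorm.pow_const p), ← lintegral_const_mul' _ _ h2]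
  exact lintegral_mono fun z => enorm_add_rpow_le hp _ _

lemma gag_smul (hp : 0 ≤ p) (c : ℝ) (u : E n → ℝ) : gag p s (c • u) = ‖c‖ₑ ^ p * gag p s u := by
  unfold gag
  rw [← lintegral_const_mul' _ _ (ENNReal.rpow_ne_top_of_nonneg hp (by simp))]
  refine lintegral_congr fun z => ?_
  rw [← mul_assoc, ← ENNReal.mul_rpow_of_nonneg _ _ hp, ← enorm_mul]
  simp [mul_sub]

lemma pint_smul (hp : 0 ≤ p) (c : ℝ) (u : E n → ℝ) : pint p (c • u) = ‖c‖ₑ ^ p * pint p u := by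
  unfold pint
  rw [← lintegral_const_mul' _ _ (ENNReal.rpow_ne_top_of_nonneg hp (by simp))]
  refine lintegral_congr fun z => ?_
  rw [← ENNReal.mul_rpow_of_nonneg _ _ hp, ← enorm_mul]
  simp

lemma gag_neg (u : E n → ℝ) : gag p s (-u) = gag p s u := by
  unfold gag
  refine lintegral_congr fun z => ?_
  rw [← enorm_neg]
  congr 3
  simp only [Pi.neg_apply]
  ring

lemma pint_neg (u : E n → ℝ) : pint p (-u) = pint p u := by
  unfold pint
  simp

lemma gag_sub_le (hp : 1 ≤ p) {u v : E n → ℝ} (hu : AEStronglyMeasurable u volume) :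
    gag p s (u - v) ≤ 2 ^ (p - 1) * (gag p s u + gag p s v) := by
  rw [sub_eq_add_neg, ← gag_neg v]
  exact gag_add_le hp hu

lemma pint_sub_le (hp : 1 ≤ p) {u v : E n → ℝ} (hu : AEStronglyMeasurable u volume) :
    pint p (u - v) ≤ 2 ^ (p - 1) * (pint p u + pint p v) := by
  rw [sub_eq_add_neg, ← pint_neg v]
  exact pint_add_le hp hu

lemma ae_prod_of_ae {P : E n → Prop} (h : ∀ᵐ x, P x) :
    ∀ᵐ z : E n × E n, P z.1 ∧ P z.2 := by
  have h1 : ∀ᵐ z : E n × E n, P z.1 := Measure.quasiMeasurePreserving_fst.ae h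
  have h2 : ∀ᵐ z : E n × E n, P z.2 := Measure.quasiMeasurePreserving_snd.ae h
  filter_upwards [h1, h2] with z a b using ⟨a, b⟩

lemma gag_congr {u v : E n → ℝ} (h : u =ᵐ[volume] v) : gag p s u = gag p s v := by
  refine lintegral_congr_ae ?_
  filter_upwards [ae_prod_of_ae h] with z hz
  rw [hz.1, hz.2]

lemma pint_congr {u v : E n → ℝ} (h : u =ᵐ[volume] v) : pint m u = pint m v := by
  refine lintegral_congr_ae ?_
  filter_upwards [h] with z hz
  rw [hz]

lemma pint_eq_eLpNorm_rpow (hm : 0 < m) (u : E n → ℝ) :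
    pint m u = eLpNorm u (ENNReal.ofReal m) volume ^ m := by
  rw [eLpNorm_eq_lintegral_rpow_enorm_toReal (by simpa using hm) (by simp),
    ENNReal.toReal_ofReal hm.le, ← ENNReal.rpow_mul, one_div, inv_mul_cancel₀ hm.ne',
    ENNReal.rpow_one, pint]

lemma eLpNorm_eq_pint_rpow (hm : 0 < m) (u : E n → ℝ) :
    eLpNorm u (ENNReal.ofReal m) volume = pint m u ^ (1 / m) := by
  rw [pint_eq_eLpNorm_rpow hm, ← ENNReal.rpow_mul, mul_one_div_cancel hm.ne', ENNReal.rpow_one]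

lemma exists_subseq_tendsto_ae (hm : 0 < m) {w : ℕ → E n → ℝ} {v : E n → ℝ}
    (hw : ∀ k, AEStronglyMeasurable (w k) volume) (hv : AEStronglyMeasurable v volume)
    (h : Tendsto (fun k => pint m (w k - v)) atTop (𝓝 0)) :
    ∃ ns : ℕ → ℕ, StrictMono ns ∧ ∀ᵐ x, Tendsto (fun k => w (ns k) x) atTop (𝓝 (v x)) := by
  have h1 : Tendsto (fun k => eLpNorm (w k - v) (ENNReal.ofReal m) volume) atTop (𝓝 0) := by
    simp_rw [eLpNorm_eq_pint_rpow hm]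
    have := h.ennrpow_const (1 / m)
    rwa [ENNReal.zero_rpow_of_pos (by positivity)] at this
  exact (tendstoInMeasure_of_tendsto_eLpNorm (by simpa using hm) hw hv h1).exists_seq_tendsto_ae

lemma lintegral_le_of_ae_tendsto {α : Type*} [MeasurableSpace α] {μ : Measure α}
    {F : ℕ → α → ℝ≥0∞} {f : α → ℝ≥0∞} {L : ℝ≥0∞} (hF : ∀ k, AEMeasurable (F k) μ)
    (h : ∀ᵐ x ∂μ, Tendsto (fun k => F k x) atTop (𝓝 (f x)))
    (hL : ∀ᶠ k in atTop, ∫⁻ x, F k x ∂μ ≤ L) : ∫⁻ x, f x ∂μ ≤ L := by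
  calc ∫⁻ x, f x ∂μ = ∫⁻ x, liminf (fun k => F k x) atTop ∂μ :=
        lintegral_congr_ae (h.mono fun x hx => hx.liminf_eq.symm)
    _ ≤ liminf (fun k => ∫⁻ x, F k x ∂μ) atTop := lintegral_liminf_le' hF
    _ ≤ L := by
        refine (liminf_le_liminf hL).trans ?_
        simp

lemma pint_le_of_ae_tendsto {w : ℕ → E n → ℝ} {v : E n → ℝ} {L : ℝ≥0∞}
    (hw : ∀ k, AEStronglyMeasurable (w k) volume)
    (h : ∀ᵐ x, Tendsto (fun k => w k x) atTop (𝓝 (v x)))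
    (hL : ∀ᶠ k in atTop, pint m (w k) ≤ L) : pint m v ≤ L := by
  refine lintegral_le_of_ae_tendsto (fun k => (hw k).enorm.pow_const m) ?_ hL
  filter_upwards [h] with x hx
  exact (continuous_enorm.tendsto _ |>.comp hx).ennrpow_const m

lemma gag_le_of_ae_tendsto {w : ℕ → E n → ℝ} {v : E n → ℝ} {L : ℝ≥0∞}
    (hw : ∀ k, AEStronglyMeasurable (w k) volume)
    (h : ∀ᵐ x, Tendsto (fun k => w k x) atTop (𝓝 (v x)))
    (hL : ∀ᶠ k in atTop, gag p s (w k) ≤ L) : gag p s v ≤ L := by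
  refine lintegral_le_of_ae_tendsto (fun k => aemeasurable_gag (hw k)) ?_ hL
  filter_upwards [ae_prod_of_ae h] with z hz
  refine ENNReal.Tendsto.mul_const ?_ (Or.inr (by simp [kern]))
  exact (continuous_enorm.tendsto _ |>.comp (hz.1.sub hz.2)).ennrpow_const p

/-- Lower semicontinuity of the Gagliardo seminorm under `L^m` convergence. -/
lemma gag_le_of_tendsto (hm : 0 < m) {w : ℕ → E n → ℝ} {v : E n → ℝ} {L : ℝ≥0∞}
    (hw : ∀ k, AEStronglyMeasurable (w k) volume) (hv : AEStronglyMeasurable v volume)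
    (h : Tendsto (fun k => pint m (w k - v)) atTop (𝓝 0))
    (hL : ∀ᶠ k in atTop, gag p s (w k) ≤ L) : gag p s v ≤ L := by
  obtain ⟨ns, hns, hae⟩ := exists_subseq_tendsto_ae hm hw hv h
  exact gag_le_of_ae_tendsto (fun k => hw _) hae (hns.tendsto_atTop.eventually hL)

lemma pint_le_of_tendsto {m' : ℝ} (hm : 0 < m) {w : ℕ → E n → ℝ} {v : E n → ℝ}
    {L : ℝ≥0∞} (hw : ∀ k, AEStronglyMeasurable (w k) volume) (hv : AEStronglyMeasurable v volume)
    (h : Tendsto (fun k => pint m (w k - v)) atTop (𝓝 0))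
    (hL : ∀ᶠ k in atTop, pint m' (w k) ≤ L) : pint m' v ≤ L := by
  obtain ⟨ns, hns, hae⟩ := exists_subseq_tendsto_ae hm hw hv h
  exact pint_le_of_ae_tendsto (fun k => hw _) hae (hns.tendsto_atTop.eventually hL)

/-- Clarkson's inequality for real numbers and exponents at least two. -/
lemma abs_clarkson (hp : 2 ≤ p) (x y : ℝ) :
    |(x + y) / 2| ^ p + |(x - y) / 2| ^ p ≤ (|x| ^ p + |y| ^ p) / 2 := by
  -- On squares the exponent is `p / 2 ≥ 1`, so superadditivity of the power, the parallelogram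
  -- identity and convexity give the claim. This is where `p ≥ 2` enters.
  have e : ∀ t : ℝ, |t| ^ p = (t ^ 2) ^ (p / 2) := fun t => by
    rw [← sq_abs, ← Real.rpow_natCast, ← Real.rpow_mul (abs_nonneg t)]
    congr 1
    push_cast
    ring
  have hp2 : 1 ≤ p / 2 := by linarith
  simp only [e]
  have h1 := Real.add_rpow_le_rpow_add (sq_nonneg ((x + y) / 2)) (sq_nonneg ((x - y) / 2)) hp2
  have h2 : ((x + y) / 2) ^ 2 + ((x - y) / 2) ^ 2 = 1 / 2 * x ^ 2 + 1 / 2 * y ^ 2 := by ring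
  have h3 := (convexOn_rpow hp2).2 (mem_Ici.2 (sq_nonneg x)) (mem_Ici.2 (sq_nonneg y))
    (show (0 : ℝ) ≤ 1 / 2 by norm_num) (show (0 : ℝ) ≤ 1 / 2 by norm_num) (by norm_num)
  simp only [smul_eq_mul] at h3
  rw [h2] at h1
  linarith

lemma enorm_rpow_eq (hp : 0 ≤ p) (x : ℝ) : ‖x‖ₑ ^ p = ENNReal.ofReal (|x| ^ p) := by
  rw [Real.enorm_eq_ofReal_abs, ENNReal.ofReal_rpow_of_nonneg (abs_nonneg x) hp]

lemma enorm_clarkson (hp : 2 ≤ p) (x y : ℝ) :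
    ‖(x + y) / 2‖ₑ ^ p + ‖(x - y) / 2‖ₑ ^ p ≤ 2⁻¹ * (‖x‖ₑ ^ p + ‖y‖ₑ ^ p) := by
  have hp0 : 0 ≤ p := by linarith
  have e2 : (2 : ℝ≥0∞)⁻¹ = ENNReal.ofReal (2⁻¹) := by
    rw [ENNReal.ofReal_inv_of_pos (by norm_num)]; simp
  simp only [enorm_rpow_eq hp0]
  rw [e2, ← ENNReal.ofReal_add (by positivity) (by positivity),
    ← ENNReal.ofReal_add (by positivity) (by positivity),
    ← ENNReal.ofReal_mul (by positivity)]
  refine ENNReal.ofReal_le_ofReal ?_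
  have := abs_clarkson hp x y
  linarith

/-- The pointwise inequality is integrated against the kernel. It plays the role of uniform
convexity: two functions of nearly minimal energy in a convex set are close in energy. -/
lemma gag_clarkson (hp : 2 ≤ p) {u v : E n → ℝ} (hu : AEStronglyMeasurable u volume)
    (hv : AEStronglyMeasurable v volume) :
    gag p s ((2⁻¹ : ℝ) • (u + v)) + gag p s ((2⁻¹ : ℝ) • (u - v))
      ≤ 2⁻¹ * (gag p s u + gag p s v) := by
  unfold gag
  rw [← lintegral_add_left' (aemeasurable_gag hu), ← lintegral_const_mul' _ _ (by simp),
    ← lintegral_add_left' (aemeasurable_gag ((hu.add hv).const_smul _))]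
  refine lintegral_mono fun z => ?_
  rw [← add_mul, ← add_mul, ← mul_assoc]
  gcongr
  refine le_trans (le_of_eq ?_) (enorm_clarkson hp _ _)
  simp only [Pi.smul_apply, Pi.add_apply, Pi.sub_apply, smul_eq_mul]
  congr 3 <;> ring

end

/-! ### Finite energy of test functions, and the vector space `Adm`. -/

section

variable {n : ℕ} {p s m : ℝ} {Ω : Set (E n)}

/-- In polar coordinates the radial integrand is at most a multiple of `y^(p-ps-1)` near zero,
integrable because `s < 1`, and of `y^(-1-ps)` at infinity, integrable because `s > 0`. -/
lemma integrable_min_mul_kernel (hn : 0 < n) (hs0 : 0 < s) (hs1 : s < 1) (hp : 1 ≤ p)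
    {L K : ℝ} (hL : 0 ≤ L) (hK : 0 ≤ K) :
    Integrable (fun z : E n => min (L * ‖z‖) K ^ p * ‖z‖ ^ (-((n : ℝ) + p * s))) volume := by
  have : Nonempty (Fin n) := ⟨⟨0, hn⟩⟩
  have hp0 : 0 < p := by linarith
  rw [integrable_fun_norm_addHaar volume
    (f := fun y : ℝ => min (L * y) K ^ p * y ^ (-((n : ℝ) + p * s)))]
  have hdim : Module.finrank ℝ (E n) = n := by simp
  rw [hdim, ← Ioc_union_Ioi_eq_Ioi zero_le_one]
  have hmeas : Measurable fun y : ℝ =>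
      y ^ (n - 1) • (min (L * y) K ^ p * y ^ (-((n : ℝ) + p * s))) := by fun_prop
  have hpow : ∀ y : ℝ, 0 < y → y ^ (n - 1) = y ^ ((n : ℝ) - 1) := fun y hy => by
    rw [← Real.rpow_natCast, Nat.cast_sub hn, Nat.cast_one]
  refine IntegrableOn.union ?_ ?_
  · have h1 : IntegrableOn (fun y : ℝ => L ^ p * y ^ (p - p * s - 1)) (Ioc 0 1) := by
      have := (intervalIntegral.intervalIntegrable_rpow' (a := 0) (b := 1)
        (r := p - p * s - 1) (by nlinarith)).const_mul (L ^ p)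
      rwa [intervalIntegrable_iff_integrableOn_Ioc_of_le zero_le_one] at this
    refine Integrable.mono' h1 hmeas.aestronglyMeasurable ?_
    refine (ae_restrict_iff' measurableSet_Ioc).2 (.of_forall fun y hy => ?_)
    have hy0 : 0 < y := hy.1
    rw [smul_eq_mul, Real.norm_of_nonneg (by positivity), hpow y hy0]
    calc y ^ ((n : ℝ) - 1) * (min (L * y) K ^ p * y ^ (-((n : ℝ) + p * s)))
        ≤ y ^ ((n : ℝ) - 1) * ((L * y) ^ p * y ^ (-((n : ℝ) + p * s))) := by
          gcongr
          exact min_le_left _ _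
      _ = L ^ p * (y ^ ((n : ℝ) - 1) * y ^ p * y ^ (-((n : ℝ) + p * s))) := by
          rw [Real.mul_rpow hL hy0.le]; ring
      _ = L ^ p * y ^ (p - p * s - 1) := by
          rw [← Real.rpow_add hy0, ← Real.rpow_add hy0]
          ring_nf
  · have h1 : IntegrableOn (fun y : ℝ => K ^ p * y ^ (-1 - p * s)) (Ioi 1) :=
      (integrableOn_Ioi_rpow_of_lt (by nlinarith) one_pos).const_mul _
    refine Integrable.mono' h1 hmeas.aestronglyMeasurable ?_
    refine (ae_restrict_iff' measurableSet_Ioi).2 (.of_forall fun y hy => ?_)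
    have hy0 : 0 < y := lt_trans one_pos hy
    rw [smul_eq_mul, Real.norm_of_nonneg (by positivity), hpow y hy0]
    calc y ^ ((n : ℝ) - 1) * (min (L * y) K ^ p * y ^ (-((n : ℝ) + p * s)))
        ≤ y ^ ((n : ℝ) - 1) * (K ^ p * y ^ (-((n : ℝ) + p * s))) := by
          gcongr
          exact min_le_right _ _
      _ = K ^ p * (y ^ ((n : ℝ) - 1) * y ^ (-((n : ℝ) + p * s))) := by ring
      _ = K ^ p * y ^ (-1 - p * s) := by
          rw [← Real.rpow_add hy0]
          ring_nf

/-- Lipschitz functions with compact support have finite Gagliardo seminorm. -/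
lemma gag_lt_top_of_lipschitz (hn : 0 < n) (hs0 : 0 < s) (hs1 : s < 1) (hp : 1 ≤ p)
    {φ : E n → ℝ} {L : NNReal} (hL : LipschitzWith L φ) (hc : HasCompactSupport φ) :
    gag p s φ < ⊤ := by
  have hp0 : 0 < p := by linarith
  obtain ⟨K, hK⟩ := hL.continuous.bounded_above_of_compact_support hc
  have hK0 : 0 ≤ K := (norm_nonneg _).trans (hK 0)
  -- A majorant depending on `x - y` only: the Lipschitz bound is used near the diagonal and the sup
  -- bound away from it.
  set g : E n → ℝ≥0∞ := fun z => ENNReal.ofReal (min (L * ‖z‖) (2 * K) ^ p) * kern p s z with hg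
  have hgm : Measurable g := by fun_prop
  have hκ : ∫⁻ z, g z < ⊤ := by
    have := (integrable_min_mul_kernel (n := n) hn hs0 hs1 hp L.2
      (by positivity : 0 ≤ 2 * K)).lintegral_lt_top
    refine lt_of_le_of_lt (le_of_eq (lintegral_congr fun z => ?_)) this
    simp only [hg, kern]
    rw [← ENNReal.ofReal_mul (by positivity)]
    rfl
  set T := tsupport φ
  have hT : MeasurableSet T := (isClosed_tsupport φ).measurableSet
  have hTv : volume T < ⊤ := IsCompact.measure_lt_top hc
  -- The integrand vanishes unless one of the two points lies in the support, so two indicators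
  -- suffice; by Tonelli and translation invariance each contributes `volume T * ∫ g`.
  have hbound : ∀ z : E n × E n, ‖φ z.1 - φ z.2‖ₑ ^ p * kern p s (z.1 - z.2) ≤
      T.indicator 1 z.1 * g (z.1 - z.2) + T.indicator 1 z.2 * g (z.1 - z.2) := by
    intro z
    have h1 : ‖φ z.1 - φ z.2‖ₑ ^ p * kern p s (z.1 - z.2) ≤ g (z.1 - z.2) := by
      rw [hg]
      dsimp only
      gcongr
      rw [enorm_rpow_eq hp0.le]
      refine ENNReal.ofReal_le_ofReal (Real.rpow_le_rpow (abs_nonneg _) (le_min ?_ ?_) hp0.le)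
      · have := hL.dist_le_mul z.1 z.2
        rwa [Real.dist_eq, dist_eq_norm] at this
      · have h1 := hK z.1
        have h2 := hK z.2
        have := norm_sub_le (φ z.1) (φ z.2)
        rw [Real.norm_eq_abs (φ z.1 - φ z.2)] at this
        linarith
    by_cases hz1 : z.1 ∈ T
    · simp only [hz1, indicator_of_mem, Pi.one_apply, one_mul]
      exact h1.trans le_self_add
    · by_cases hz2 : z.2 ∈ T
      · simp only [hz2, indicator_of_mem, Pi.one_apply, one_mul]
        exact h1.trans le_add_self
      · rw [image_eq_zero_of_notMem_tsupport hz1, image_eq_zero_of_notMem_tsupport hz2]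
        simp [ENNReal.zero_rpow_of_pos hp0]
  have e1 : ∫⁻ z : E n × E n, T.indicator 1 z.1 * g (z.1 - z.2) = volume T * (∫⁻ z, g z) := by
    have hm : Measurable fun z : E n × E n => T.indicator (1 : E n → ℝ≥0∞) z.1 * g (z.1 - z.2) :=
      ((measurable_one.indicator hT).comp measurable_fst).mul
        (hgm.comp (measurable_fst.sub measurable_snd))
    rw [Measure.volume_eq_prod, lintegral_prod _ hm.aemeasurable]
    have h (x : E n) : ∫⁻ y, T.indicator 1 x * g (x - y) = T.indicator 1 x * ∫⁻ z, g z := by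
      rw [lintegral_const_mul _ (by fun_prop),
        lintegral_sub_left_eq_self g x]
    simp_rw [h]
    rw [lintegral_mul_const _ (measurable_one.indicator hT), lintegral_indicator_one hT]
  have e2 : ∫⁻ z : E n × E n, T.indicator 1 z.2 * g (z.1 - z.2) = volume T * (∫⁻ z, g z) := by
    have hm : Measurable fun z : E n × E n => T.indicator (1 : E n → ℝ≥0∞) z.2 * g (z.1 - z.2) :=
      ((measurable_one.indicator hT).comp measurable_snd).mul
        (hgm.comp (measurable_fst.sub measurable_snd))
    rw [Measure.volume_eq_prod, lintegral_prod_symm _ hm.aemeasurable]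
    have h (y : E n) : ∫⁻ x, T.indicator 1 y * g (x - y) = T.indicator 1 y * ∫⁻ z, g z := by
      rw [lintegral_const_mul _ (by fun_prop),
        lintegral_sub_right_eq_self g y]
    simp_rw [h]
    rw [lintegral_mul_const _ (measurable_one.indicator hT), lintegral_indicator_one hT]
  calc gag p s φ ≤ ∫⁻ z : E n × E n,
        (T.indicator 1 z.1 * g (z.1 - z.2) + T.indicator 1 z.2 * g (z.1 - z.2)) :=
        lintegral_mono hbound
    _ = volume T * (∫⁻ z, g z) + volume T * (∫⁻ z, g z) := by
        rw [lintegral_add_left, e1, e2]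
        exact ((measurable_one.indicator hT).comp measurable_fst).mul
          (hgm.comp (measurable_fst.sub measurable_snd))
    _ < ⊤ := by
        have := ENNReal.mul_lt_top hTv hκ
        exact ENNReal.add_lt_top.2 ⟨this, this⟩

lemma IsTest.aestronglyMeasurable {φ : E n → ℝ} (h : IsTest Ω φ) :
    AEStronglyMeasurable φ volume := h.1.continuous.aestronglyMeasurable

lemma IsTest.gag_lt_top (hn : 0 < n) (hs0 : 0 < s) (hs1 : s < 1) (hp : 1 ≤ p) {φ : E n → ℝ}
    (h : IsTest Ω φ) : gag p s φ < ⊤ := by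
  obtain ⟨L, hL⟩ := (h.1.of_le (by exact_mod_cast le_top)).lipschitzWith_of_hasCompactSupport h.2.1 one_ne_zero
  exact gag_lt_top_of_lipschitz hn hs0 hs1 hp hL h.2.1

lemma pint_lt_top_iff (hm : 0 < m) {u : E n → ℝ} :
    pint m u < ⊤ ↔ eLpNorm u (ENNReal.ofReal m) volume < ⊤ := by
  rw [pint_eq_eLpNorm_rpow hm]
  exact ENNReal.rpow_lt_top_iff_of_pos hm

lemma IsTest.pint_lt_top (hm : 0 < m) {φ : E n → ℝ} (h : IsTest Ω φ) : pint m φ < ⊤ :=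
  (pint_lt_top_iff hm).2 (h.1.continuous.memLp_of_hasCompactSupport h.2.1).2

lemma IsTest.add {φ ψ : E n → ℝ} (h : IsTest Ω φ) (h' : IsTest Ω ψ) : IsTest Ω (φ + ψ) :=
  ⟨h.1.add h'.1, h.2.1.add h'.2.1,
    (tsupport_add φ ψ).trans (union_subset h.2.2 h'.2.2)⟩

lemma IsTest.smul {φ : E n → ℝ} (c : ℝ) (h : IsTest Ω φ) : IsTest Ω (c • φ) :=
  ⟨contDiff_const.smul h.1, h.2.1.smul_left (f := fun _ => c),
    (tsupport_smul_subset_right (fun _ => c) φ).trans h.2.2⟩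

lemma IsTest.eq_zero {φ : E n → ℝ} (h : IsTest Ω φ) {x : E n} (hx : x ∉ Ω) : φ x = 0 :=
  image_eq_zero_of_notMem_tsupport fun hx' => hx (h.2.2 hx')

lemma two_rpow_ne_top (hp : 1 ≤ p) : (2 : ℝ≥0∞) ^ (p - 1) ≠ ⊤ :=
  ENNReal.rpow_ne_top_of_nonneg (by linarith) (by simp)

lemma exists_mul_le {C ε : ℝ≥0∞} (hC : C ≠ ⊤) (hε : 0 < ε) : ∃ δ : ℝ≥0∞, 0 < δ ∧ C * δ ≤ ε := by
  refine ⟨ε / (C + 1), ENNReal.div_pos hε.ne' (by simp [hC]), ?_⟩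
  calc C * (ε / (C + 1)) ≤ (C + 1) * (ε / (C + 1)) := by gcongr; exact le_self_add
    _ ≤ ε := ENNReal.mul_div_le

namespace Adm

lemma of_isTest (hp : 0 < p) {φ : E n → ℝ} (h : IsTest Ω φ) : φ ∈ Adm Ω p s := by
  refine ⟨h.aestronglyMeasurable, .of_forall fun x hx => h.eq_zero hx, fun ε hε => ⟨φ, h, ?_⟩⟩
  simp [pint, gag, ENNReal.zero_rpow_of_pos hp]

lemma add (hp : 1 ≤ p) {u v : E n → ℝ} (hu : u ∈ Adm Ω p s) (hv : v ∈ Adm Ω p s) :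
    u + v ∈ Adm Ω p s := by
  refine ⟨hu.1.add hv.1, ?_, fun ε hε => ?_⟩
  · filter_upwards [hu.2.1, hv.2.1] with x h1 h2 hx
    simp [h1 hx, h2 hx]
  · obtain ⟨δ, hδ, hδε⟩ := exists_mul_le (C := 2 ^ (p - 1) * 2)
      (ENNReal.mul_ne_top (two_rpow_ne_top hp) (by simp)) hε
    obtain ⟨φ, hφ, h1⟩ := hu.2.2 δ hδ
    obtain ⟨ψ, hψ, h2⟩ := hv.2.2 δ hδ
    refine ⟨φ + ψ, hφ.add hψ, ?_⟩
    have e : u + v - (φ + ψ) = (u - φ) + (v - ψ) := by abel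
    have hm := hu.1.sub hφ.aestronglyMeasurable
    rw [e]
    calc _ ≤ _ := add_le_add (pint_add_le hp hm) (gag_add_le hp hm)
      _ = 2 ^ (p - 1) * ((pint p (u - φ) + gag p s (u - φ))
          + (pint p (v - ψ) + gag p s (v - ψ))) := by ring
      _ ≤ 2 ^ (p - 1) * (δ + δ) := by gcongr
      _ = 2 ^ (p - 1) * 2 * δ := by ring
      _ ≤ ε := hδε

lemma smul (hp : 0 ≤ p) {u : E n → ℝ} (c : ℝ) (hu : u ∈ Adm Ω p s) : c • u ∈ Adm Ω p s := by
  refine ⟨hu.1.const_smul c, ?_, fun ε hε => ?_⟩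
  · filter_upwards [hu.2.1] with x h1 hx
    simp [h1 hx]
  · obtain ⟨δ, hδ, hδε⟩ := exists_mul_le (C := ‖c‖ₑ ^ p)
      (ENNReal.rpow_ne_top_of_nonneg hp (by simp)) hε
    obtain ⟨φ, hφ, h1⟩ := hu.2.2 δ hδ
    refine ⟨c • φ, hφ.smul c, ?_⟩
    rw [← smul_sub, pint_smul hp, gag_smul hp, ← mul_add]
    exact (mul_le_mul_right h1 _).trans hδε

lemma sub (hp : 1 ≤ p) {u v : E n → ℝ} (hu : u ∈ Adm Ω p s) (hv : v ∈ Adm Ω p s) :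
    u - v ∈ Adm Ω p s := by
  have := Adm.add hp hu (Adm.smul (by linarith) (-1) hv)
  rwa [neg_one_smul, ← sub_eq_add_neg] at this

/-- Finiteness is not part of the definition of `Adm`; it holds because `u` is at finite distance
from some test function. -/
lemma add_lt_top (hn : 0 < n) (hs0 : 0 < s) (hs1 : s < 1) (hp : 1 ≤ p) {u : E n → ℝ}
    (hu : u ∈ Adm Ω p s) : pint p u + gag p s u < ⊤ := by
  obtain ⟨φ, hφ, h⟩ := hu.2.2 1 one_pos
  have hm := hu.1.sub hφ.aestronglyMeasurable
  have e : u = (u - φ) + φ := by abel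
  have h1 : pint p (u - φ) < ⊤ := (le_self_add.trans h).trans_lt ENNReal.one_lt_top
  have h2 : gag p s (u - φ) < ⊤ := (le_add_self.trans h).trans_lt ENNReal.one_lt_top
  have h3 := hφ.gag_lt_top hn hs0 hs1 hp
  have h4 := hφ.pint_lt_top (m := p) (by linarith)
  have h5 := pint_add_le (v := φ) hp hm
  have h6 := gag_add_le (s := s) (v := φ) hp hm
  rw [← e] at h5 h6
  have h2' := (two_rpow_ne_top hp).lt_top
  refine (add_le_add h5 h6).trans_lt (ENNReal.add_lt_top.2 ⟨?_, ?_⟩)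
  · exact ENNReal.mul_lt_top h2' (ENNReal.add_lt_top.2 ⟨h1, h4⟩)
  · exact ENNReal.mul_lt_top h2' (ENNReal.add_lt_top.2 ⟨h2, h3⟩)

lemma gag_lt_top (hn : 0 < n) (hs0 : 0 < s) (hs1 : s < 1) (hp : 1 ≤ p) {u : E n → ℝ}
    (hu : u ∈ Adm Ω p s) : gag p s u < ⊤ :=
  le_add_self.trans_lt (Adm.add_lt_top hn hs0 hs1 hp hu)

lemma pint_lt_top (hn : 0 < n) (hs0 : 0 < s) (hs1 : s < 1) (hp : 1 ≤ p) {u : E n → ℝ}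
    (hu : u ∈ Adm Ω p s) : pint p u < ⊤ :=
  le_self_add.trans_lt (Adm.add_lt_top hn hs0 hs1 hp hu)

end Adm

end

/-! ### Identification of `X0` with `Adm`. -/

section

variable {n : ℕ} {p s m : ℝ} {Ω : Set (E n)}

lemma ofReal_abs_rpow_div (hp : 0 ≤ p) (x : ℝ) (z : E n) :
    ENNReal.ofReal (|x| ^ p / ‖z‖ ^ ((n : ℝ) + p * s)) = ‖x‖ₑ ^ p * kern p s z := by
  rw [enorm_rpow_eq hp, kern, ← ENNReal.ofReal_mul (by positivity), Real.rpow_neg (norm_nonneg _),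
    div_eq_mul_inv]

lemma enorm_div_rpow (hp : 0 < p) (x : ℝ) (z : E n) :
    ‖x / ‖z‖ ^ ((n : ℝ) / p + s)‖ₑ ^ p = ‖x‖ₑ ^ p * kern p s z := by
  rw [← ofReal_abs_rpow_div hp.le, enorm_rpow_eq hp.le, abs_div,
    Real.div_rpow (abs_nonneg _) (abs_nonneg _), abs_of_nonneg (a := ‖z‖ ^ _) (by positivity),
    ← Real.rpow_mul (norm_nonneg _)]
  congr 3
  field_simp

lemma integral_gag (hp : 0 ≤ p) {u : E n → ℝ} (hu : AEStronglyMeasurable u volume)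
    (A : Set (E n × E n)) :
    ∫ z in A, |u z.1 - u z.2| ^ p / ‖z.1 - z.2‖ ^ ((n : ℝ) + p * s)
      = (∫⁻ z in A, ‖u z.1 - u z.2‖ₑ ^ p * kern p s (z.1 - z.2)).toReal := by
  rw [integral_eq_lintegral_of_nonneg_ae (.of_forall fun z => by positivity)]
  · simp_rw [ofReal_abs_rpow_div hp]
  · have h1 := (aemeasurable_diff hu).restrict (s := A)
    have h2 : Measurable fun z : E n × E n => ‖z.1 - z.2‖ ^ ((n : ℝ) + p * s) := by fun_prop
    exact ((continuous_abs.measurable.comp_aemeasurable h1).pow_const p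
      |>.div h2.aemeasurable).aestronglyMeasurable

lemma integral_abs_rpow {α : Type*} [MeasurableSpace α] {μ : Measure α} (hp : 0 ≤ p) {u : α → ℝ}
    (hu : AEStronglyMeasurable u μ) :
    ∫ x, |u x| ^ p ∂μ = (∫⁻ x, ‖u x‖ₑ ^ p ∂μ).toReal := by
  rw [integral_eq_lintegral_of_nonneg_ae (.of_forall fun z => by positivity)]
  · simp_rw [enorm_rpow_eq hp]
  · exact ((continuous_abs.measurable.comp_aemeasurable hu.aemeasurable).pow_const
      p).aestronglyMeasurable

lemma memLp_iff_lintegral {α : Type*} [MeasurableSpace α] {μ : Measure α} (hp : 0 < p) {u : α → ℝ}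
    (hu : AEStronglyMeasurable u μ) :
    MemLp u (ENNReal.ofReal p) μ ↔ ∫⁻ x, ‖u x‖ₑ ^ p ∂μ < ⊤ := by
  have := eLpNorm_lt_top_iff_lintegral_rpow_enorm_lt_top (f := u) (μ := μ)
    (p := ENNReal.ofReal p) (by simpa using hp) (by simp)
  rw [ENNReal.toReal_ofReal hp.le] at this
  rw [← this]
  exact ⟨fun h => h.2, fun h => ⟨hu, h⟩⟩

lemma memX_iff (hp : 0 < p) {u : E n → ℝ} (hu : AEStronglyMeasurable u volume) :
    MemX Ω p s u ↔ ∫⁻ x in Ω, ‖u x‖ₑ ^ p < ⊤ ∧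
      ∫⁻ z in Q Ω, ‖u z.1 - u z.2‖ₑ ^ p * kern p s (z.1 - z.2) < ⊤ := by
  have h2 : Measurable fun z : E n × E n => ‖z.1 - z.2‖ ^ ((n : ℝ) / p + s) := by fun_prop
  have hm : AEStronglyMeasurable (fun z : E n × E n =>
      (u z.1 - u z.2) / ‖z.1 - z.2‖ ^ ((n : ℝ) / p + s)) (volume.restrict (Q Ω)) :=
    ((aemeasurable_diff hu).div h2.aemeasurable).aestronglyMeasurable.restrict
  rw [MemX, memLp_iff_lintegral hp hu.restrict, memLp_iff_lintegral hp hm]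
  simp_rw [enorm_div_rpow hp]
  exact ⟨fun h => h.2, fun h => ⟨hu, h⟩⟩

lemma setLIntegral_eq_pint (hΩ : MeasurableSet Ω) (hm : 0 < m) {u : E n → ℝ}
    (hu : ∀ᵐ x, x ∉ Ω → u x = 0) : ∫⁻ x in Ω, ‖u x‖ₑ ^ m = pint m u := by
  rw [pint, ← lintegral_indicator hΩ]
  refine lintegral_congr_ae ?_
  filter_upwards [hu] with x hx
  by_cases h : x ∈ Ω
  · simp [h]
  · simp [h, hx h, ENNReal.zero_rpow_of_pos hm]

lemma measurableSet_Q (hΩ : MeasurableSet Ω) : MeasurableSet (Q Ω) :=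
  (hΩ.compl.prod hΩ.compl).compl

lemma setLIntegral_Q_eq_gag (hΩ : MeasurableSet Ω) (hp : 0 < p) {u : E n → ℝ}
    (hu : ∀ᵐ x, x ∉ Ω → u x = 0) :
    ∫⁻ z in Q Ω, ‖u z.1 - u z.2‖ₑ ^ p * kern p s (z.1 - z.2) = gag p s u := by
  rw [gag, ← lintegral_indicator (measurableSet_Q hΩ)]
  refine lintegral_congr_ae ?_
  filter_upwards [ae_prod_of_ae hu] with z hz
  by_cases h : z ∈ Q Ω
  · simp [h]
  · have h' : z.1 ∉ Ω ∧ z.2 ∉ Ω := by simpa [Q] using h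
    simp [h, hz.1 h'.1, hz.2 h'.2, ENNReal.zero_rpow_of_pos hp]

/-- The real-valued `normX` reads a divergent integral as zero, so its smallness alone proves
nothing. Both integrals of `u - φ` are shown to be finite first; then the inequality transfers to
the extended-real integrals. -/
lemma exists_test_le (hn : 0 < n) (hs0 : 0 < s) (hs1 : s < 1) (hp : 1 ≤ p) {u : E n → ℝ}
    (hu : u ∈ X0 Ω p s) {ε : ℝ≥0∞} (hε : 0 < ε) :
    ∃ φ, IsTest Ω φ ∧ (∫⁻ x in Ω, ‖u x - φ x‖ₑ ^ p) +
      ∫⁻ z in Q Ω, ‖(u - φ) z.1 - (u - φ) z.2‖ₑ ^ p * kern p s (z.1 - z.2) ≤ ε := by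
  have hp0 : 0 < p := by linarith
  wlog hε' : ε ≠ ⊤ generalizing ε
  · obtain ⟨φ, h1, h2⟩ := this one_pos (by simp)
    exact ⟨φ, h1, h2.trans (by simp [not_not.1 hε'])⟩
  have hpos : 0 < ε.toReal := ENNReal.toReal_pos hε.ne' hε'
  obtain ⟨φ, hφ, h⟩ := hu.2 (ε.toReal ^ (1 / p)) (by positivity)
  refine ⟨φ, hφ, ?_⟩
  have hum := hu.1.1
  have hm := hum.sub hφ.aestronglyMeasurable
  obtain ⟨hu1, hu2⟩ := (memX_iff hp0 hum).1 hu.1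
  have h2' := (two_rpow_ne_top hp).lt_top
  have hf1 : (∫⁻ x in Ω, ‖u x - φ x‖ₑ ^ p) < ⊤ := by
    refine (lintegral_mono (g := fun x => 2 ^ (p - 1) * (‖u x‖ₑ ^ p + ‖φ x‖ₑ ^ p))
      fun x => ?_).trans_lt ?_
    · have := enorm_add_rpow_le hp (u x) (-φ x)
      rwa [enorm_neg, ← sub_eq_add_neg] at this
    · rw [lintegral_const_mul' _ _ h2'.ne, lintegral_add_left' (hum.restrict.enorm.pow_const p)]
      refine ENNReal.mul_lt_top h2' (ENNReal.add_lt_top.2 ⟨hu1, ?_⟩)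
      exact (setLIntegral_le_lintegral _ _).trans_lt (hφ.pint_lt_top hp0)
  have hf2 : ∫⁻ z in Q Ω, ‖(u - φ) z.1 - (u - φ) z.2‖ₑ ^ p * kern p s (z.1 - z.2) < ⊤ := by
    refine (lintegral_mono (g := fun z => 2 ^ (p - 1) *
      (‖u z.1 - u z.2‖ₑ ^ p * kern p s (z.1 - z.2)
        + ‖φ z.1 - φ z.2‖ₑ ^ p * kern p s (z.1 - z.2))) fun z => ?_).trans_lt ?_
    · have := enorm_add_rpow_le hp (u z.1 - u z.2) (-(φ z.1 - φ z.2))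
      rw [enorm_neg] at this
      dsimp only
      rw [← add_mul, ← mul_assoc]
      gcongr
      refine le_trans (le_of_eq ?_) this
      simp only [Pi.sub_apply]
      congr 2
      ring
    · rw [lintegral_const_mul' _ _ h2'.ne, lintegral_add_left' (aemeasurable_gag hum).restrict]
      refine ENNReal.mul_lt_top h2' (ENNReal.add_lt_top.2 ⟨hu2, ?_⟩)
      exact (setLIntegral_le_lintegral _ _).trans_lt (hφ.gag_lt_top hn hs0 hs1 hp)
  rw [normX, integral_gag hp0.le hm, integral_abs_rpow hp0.le hm.restrict,
    Real.rpow_lt_rpow_iff (by positivity) hpos.le (by positivity),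
    ← ENNReal.toReal_add (by exact hf1.ne) hf2.ne] at h
  exact ((ENNReal.toReal_lt_toReal (ENNReal.add_lt_top.2 ⟨hf1, hf2⟩).ne hε').1 h).le

/-- Elements of `X₀` vanish almost everywhere outside `Ω`. -/
lemma X0_ae_eq_zero (hn : 0 < n) (hs0 : 0 < s) (hs1 : s < 1) (hp : 1 ≤ p) (hΩo : IsOpen Ω)
    (hΩn : Ω.Nonempty) (hΩb : Bornology.IsBounded Ω) {u : E n → ℝ} (hu : u ∈ X0 Ω p s) :
    ∀ᵐ x, x ∉ Ω → u x = 0 := by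
  have hp0 : 0 < p := by linarith
  have hum := hu.1.1
  have hΩm := hΩo.measurableSet
  obtain ⟨R₀, hR₀⟩ := hΩb.subset_ball 0
  -- The exterior is exhausted by bounded pieces, so that the kernel is bounded below on `Ω` times a
  -- piece. The maximum with `R₀` keeps `Ω` inside the same ball.
  suffices H : ∀ k : ℕ, ∀ᵐ x, x ∈ Ωᶜ ∩ Metric.ball 0 (max R₀ k) → u x = 0 by
    filter_upwards [ae_all_iff.2 H] with x hx hxΩ
    obtain ⟨k, hk⟩ := exists_nat_gt ‖x‖
    exact hx k ⟨hxΩ, by simpa using Or.inr hk⟩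
  intro k
  set R := max R₀ k with hR
  set D := Ωᶜ ∩ Metric.ball (0 : E n) R with hD
  have hDm : MeasurableSet D := hΩm.compl.inter measurableSet_ball
  have hDv : volume D < ⊤ := (measure_mono inter_subset_right).trans_lt measure_ball_lt_top
  have hR0 : 0 < R := by
    obtain ⟨x, hx⟩ := hΩn
    have := hR₀ hx
    rw [mem_ball_zero_iff] at this
    exact (norm_nonneg x).trans_lt (this.trans_le (le_max_left _ _))
  set c : ℝ≥0∞ := ENNReal.ofReal ((2 * R) ^ (-((n : ℝ) + p * s))) with hc
  have hc0 : c ≠ 0 := by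
    rw [hc]
    simp only [ne_eq, ENNReal.ofReal_eq_zero, not_le]
    positivity
  have hkern : ∀ z ∈ Ω ×ˢ D, c ≤ kern p s (z.1 - z.2) := by
    rintro ⟨x, y⟩ ⟨hx, hy⟩
    have hxy : 0 < ‖x - y‖ := by
      rw [norm_pos_iff, sub_ne_zero]
      rintro rfl
      exact hy.1 hx
    refine ENNReal.ofReal_le_ofReal (Real.rpow_le_rpow_of_nonpos hxy ?_ ?_)
    · have h1 : ‖x‖ < R₀ := by simpa using hR₀ hx
      have h2 : ‖y‖ < R := by simpa using hy.2
      have := norm_sub_le x y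
      have := le_max_left R₀ (k : ℝ)
      linarith
    · have : 0 < p * s := by positivity
      have : (0 : ℝ) ≤ n := by positivity
      linarith
  have hprod : (volume : Measure (E n × E n)).restrict (Ω ×ˢ D)
      = (volume.restrict Ω).prod (volume.restrict D) := by
    rw [Measure.volume_eq_prod, Measure.prod_restrict]
  set C : ℝ≥0∞ := 2 ^ (p - 1) * (c⁻¹ + volume D) with hC
  have hCt : C ≠ ⊤ := ENNReal.mul_ne_top (two_rpow_ne_top hp)
    (ENNReal.add_ne_top.2 ⟨ENNReal.inv_ne_top.2 hc0, hDv.ne⟩)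
  -- For `x ∈ Ω` and `y ∈ D` one has `φ y = 0`, so `u y` is the value of `u - φ` at `x` minus its
  -- increment from `y` to `x`. Integrating over `Ω ×ˢ D ⊆ Q Ω` bounds the left side by the distance
  -- to `φ` in `X`, which can be made arbitrarily small.
  have key : ∀ φ, IsTest Ω φ → volume Ω * ∫⁻ y in D, ‖u y‖ₑ ^ p ≤ C *
      ((∫⁻ x in Ω, ‖u x - φ x‖ₑ ^ p) +
      ∫⁻ z in Q Ω, ‖(u - φ) z.1 - (u - φ) z.2‖ₑ ^ p * kern p s (z.1 - z.2)) := by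
    intro φ hφ
    have hm := hum.sub hφ.aestronglyMeasurable
    have hg1 : AEMeasurable (fun z : E n × E n => ‖(u - φ) z.1 - (u - φ) z.2‖ₑ ^ p)
        (volume.restrict (Ω ×ˢ D)) := ((aemeasurable_diff hm).enorm.pow_const p).restrict
    have e1 : volume Ω * ∫⁻ y in D, ‖u y‖ₑ ^ p = ∫⁻ z in Ω ×ˢ D, ‖u z.2‖ₑ ^ p := by
      rw [hprod, lintegral_prod_symm]
      · simp only [lintegral_const, Measure.restrict_apply_univ]
        rw [lintegral_mul_const'' _ (hum.restrict.enorm.pow_const p), mul_comm]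
      · exact (hum.restrict.aemeasurable.comp_snd).enorm.pow_const p
    have e2 : ∫⁻ z in Ω ×ˢ D, ‖(u - φ) z.1‖ₑ ^ p = volume D * (∫⁻ x in Ω, ‖u x - φ x‖ₑ ^ p) := by
      rw [hprod, lintegral_prod]
      · simp only [lintegral_const, Measure.restrict_apply_univ]
        rw [lintegral_mul_const'' _ (hm.restrict.enorm.pow_const p), mul_comm]
        rfl
      · exact (hm.restrict.aemeasurable.comp_fst).enorm.pow_const p
    have hsub : Ω ×ˢ D ⊆ Q Ω := by
      rintro ⟨x, y⟩ ⟨hx, -⟩ ⟨hx', -⟩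
      exact hx' hx
    rw [e1]
    calc ∫⁻ z in Ω ×ˢ D, ‖u z.2‖ₑ ^ p
        ≤ ∫⁻ z in Ω ×ˢ D, 2 ^ (p - 1) *
          (‖(u - φ) z.1 - (u - φ) z.2‖ₑ ^ p + ‖(u - φ) z.1‖ₑ ^ p) := by
          refine setLIntegral_mono' (hΩm.prod hDm) fun z hz => ?_
          have h0 : φ z.2 = 0 := hφ.eq_zero hz.2.1
          have := enorm_add_rpow_le hp (-((u - φ) z.1 - (u - φ) z.2)) ((u - φ) z.1)
          rw [enorm_neg] at this
          refine le_trans (le_of_eq ?_) this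
          simp only [Pi.sub_apply, h0]
          congr 2
          ring
      _ = 2 ^ (p - 1) * ((∫⁻ z in Ω ×ˢ D, ‖(u - φ) z.1 - (u - φ) z.2‖ₑ ^ p)
          + volume D * (∫⁻ x in Ω, ‖u x - φ x‖ₑ ^ p)) := by
          rw [lintegral_const_mul' _ _ (two_rpow_ne_top hp), lintegral_add_left' hg1, e2]
      _ ≤ 2 ^ (p - 1) * (c⁻¹ * (∫⁻ z in Q Ω, ‖(u - φ) z.1 - (u - φ) z.2‖ₑ ^ p *
          kern p s (z.1 - z.2)) + volume D * (∫⁻ x in Ω, ‖u x - φ x‖ₑ ^ p)) := by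
          gcongr
          rw [← lintegral_const_mul' _ _ (ENNReal.inv_ne_top.2 hc0)]
          refine le_trans ?_ (lintegral_mono_set hsub)
          refine setLIntegral_mono' (hΩm.prod hDm) fun z hz => ?_
          calc ‖(u - φ) z.1 - (u - φ) z.2‖ₑ ^ p
              = c⁻¹ * (‖(u - φ) z.1 - (u - φ) z.2‖ₑ ^ p * c) := by
                rw [mul_comm, mul_assoc, ENNReal.mul_inv_cancel hc0 ENNReal.ofReal_ne_top, mul_one]
            _ ≤ _ := by
                gcongr
                exact hkern z hz
      _ ≤ C * _ := by
          rw [hC, mul_assoc, add_mul, mul_add, add_comm (∫⁻ x in Ω, ‖u x - φ x‖ₑ ^ p), mul_add]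
          gcongr
          · exact le_self_add
          · exact le_add_self
  have hzero : volume Ω * ∫⁻ y in D, ‖u y‖ₑ ^ p = 0 := by
    refine le_antisymm (le_of_forall_pos_le_add fun ε hε => ?_) zero_le
    obtain ⟨δ, hδ, hδε⟩ := exists_mul_le hCt hε
    obtain ⟨φ, hφ, h⟩ := exists_test_le hn hs0 hs1 hp hu hδ
    rw [zero_add]
    exact (key φ hφ).trans ((by gcongr : _ ≤ C * δ).trans hδε)
  have hz2 : ∫⁻ y in D, ‖u y‖ₑ ^ p = 0 :=
    (mul_eq_zero.1 hzero).resolve_left (hΩo.measure_pos volume hΩn).ne'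
  rw [lintegral_eq_zero_iff' (hum.restrict.enorm.pow_const p)] at hz2
  have := (ae_restrict_iff' hDm).1 hz2
  filter_upwards [this] with x hx hxD
  simpa [ENNReal.rpow_eq_zero_iff_of_pos hp0] using hx hxD

/-- For functions vanishing outside `Ω` the integrals over `Ω` and `Q Ω` are integrals over the
whole space, so the two approximation conditions differ only by a `p`-th root. -/
lemma X0_eq_adm (hn : 0 < n) (hs0 : 0 < s) (hs1 : s < 1) (hp : 1 ≤ p) (hΩo : IsOpen Ω)
    (hΩn : Ω.Nonempty) (hΩb : Bornology.IsBounded Ω) : X0 Ω p s = Adm Ω p s := by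
  have hp0 : 0 < p := by linarith
  have hΩm := hΩo.measurableSet
  ext u
  constructor
  · intro hu
    have h0 := X0_ae_eq_zero hn hs0 hs1 hp hΩo hΩn hΩb hu
    refine ⟨hu.1.1, h0, fun ε hε => ?_⟩
    obtain ⟨φ, hφ, h⟩ := exists_test_le hn hs0 hs1 hp hu hε
    refine ⟨φ, hφ, ?_⟩
    have h0' : ∀ᵐ x, x ∉ Ω → (u - φ) x = 0 := by
      filter_upwards [h0] with x hx hxΩ
      simp [hx hxΩ, hφ.eq_zero hxΩ]
    rwa [← setLIntegral_eq_pint hΩm hp0 h0', ← setLIntegral_Q_eq_gag hΩm hp0 h0']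
  · intro hu
    have hlt := Adm.add_lt_top hn hs0 hs1 hp hu
    refine ⟨(memX_iff hp0 hu.1).2 ?_, fun ε hε => ?_⟩
    · rw [setLIntegral_eq_pint hΩm hp0 hu.2.1, setLIntegral_Q_eq_gag hΩm hp0 hu.2.1]
      exact ENNReal.add_lt_top.1 hlt
    · obtain ⟨φ, hφ, h⟩ := hu.2.2 (ENNReal.ofReal ((ε / 2) ^ p)) (by
        rw [ENNReal.ofReal_pos]; positivity)
      refine ⟨φ, hφ, ?_⟩
      have h0' := (Adm.sub hp hu (Adm.of_isTest hp0 hφ)).2.1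
      have hm := hu.1.sub hφ.aestronglyMeasurable
      have hlt := Adm.add_lt_top hn hs0 hs1 hp (Adm.sub hp hu (Adm.of_isTest hp0 hφ))
      rw [normX, integral_gag hp0.le hm, integral_abs_rpow hp0.le hm.restrict,
        setLIntegral_eq_pint hΩm hp0 h0', setLIntegral_Q_eq_gag hΩm hp0 h0',
        ← ENNReal.toReal_add (ENNReal.add_lt_top.1 hlt).1.ne (ENNReal.add_lt_top.1 hlt).2.ne]
      have h1 := ENNReal.toReal_mono ENNReal.ofReal_ne_top h
      rw [ENNReal.toReal_ofReal (by positivity)] at h1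
      calc _ ≤ ((ε / 2) ^ p) ^ (1 / p) := by gcongr
        _ = ε / 2 := by rw [← Real.rpow_mul (by positivity), mul_one_div_cancel hp0.ne',
            Real.rpow_one]
        _ < ε := by linarith

lemma normX0_rpow (hp : 0 < p) (hΩ : MeasurableSet Ω) {u : E n → ℝ} (hu : u ∈ Adm Ω p s) :
    normX0 Ω p s u ^ p = (gag p s u).toReal := by
  rw [normX0, integral_gag hp.le hu.1, setLIntegral_Q_eq_gag hΩ hp hu.2.1,
    ← Real.rpow_mul (by positivity), one_div_mul_cancel hp.ne', Real.rpow_one]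

end

/-! ### The fractional Sobolev inequality. -/

section

variable {n : ℕ} {p s m : ℝ} {Ω : Set (E n)}

/-- The inner integral of the Gagliardo seminorm. -/
def gagAt (p s : ℝ) (u : E n → ℝ) (x : E n) : ℝ≥0∞ :=
  ∫⁻ y, ‖u x - u y‖ₑ ^ p * kern p s (x - y)

lemma lintegral_gagAt {u : E n → ℝ} (hu : AEStronglyMeasurable u volume) :
    ∫⁻ x, gagAt p s u x = gag p s u := by
  have h := aemeasurable_gag (p := p) (s := s) hu
  rw [Measure.volume_eq_prod] at h
  rw [gag, Measure.volume_eq_prod, lintegral_prod _ h]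
  rfl

lemma volume_ball_eq (x : E n) {h : ℝ} (hh : 0 < h) :
    volume (Metric.ball x h) = ENNReal.ofReal (volume.real (Metric.ball (0 : E n) 1) * h ^ n) := by
  rw [Measure.addHaar_ball_of_pos _ _ hh, Measure.real, ENNReal.ofReal_mul ENNReal.toReal_nonneg,
    ENNReal.ofReal_toReal measure_ball_lt_top.ne, mul_comm]
  simp

lemma volume_real_unitBall_pos : 0 < volume.real (Metric.ball (0 : E n) 1) :=
  ENNReal.toReal_pos (Metric.measure_ball_pos _ _ one_pos).ne' measure_ball_lt_top.ne

/-- The critical fractional Sobolev exponent. -/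
def critExp (n : ℕ) (p s : ℝ) : ℝ := n * p / (n - p * s)

lemma lt_critExp (hp : 0 < p) (hs0 : 0 < s) (hn : p * s < n) : p < critExp n p s := by
  have : 0 < p * s := by positivity
  rw [critExp, lt_div_iff₀ (by linarith)]
  nlinarith

/-- The scaling relation that makes the powers of `|u x|` match in the pointwise Sobolev bound
below. -/
lemma critExp_identity (hn : p * s < n) (hn0 : 0 < n) :
    p + critExp n p s * (p * s / n) = critExp n p s := by
  have h1 : (n : ℝ) - p * s ≠ 0 := by linarith
  have h2 : (n : ℝ) ≠ 0 := by positivity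
  rw [critExp]
  field_simp
  ring

/-- By Chebyshev, `|u|` can exceed `τ/2`, where `τ = |u x|`, only on a set of measure at most `2^P A
/ τ^P`, with `P` the critical exponent and `A = ∫|u|^P`. On at least half of a ball of twice that
measure around `x` the increment is therefore at least `τ/2`, and the kernel is bounded below by the
radius. This bounds `gagAt` below by a multiple of `τ^P A^(-ps/n)`. -/
lemma enorm_rpow_le_gagAt (hp : 0 < p) (hs0 : 0 < s) (hn : p * s < n) :
    ∃ C : ℝ, 0 < C ∧ ∀ u : E n → ℝ, AEStronglyMeasurable u volume →
      pint (critExp n p s) u ≠ 0 → pint (critExp n p s) u ≠ ⊤ → ∀ x,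
      ‖u x‖ₑ ^ critExp n p s ≤ ENNReal.ofReal (C * (pint (critExp n p s) u).toReal ^ (p * s / n))
        * gagAt p s u x := by
  have hps : 0 < p * s := by positivity
  have hn0 : (0 : ℝ) < n := by linarith
  have hn0' : 0 < n := by exact_mod_cast hn0
  set P := critExp n p s with hP
  have hpP : p < P := lt_critExp hp hs0 hn
  have hP0 : 0 < P := by linarith
  have hid : p + P * (p * s / n) = P := critExp_identity hn hn0'
  set ϖ := volume.real (Metric.ball (0 : E n) 1) with hϖ
  have hϖ0 : 0 < ϖ := volume_real_unitBall_pos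
  refine ⟨2 ^ p * 2 / ϖ * (2 ^ (P + 1) / ϖ) ^ (p * s / n), by positivity, ?_⟩
  intro u hu hA0 hAt x
  set A := (pint P u).toReal with hA
  have hApos : 0 < A := ENNReal.toReal_pos hA0 hAt
  have hAe : pint P u = ENNReal.ofReal A := (ENNReal.ofReal_toReal hAt).symm
  rcases eq_or_ne (u x) 0 with hx | hx
  · simp [hx, ENNReal.zero_rpow_of_pos hP0]
  set τ := |u x| with hτ
  have hτ0 : 0 < τ := abs_pos.2 hx
  -- The radius for which the ball has exactly twice the measure allowed to `Bd` by Chebyshev.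
  set h : ℝ := (2 ^ (P + 1) / ϖ * A / τ ^ P) ^ (1 / (n : ℝ)) with hh
  have hh0 : 0 < h := by positivity
  have hhn : h ^ n = 2 ^ (P + 1) / ϖ * A / τ ^ P := by
    rw [hh, ← Real.rpow_natCast, ← Real.rpow_mul (by positivity), one_div_mul_cancel hn0.ne',
      Real.rpow_one]
  have hhps : h ^ (-(p * s)) = (2 ^ (P + 1) / ϖ * A / τ ^ P) ^ (-(p * s / n)) := by
    rw [hh, ← Real.rpow_mul (by positivity)]
    congr 1
    field_simp
  set c : ℝ := (τ / 2) ^ p * h ^ (-((n : ℝ) + p * s)) with hc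
  set G := {y | ENNReal.ofReal c ≤ ‖u x - u y‖ₑ ^ p * kern p s (x - y)} with hG
  set Bd := {y | ENNReal.ofReal ((τ / 2) ^ P) ≤ ‖u y‖ₑ ^ P} with hBd
  have hsub : Metric.ball x h ⊆ G ∪ Bd := by
    intro y hy
    by_cases hy' : y ∈ Bd
    · exact Or.inr hy'
    · left
      simp only [hBd, mem_ofPred_eq, not_le] at hy'
      rw [enorm_rpow_eq hP0.le, ENNReal.ofReal_lt_ofReal_iff (by positivity),
        Real.rpow_lt_rpow_iff (abs_nonneg _) (by positivity) hP0] at hy'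
      have h1 : τ / 2 ≤ |u x - u y| := by
        have := abs_sub_abs_le_abs_sub (u x) (u y)
        linarith
      have hxy : 0 < ‖x - y‖ := by
        rw [norm_pos_iff, sub_ne_zero]
        rintro rfl
        simp only [sub_self, abs_zero] at h1
        linarith
      have h2 : ‖x - y‖ ≤ h := by
        rw [Metric.mem_ball, dist_comm, dist_eq_norm] at hy
        exact hy.le
      simp only [hG, mem_ofPred_eq]
      rw [enorm_rpow_eq hp.le, kern, ← ENNReal.ofReal_mul (by positivity)]
      refine ENNReal.ofReal_le_ofReal ?_
      rw [hc]
      gcongr ?_ * ?_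
      · gcongr
      · exact Real.rpow_le_rpow_of_nonpos hxy h2 (by linarith)
  have hbad : volume Bd ≤ ENNReal.ofReal (ϖ * h ^ n / 2) := by
    have h1 := mul_meas_ge_le_lintegral₀ (hu.enorm.pow_const P) (ENNReal.ofReal ((τ / 2) ^ P))
    have h3 : ENNReal.ofReal ((τ / 2) ^ P) ≠ 0 := by
      simp only [ne_eq, ENNReal.ofReal_eq_zero, not_le]; positivity
    have h2 : volume Bd ≤ ENNReal.ofReal A / ENNReal.ofReal ((τ / 2) ^ P) := by
      rw [ENNReal.le_div_iff_mul_le (Or.inl h3) (Or.inl ENNReal.ofReal_ne_top), mul_comm, ← hAe]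
      exact h1
    refine h2.trans (le_of_eq ?_)
    rw [← ENNReal.ofReal_div_of_pos (by positivity), hhn, Real.div_rpow hτ0.le (by norm_num),
      Real.rpow_add_one (by norm_num)]
    congr 1
    field_simp
  have hgood : ENNReal.ofReal (ϖ * h ^ n / 2) ≤ volume G := by
    have h1 : volume (Metric.ball x h) ≤ volume G + volume Bd :=
      (measure_mono hsub).trans (measure_union_le _ _)
    rw [volume_ball_eq x hh0, ← hϖ] at h1
    have h2 : ENNReal.ofReal (ϖ * h ^ n) =
        ENNReal.ofReal (ϖ * h ^ n / 2) + ENNReal.ofReal (ϖ * h ^ n / 2) := by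
      rw [← ENNReal.ofReal_add (by positivity) (by positivity)]
      congr 1
      ring
    rw [h2] at h1
    have h3 := h1.trans (add_le_add_right hbad _)
    exact (ENNReal.add_le_add_iff_right ENNReal.ofReal_ne_top).1 h3
  have hD : ENNReal.ofReal (c * (ϖ * h ^ n / 2)) ≤ gagAt p s u x := by
    have hm : AEMeasurable (fun y => ‖u x - u y‖ₑ ^ p * kern p s (x - y)) volume := by
      have h1 := (hu.aemeasurable.const_sub (u x)).enorm.pow_const p
      have h2 : Measurable fun y => kern p s (x - y) := by fun_prop
      exact h1.mul h2.aemeasurable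
    rw [ENNReal.ofReal_mul (by positivity)]
    exact (mul_le_mul_right hgood _).trans (mul_meas_ge_le_lintegral₀ hm _)
  have hreal : τ ^ P = 2 ^ p * 2 / ϖ * (2 ^ (P + 1) / ϖ) ^ (p * s / n) * A ^ (p * s / n)
      * (c * (ϖ * h ^ n / 2)) := by
    have e1 : c * (ϖ * h ^ n / 2) = ϖ / 2 * (τ / 2) ^ p * h ^ (-(p * s)) := by
      have : h ^ (-((n : ℝ) + p * s)) * h ^ n = h ^ (-(p * s)) := by
        rw [← Real.rpow_natCast, ← Real.rpow_add hh0]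
        congr 1
        ring
      rw [hc, ← this]
      ring
    have hκ0 : 0 < 2 ^ (P + 1) / ϖ := by positivity
    rw [e1, hhps]
    generalize 2 ^ (P + 1) / ϖ = κ at hκ0 ⊢
    rw [Real.rpow_neg (by positivity), Real.div_rpow (x := κ * A) (by positivity) (by positivity),
      Real.mul_rpow (by positivity) hApos.le, Real.div_rpow hτ0.le (by norm_num),
      ← Real.rpow_mul hτ0.le]
    conv_lhs => rw [← hid, Real.rpow_add hτ0]
    field_simp
  calc ‖u x‖ₑ ^ P = ENNReal.ofReal (2 ^ p * 2 / ϖ * (2 ^ (P + 1) / ϖ) ^ (p * s / n)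
        * A ^ (p * s / n)) * ENNReal.ofReal (c * (ϖ * h ^ n / 2)) := by
        rw [← ENNReal.ofReal_mul (by positivity), enorm_rpow_eq hP0.le, ← hreal]
    _ ≤ _ := by gcongr

/-- The fractional Sobolev inequality for functions that are a priori in `L^{p_s^*}`. -/
lemma sobolev_of_finite (hp : 0 < p) (hs0 : 0 < s) (hn : p * s < n) :
    ∃ C : ℝ≥0∞, C ≠ ⊤ ∧ ∀ u : E n → ℝ, AEStronglyMeasurable u volume →
      pint (critExp n p s) u ≠ ⊤ →
      pint (critExp n p s) u ≤ C * gag p s u ^ (critExp n p s / p) := by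
  have hps : 0 < p * s := by positivity
  have hn0 : (0 : ℝ) < n := by linarith
  have hn0' : 0 < n := by exact_mod_cast hn0
  obtain ⟨C, hC, H⟩ := enorm_rpow_le_gagAt hp hs0 hn
  set P := critExp n p s with hP
  have hpP : p < P := lt_critExp hp hs0 hn
  have hP0 : 0 < P := by linarith
  refine ⟨ENNReal.ofReal C ^ (P / p), ENNReal.rpow_ne_top_of_nonneg (by positivity)
    ENNReal.ofReal_ne_top, fun u hu hAt => ?_⟩
  rcases eq_or_ne (pint P u) 0 with hA0 | hA0
  · simp [hA0]
  set A := (pint P u).toReal with hA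
  have hApos : 0 < A := ENNReal.toReal_pos hA0 hAt
  have hAe : pint P u = ENNReal.ofReal A := (ENNReal.ofReal_toReal hAt).symm
  have h1 : pint P u ≤ ENNReal.ofReal (C * A ^ (p * s / n)) * gag p s u := by
    rw [← lintegral_gagAt hu, ← lintegral_const_mul' _ _ ENNReal.ofReal_ne_top]
    exact lintegral_mono (H u hu hA0 hAt)
  -- Cancelling `A^(ps/n)` is legitimate because `A` is positive and finite; the remaining exponent
  -- is `1 - ps/n = p/P`.
  have h2 : ENNReal.ofReal (A ^ (p / P)) ≤ ENNReal.ofReal C * gag p s u := by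
    have e : A = A ^ (p / P) * A ^ (p * s / n) := by
      rw [← Real.rpow_add hApos]
      conv_lhs => rw [← Real.rpow_one A]
      congr 1
      have := critExp_identity hn hn0'
      rw [← hP] at this
      field_simp
      field_simp at this
      linarith
    have h3 : ENNReal.ofReal (A ^ (p * s / n)) ≠ 0 := by
      simp only [ne_eq, ENNReal.ofReal_eq_zero, not_le]; positivity
    rw [← ENNReal.mul_le_mul_iff_left h3 ENNReal.ofReal_ne_top, ← ENNReal.ofReal_mul (by positivity),
      ← e, ← hAe]
    refine h1.trans (le_of_eq ?_)
    rw [ENNReal.ofReal_mul hC.le]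
    ring
  calc pint P u = ENNReal.ofReal (A ^ (p / P)) ^ (P / p) := by
        rw [hAe, ENNReal.ofReal_rpow_of_nonneg (by positivity) (by positivity),
          ← Real.rpow_mul hApos.le]
        field_simp
        simp
    _ ≤ (ENNReal.ofReal C * gag p s u) ^ (P / p) := by gcongr
    _ = _ := ENNReal.mul_rpow_of_nonneg _ _ (by positivity)

lemma exists_test_seq {u : E n → ℝ} (hu : u ∈ Adm Ω p s) :
    ∃ φ : ℕ → E n → ℝ, (∀ k, IsTest Ω (φ k)) ∧ Tendsto (fun k => pint p (φ k - u)) atTop (𝓝 0) ∧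
      Tendsto (fun k => gag p s (φ k - u)) atTop (𝓝 0) := by
  have h : ∀ k : ℕ, ∃ φ, IsTest Ω φ ∧ pint p (u - φ) + gag p s (u - φ) ≤ (k : ℝ≥0∞)⁻¹ := fun k =>
    hu.2.2 _ (by simp)
  choose φ hφ hle using h
  have h0 : Tendsto (fun k : ℕ => (k : ℝ≥0∞)⁻¹) atTop (𝓝 0) := ENNReal.tendsto_inv_nat_nhds_zero
  refine ⟨φ, hφ, ?_, ?_⟩
  · refine tendsto_of_tendsto_of_tendsto_of_le_of_le tendsto_const_nhds h0 (fun _ => zero_le)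
      fun k => ?_
    rw [← pint_neg, neg_sub]
    exact le_self_add.trans (hle k)
  · refine tendsto_of_tendsto_of_tendsto_of_le_of_le tendsto_const_nhds h0 (fun _ => zero_le)
      fun k => ?_
    rw [← gag_neg, neg_sub]
    exact le_add_self.trans (hle k)

/-- The fractional Sobolev inequality at the critical exponent. -/
lemma sobolev_critical (hp : 1 ≤ p) (hs0 : 0 < s) (hs1 : s < 1) (hn : p * s < n) :
    ∃ C : ℝ≥0∞, C ≠ ⊤ ∧ ∀ (Ω : Set (E n)), ∀ u ∈ Adm Ω p s,
      pint (critExp n p s) u ≤ C * gag p s u ^ (critExp n p s / p) := by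
  have hp0 : 0 < p := by linarith
  have hps : 0 < p * s := by positivity
  have hn0' : 0 < n := by exact_mod_cast (by linarith : (0 : ℝ) < n)
  have hpP := lt_critExp hp0 hs0 hn
  obtain ⟨C, hC, H⟩ := sobolev_of_finite hp0 hs0 hn
  -- Only finiteness of the critical integral remains: approximating test functions have it, satisfy
  -- the inequality with bounded right-hand sides, and Fatou's lemma passes the bound to `u`.
  refine ⟨C, hC, fun Ω u hu => H u hu.1 ?_⟩
  obtain ⟨φ, hφ, hφ1, hφ2⟩ := exists_test_seq hu
  have hgu := Adm.gag_lt_top hn0' hs0 hs1 hp hu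
  set L := C * (2 ^ (p - 1) * (1 + gag p s u)) ^ (critExp n p s / p)
  have hL : L ≠ ⊤ := by
    refine ENNReal.mul_ne_top hC (ENNReal.rpow_ne_top_of_nonneg (div_nonneg (by linarith) hp0.le) ?_)
    exact ENNReal.mul_ne_top (two_rpow_ne_top hp) (ENNReal.add_ne_top.2 ⟨by simp, hgu.ne⟩)
  refine ne_top_of_le_ne_top hL (pint_le_of_tendsto hp0 (fun k => (hφ k).aestronglyMeasurable)
    hu.1 hφ1 ?_)
  filter_upwards [hφ2.eventually (eventually_le_nhds one_pos)] with k hk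
  refine (H _ (hφ k).aestronglyMeasurable ((hφ k).pint_lt_top (by linarith)).ne).trans ?_
  have e : φ k = (φ k - u) + u := by abel
  have h1 := gag_add_le (s := s) (v := u) hp ((hφ k).aestronglyMeasurable.sub hu.1)
  rw [← e] at h1
  have : 0 ≤ critExp n p s / p := div_nonneg (by linarith) hp0.le
  refine mul_le_mul_right (ENNReal.rpow_le_rpow (h1.trans ?_) this) _
  gcongr

/-- Hölder's inequality on a set of finite measure. -/
lemma pint_le_mul_rpow {m m' : ℝ} (hm : 0 < m) (hmm : m ≤ m') (hΩ : MeasurableSet Ω) {u : E n → ℝ}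
    (hum : AEStronglyMeasurable u volume) (hu : ∀ᵐ x, x ∉ Ω → u x = 0) :
    pint m u ≤ volume Ω ^ (1 - m / m') * pint m' u ^ (m / m') := by
  have hm' : 0 < m' := by linarith
  rw [← setLIntegral_eq_pint hΩ hm hu, ← setLIntegral_eq_pint hΩ hm' hu]
  have h := eLpNorm_le_eLpNorm_mul_rpow_measure_univ (f := u) (μ := volume.restrict Ω)
    (ENNReal.ofReal_le_ofReal hmm) hum.restrict
  rw [eLpNorm_eq_lintegral_rpow_enorm_toReal (by simpa using hm) (by simp),
    eLpNorm_eq_lintegral_rpow_enorm_toReal (by simpa using hm') (by simp),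
    ENNReal.toReal_ofReal hm.le, ENNReal.toReal_ofReal hm'.le, Measure.restrict_apply_univ] at h
  have h2 := ENNReal.rpow_le_rpow h hm.le
  rw [← ENNReal.rpow_mul, one_div_mul_cancel hm.ne', ENNReal.rpow_one,
    ENNReal.mul_rpow_of_nonneg _ _ hm.le, ← ENNReal.rpow_mul, ← ENNReal.rpow_mul] at h2
  refine h2.trans (le_of_eq ?_)
  rw [mul_comm]
  congr 2
  · field_simp
  · field_simp

/-- The continuous embedding into `L^m` for exponents up to the critical one. -/
lemma sobolev_subcritical (hp : 1 ≤ p) (hs0 : 0 < s) (hs1 : s < 1) (hn : p * s < n)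
    (hΩ : MeasurableSet Ω) (hΩv : volume Ω < ⊤) (hm : 0 < m) (hmP : m ≤ critExp n p s) :
    ∃ C : ℝ≥0∞, C ≠ ⊤ ∧ ∀ u ∈ Adm Ω p s, pint m u ≤ C * gag p s u ^ (m / p) := by
  have hp0 : 0 < p := by linarith
  have hpP := lt_critExp hp0 hs0 hn
  obtain ⟨C, hC, H⟩ := sobolev_critical hp hs0 hs1 hn
  set P := critExp n p s with hP
  have hP0 : 0 < P := by linarith
  have hmP1 : m / P ≤ 1 := (div_le_one hP0).2 hmP
  refine ⟨volume Ω ^ (1 - m / P) * C ^ (m / P), ENNReal.mul_ne_top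
    (ENNReal.rpow_ne_top_of_nonneg (by linarith) hΩv.ne)
    (ENNReal.rpow_ne_top_of_nonneg (by positivity) hC), fun u hu => ?_⟩
  refine (pint_le_mul_rpow hm hmP hΩ hu.1 hu.2.1).trans ?_
  rw [mul_assoc]
  gcongr
  refine (ENNReal.rpow_le_rpow (H Ω u hu) (by positivity)).trans (le_of_eq ?_)
  rw [ENNReal.mul_rpow_of_nonneg _ _ (by positivity), ← ENNReal.rpow_mul]
  congr 2
  field_simp

end

/-! ### Local averages and a quantitative compactness estimate. -/

section

variable {n : ℕ} {p s m : ℝ} {Ω : Set (E n)}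

lemma lintegral_enorm_rpow_le {α : Type*} [MeasurableSpace α] {μ : Measure α} (hp : 1 ≤ p)
    {f : α → ℝ} (hf : AEStronglyMeasurable f μ) :
    (∫⁻ x, ‖f x‖ₑ ∂μ) ^ p ≤ μ univ ^ (p - 1) * ∫⁻ x, ‖f x‖ₑ ^ p ∂μ := by
  have hp0 : 0 < p := by linarith
  have h := eLpNorm_le_eLpNorm_mul_rpow_measure_univ (f := f) (μ := μ)
    (p := 1) (q := ENNReal.ofReal p) (by simpa using hp) hf
  rw [eLpNorm_one_eq_lintegral_enorm,
    eLpNorm_eq_lintegral_rpow_enorm_toReal (by simpa using hp0) (by simp),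
    ENNReal.toReal_ofReal hp0.le] at h
  have h2 := ENNReal.rpow_le_rpow h hp0.le
  rw [ENNReal.mul_rpow_of_nonneg _ _ hp0.le, ← ENNReal.rpow_mul, ← ENNReal.rpow_mul,
    one_div_mul_cancel hp0.ne', ENNReal.rpow_one] at h2
  refine h2.trans (le_of_eq ?_)
  rw [mul_comm]
  congr 2
  simp
  field_simp

/-- `w x` is compared with its mean over the ball. Jensen's inequality turns the difference into a
mean of `|w x - w y|^p`, and `‖x - y‖ ≤ 2h` allows the kernel to be inserted. The factor
`(2h)^(n+ps)` divided by the volume leaves `h^(ps)`, which is small for small balls. -/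
lemma enorm_rpow_le_of_mem_ball (hp : 1 ≤ p) (hs0 : 0 < s) {w : E n → ℝ}
    (hw : Integrable w volume) {c x : E n} {h : ℝ} (hh : 0 < h) (hx : x ∈ Metric.ball c h) :
    ‖w x‖ₑ ^ p ≤ ENNReal.ofReal (2 ^ (p - 1) * 2 ^ ((n : ℝ) + p * s) /
        volume.real (Metric.ball (0 : E n) 1) * h ^ (p * s)) * gagAt p s w x
      + 2 ^ (p - 1) * (volume (Metric.ball c h))⁻¹ ^ p * ‖∫ y in Metric.ball c h, w y‖ₑ ^ p := by
  have hp0 : 0 < p := by linarith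
  have hps : 0 < p * s := by positivity
  set B := Metric.ball c h with hB
  set ϖ := volume.real (Metric.ball (0 : E n) 1) with hϖ
  have hϖ0 : 0 < ϖ := volume_real_unitBall_pos
  have hBv : volume B = ENNReal.ofReal (ϖ * h ^ n) := volume_ball_eq c hh
  have hB0 : volume B ≠ 0 := (Metric.measure_ball_pos _ _ hh).ne'
  have hBt : volume B ≠ ⊤ := measure_ball_lt_top.ne
  have hBr : (volume B).toReal ≠ 0 := (ENNReal.toReal_pos hB0 hBt).ne'
  set I := ∫ y in B, w y with hI
  set V := (volume B).toReal with hV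
  have hVe : ‖V⁻¹‖ₑ = (volume B)⁻¹ := by
    rw [Real.enorm_eq_ofReal (by positivity), ENNReal.ofReal_inv_of_pos (by positivity),
      hV, ENNReal.ofReal_toReal hBt]
  have e1 : w x - V⁻¹ * I = V⁻¹ * ∫ y in B, (w x - w y) := by
    have hci : IntegrableOn (fun _ => w x) B volume := integrableOn_const hBt (by simp)
    rw [integral_sub hci hw.integrableOn]
    · rw [setIntegral_const, mul_sub, smul_eq_mul, Measure.real, ← mul_assoc, inv_mul_cancel₀ hBr,
        one_mul]
  have hm : AEStronglyMeasurable (fun y => w x - w y) (volume.restrict B) :=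
    (aestronglyMeasurable_const.sub hw.1).restrict
  have h1 : ‖w x - V⁻¹ * I‖ₑ ^ p ≤ (volume B)⁻¹ * ∫⁻ y in B, ‖w x - w y‖ₑ ^ p := by
    rw [e1, enorm_mul, hVe, ENNReal.mul_rpow_of_nonneg _ _ hp0.le]
    calc (volume B)⁻¹ ^ p * ‖∫ y in B, (w x - w y)‖ₑ ^ p
        ≤ (volume B)⁻¹ ^ p * (volume B ^ (p - 1) * ∫⁻ y in B, ‖w x - w y‖ₑ ^ p) := by
          gcongr
          refine (ENNReal.rpow_le_rpow (enorm_integral_le_lintegral_enorm _) hp0.le).trans ?_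
          simpa using lintegral_enorm_rpow_le hp hm
      _ = (volume B)⁻¹ * ∫⁻ y in B, ‖w x - w y‖ₑ ^ p := by
          rw [← mul_assoc]
          congr 1
          rw [ENNReal.inv_rpow, ← ENNReal.rpow_neg, ← ENNReal.rpow_add _ _ hB0 hBt,
            ← ENNReal.rpow_neg_one]
          congr 1
          ring
  have h2 : ∫⁻ y in B, ‖w x - w y‖ₑ ^ p ≤
      ENNReal.ofReal ((2 * h) ^ ((n : ℝ) + p * s)) * gagAt p s w x := by
    rw [gagAt, ← lintegral_const_mul' _ _ ENNReal.ofReal_ne_top]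
    refine le_trans ?_ (setLIntegral_le_lintegral B _)
    refine setLIntegral_mono' measurableSet_ball fun y hy => ?_
    rcases eq_or_ne x y with rfl | hxy
    · simp [ENNReal.zero_rpow_of_pos hp0]
    have hd : 0 < ‖x - y‖ := norm_pos_iff.2 (sub_ne_zero.2 hxy)
    have hd2 : ‖x - y‖ ≤ 2 * h := by
      rw [← dist_eq_norm]
      have := dist_triangle_right x y c
      rw [hB, Metric.mem_ball] at hx hy
      linarith
    rw [mul_left_comm]
    refine le_mul_of_one_le_right zero_le ?_
    rw [kern, ← ENNReal.ofReal_mul (by positivity), ENNReal.one_le_ofReal,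
      Real.rpow_neg hd.le, ← div_eq_mul_inv, one_le_div (by positivity)]
    gcongr
  have h3 : ‖w x‖ₑ ^ p ≤ 2 ^ (p - 1) * (‖w x - V⁻¹ * I‖ₑ ^ p + ‖V⁻¹ * I‖ₑ ^ p) := by
    have := enorm_add_rpow_le hp (w x - V⁻¹ * I) (V⁻¹ * I)
    rwa [sub_add_cancel] at this
  refine h3.trans ?_
  rw [enorm_mul V⁻¹ I, hVe, ENNReal.mul_rpow_of_nonneg _ _ hp0.le, mul_add, ← mul_assoc]
  refine add_le_add ?_ le_rfl
  calc 2 ^ (p - 1) * ‖w x - V⁻¹ * I‖ₑ ^ p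
      ≤ 2 ^ (p - 1) * ((volume B)⁻¹ *
        (ENNReal.ofReal ((2 * h) ^ ((n : ℝ) + p * s)) * gagAt p s w x)) := by
        gcongr
        exact h1.trans (by gcongr)
    _ = 2 ^ (p - 1) * (volume B)⁻¹ * ENNReal.ofReal ((2 * h) ^ ((n : ℝ) + p * s))
        * gagAt p s w x := by ring
    _ = _ := by
        congr 1
        have h2p : (2 : ℝ≥0∞) ^ (p - 1) = ENNReal.ofReal (2 ^ (p - 1)) := by
          rw [← ENNReal.ofReal_rpow_of_pos two_pos]
          simp
        rw [hBv, h2p, ← ENNReal.ofReal_inv_of_pos (by positivity),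
          ← ENNReal.ofReal_mul (by positivity), ← ENNReal.ofReal_mul (by positivity)]
        congr 1
        rw [Real.mul_rpow (by norm_num) hh.le, Real.rpow_add hh, Real.rpow_natCast]
        field_simp

/-- A quantitative form of compactness: the `L^p` norm is controlled by a small multiple of the
Gagliardo seminorm and by finitely many averages. -/
lemma pint_le_small_gag_add_averages (hp : 1 ≤ p) (hs0 : 0 < s) (hΩm : MeasurableSet Ω)
    (hΩb : Bornology.IsBounded Ω) {ε : ℝ} (hε : 0 < ε) :
    ∃ (t : Finset (E n)) (h : ℝ) (C : ℝ≥0∞), C ≠ ⊤ ∧ ∀ w : E n → ℝ, Integrable w volume →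
      (∀ᵐ x, x ∉ Ω → w x = 0) → pint p w ≤ ENNReal.ofReal ε * gag p s w
        + C * ∑ c ∈ t, ‖∫ y in Metric.ball c h, w y‖ₑ ^ p := by
  have hp0 : 0 < p := by linarith
  have hps : 0 < p * s := by positivity
  have hϖ0 : 0 < volume.real (Metric.ball (0 : E n) 1) := volume_real_unitBall_pos
  set K := 2 ^ (p - 1) * 2 ^ ((n : ℝ) + p * s) / volume.real (Metric.ball (0 : E n) 1) with hK
  have hK0 : 0 < K := by positivity
  -- The radius at which the energy coefficient `K * h ^ (p * s)` of the single-ball estimate equals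
  -- `ε`.
  set h := (ε / K) ^ (1 / (p * s)) with hh
  have hh0 : 0 < h := by positivity
  have hKh : K * h ^ (p * s) = ε := by
    rw [hh, ← Real.rpow_mul (by positivity), one_div_mul_cancel hps.ne', Real.rpow_one]
    field_simp
  obtain ⟨t, ht, hcov⟩ := Metric.totallyBounded_iff.1
    (hΩb.isCompact_closure.totallyBounded.subset subset_closure) h hh0
  set b := 2 ^ (p - 1) * (ENNReal.ofReal (volume.real (Metric.ball (0 : E n) 1) * h ^ n))⁻¹ ^ p
    with hb
  have hbt : b ≠ ⊤ := by
    refine ENNReal.mul_ne_top (two_rpow_ne_top hp) (ENNReal.rpow_ne_top_of_nonneg hp0.le ?_)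
    rw [ne_eq, ENNReal.inv_eq_top, ENNReal.ofReal_eq_zero, not_le]
    positivity
  refine ⟨ht.toFinset, h, volume Ω * b, ENNReal.mul_ne_top hΩb.measure_lt_top.ne hbt,
    fun w hw hw0 => ?_⟩
  set T := ∑ c ∈ ht.toFinset, ‖∫ y in Metric.ball c h, w y‖ₑ ^ p with hT
  calc pint p w = ∫⁻ x in Ω, ‖w x‖ₑ ^ p := (setLIntegral_eq_pint hΩm hp0 hw0).symm
    _ ≤ ∫⁻ x in Ω, (b * T + ENNReal.ofReal ε * gagAt p s w x) := by
        refine setLIntegral_mono' hΩm fun x hx => ?_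
        obtain ⟨c, hc, hxc⟩ := mem_iUnion₂.1 (hcov hx)
        have := enorm_rpow_le_of_mem_ball hp hs0 hw hh0 hxc
        rw [← hK, hKh, volume_ball_eq c hh0, ← hb, add_comm] at this
        refine this.trans ?_
        gcongr
        exact Finset.single_le_sum (f := fun c => ‖∫ y in Metric.ball c h, w y‖ₑ ^ p)
          (fun _ _ => zero_le) (ht.mem_toFinset.2 hc)
    _ = b * T * volume Ω + ENNReal.ofReal ε * ∫⁻ x in Ω, gagAt p s w x := by
        rw [lintegral_add_left measurable_const, setLIntegral_const,
          lintegral_const_mul' _ _ ENNReal.ofReal_ne_top]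
    _ ≤ b * T * volume Ω + ENNReal.ofReal ε * gag p s w := by
        gcongr
        rw [← lintegral_gagAt hw.1]
        exact setLIntegral_le_lintegral _ _
    _ = _ := by ring

end

/-! ### Compactness in `L^p` and weak closedness of `Adm`. -/

section

variable {n : ℕ} {p s m : ℝ} {Ω : Set (E n)}

lemma exists_tendsto_of_cauchy_pint (hp : 1 ≤ p) {w : ℕ → E n → ℝ}
    (hw : ∀ k, AEStronglyMeasurable (w k) volume) (hwp : ∀ k, pint p (w k) < ⊤)
    (hc : Tendsto (fun kl : ℕ × ℕ => pint p (w kl.1 - w kl.2)) atTop (𝓝 0)) :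
    ∃ v : E n → ℝ, AEStronglyMeasurable v volume ∧
      Tendsto (fun k => pint p (w k - v)) atTop (𝓝 0) := by
  have hp0 : 0 < p := by linarith
  have : Fact (1 ≤ ENNReal.ofReal p) := ⟨by simpa using hp⟩
  have hL : ∀ k, MemLp (w k) (ENNReal.ofReal p) volume := fun k =>
    ⟨hw k, (pint_lt_top_iff hp0).1 (hwp k)⟩
  have hcs : CauchySeq fun k => (hL k).toLp (w k) := by
    rw [Lp.cauchySeq_Lp_iff_cauchySeq_eLpNorm]
    have h1 := hc.ennrpow_const (1 / p)
    rw [ENNReal.zero_rpow_of_pos (by positivity)] at h1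
    refine h1.congr fun kl => ?_
    rw [← eLpNorm_eq_pint_rpow hp0]
    exact eLpNorm_congr_ae (((hL _).coeFn_toLp.sub (hL _).coeFn_toLp)).symm
  obtain ⟨v, hv⟩ := cauchySeq_tendsto_of_complete hcs
  refine ⟨v, Lp.aestronglyMeasurable v, ?_⟩
  rw [Lp.tendsto_Lp_iff_tendsto_eLpNorm'] at hv
  have h1 := hv.ennrpow_const p
  rw [ENNReal.zero_rpow_of_pos hp0] at h1
  refine h1.congr fun k => ?_
  rw [pint_eq_eLpNorm_rpow hp0]
  congr 1
  exact eLpNorm_congr_ae ((hL _).coeFn_toLp.sub (ae_eq_refl _))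

lemma integrable_of_pint_one {u : E n → ℝ} (hu : AEStronglyMeasurable u volume)
    (h : pint 1 u < ⊤) : Integrable u volume := by
  refine ⟨hu, ?_⟩
  simpa [pint, HasFiniteIntegral] using h

/-- Bounded sequences have subsequences that converge in `L^p`. -/
lemma exists_subseq_tendsto_pint (hp : 1 ≤ p) (hs0 : 0 < s) (hs1 : s < 1) (hn : p * s < n)
    (hΩm : MeasurableSet Ω) (hΩb : Bornology.IsBounded Ω) {w : ℕ → E n → ℝ}
    (hw : ∀ k, w k ∈ Adm Ω p s) {R : ℝ≥0∞} (hR : R ≠ ⊤) (hwR : ∀ k, gag p s (w k) ≤ R) :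
    ∃ ns : ℕ → ℕ, StrictMono ns ∧ ∃ v : E n → ℝ, AEStronglyMeasurable v volume ∧
      Tendsto (fun k => pint p (w (ns k) - v)) atTop (𝓝 0) := by
  have hp0 : 0 < p := by linarith
  have hps : 0 < p * s := by positivity
  have hn0 : 0 < n := by exact_mod_cast (by linarith : (0 : ℝ) < n)
  have hpP := lt_critExp hp0 hs0 hn
  obtain ⟨C₁, hC₁, H₁⟩ := sobolev_subcritical hp hs0 hs1 hn hΩm hΩb.measure_lt_top one_pos
    (by linarith : 1 ≤ critExp n p s)
  set B := C₁ * R ^ (1 / p) with hB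
  have hBt : B ≠ ⊤ := ENNReal.mul_ne_top hC₁ (ENNReal.rpow_ne_top_of_nonneg (by positivity) hR)
  have hw1 : ∀ k, pint 1 (w k) ≤ B := fun k => (H₁ _ (hw k)).trans
    (mul_le_mul_right (ENNReal.rpow_le_rpow (hwR k) (by positivity)) _)
  have hwi : ∀ k, Integrable (w k) volume := fun k =>
    integrable_of_pint_one (hw k).1 ((hw1 k).trans_lt hBt.lt_top)
  -- One finite family of balls for each precision `1/(j+1)`: only countably many averages in all,
  -- uniformly bounded by the `L^1` bound.
  choose t h C hC H using fun j : ℕ => pint_le_small_gag_add_averages (p := p) hp hs0 hΩm hΩb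
    (by positivity : (0 : ℝ) < 1 / (j + 1))
  let a : ℕ → (Σ j : ℕ, t j) → ℝ := fun k i => ∫ y in Metric.ball (i.2 : E n) (h i.1), w k y
  have ha : ∀ k, a k ∈ univ.pi fun _ : Σ j : ℕ, t j => Icc (-B.toReal) B.toReal := by
    intro k i _
    refine abs_le.1 ?_
    rw [← Real.norm_eq_abs, ← toReal_enorm]
    refine ENNReal.toReal_mono hBt ?_
    refine (enorm_integral_le_lintegral_enorm _).trans ?_
    refine (setLIntegral_le_lintegral _ _).trans ?_
    simpa [pint] using hw1 k
  -- Compactness of the countable product of intervals replaces a diagonal argument: one subsequence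
  -- makes every average converge. Differences then have small averages, which gives the Cauchy
  -- property in `L^p`.
  obtain ⟨α, -, ns, hns, hα⟩ := (isCompact_univ_pi fun _ : Σ j : ℕ, t j =>
    isCompact_Icc (a := -B.toReal) (b := B.toReal)).tendsto_subseq ha
  refine ⟨ns, hns, ?_⟩
  refine exists_tendsto_of_cauchy_pint hp (fun k => (hw _).1)
    (fun k => Adm.pint_lt_top hn0 hs0 hs1 hp (hw _)) ?_
  set R' := 2 ^ (p - 1) * (R + R) with hR'
  have hR't : R' ≠ ⊤ := ENNReal.mul_ne_top (two_rpow_ne_top hp) (ENNReal.add_ne_top.2 ⟨hR, hR⟩)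
  have hle : ∀ (j : ℕ) (kl : ℕ × ℕ), pint p (w (ns kl.1) - w (ns kl.2)) ≤
      ENNReal.ofReal (1 / (j + 1)) * R' + C j * ∑ c ∈ (t j).attach,
        ‖a (ns kl.1) ⟨j, c⟩ - a (ns kl.2) ⟨j, c⟩‖ₑ ^ p := by
    intro j kl
    refine (H j _ ((hwi _).sub (hwi _)) (Adm.sub hp (hw _) (hw _)).2.1).trans ?_
    gcongr
    · refine (gag_sub_le hp (hw _).1).trans ?_
      rw [hR']
      gcongr <;> exact hwR _
    · rw [← Finset.sum_attach]
      refine Finset.sum_le_sum fun c _ => le_of_eq ?_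
      congr 2
      exact integral_sub (hwi _).integrableOn (hwi _).integrableOn
  rw [ENNReal.tendsto_nhds_zero]
  intro ε hε
  have hε2 : 0 < ε / 2 := ENNReal.half_pos hε.ne'
  have h1 : ∃ j : ℕ, ENNReal.ofReal (1 / (j + 1)) * R' ≤ ε / 2 := by
    have : Tendsto (fun j : ℕ => ENNReal.ofReal (1 / ((j : ℝ) + 1)) * R') atTop (𝓝 0) := by
      have h := ENNReal.Tendsto.mul_const (b := R')
        (ENNReal.tendsto_ofReal (tendsto_one_div_add_atTop_nhds_zero_nat (𝕜 := ℝ))) (Or.inr hR't)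
      simpa using h
    exact (this.eventually (eventually_le_nhds hε2)).exists
  obtain ⟨j, hj⟩ := h1
  have h2 : Tendsto (fun kl : ℕ × ℕ => C j * ∑ c ∈ (t j).attach,
      ‖a (ns kl.1) ⟨j, c⟩ - a (ns kl.2) ⟨j, c⟩‖ₑ ^ p) atTop (𝓝 0) := by
    have h3 : Tendsto (fun kl : ℕ × ℕ => ∑ c ∈ (t j).attach,
        ‖a (ns kl.1) ⟨j, c⟩ - a (ns kl.2) ⟨j, c⟩‖ₑ ^ p) atTop (𝓝 0) := by
      rw [← Finset.sum_const_zero (s := (t j).attach)]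
      refine tendsto_finsetSum _ fun c _ => ?_
      have hc := (tendsto_pi_nhds.1 hα) ⟨j, c⟩
      have hd : Tendsto (fun kl : ℕ × ℕ => a (ns kl.1) ⟨j, c⟩ - a (ns kl.2) ⟨j, c⟩) atTop
          (𝓝 0) := by
        rw [← prod_atTop_atTop_eq, ← sub_self (α ⟨j, c⟩)]
        exact (hc.comp tendsto_fst).sub (hc.comp tendsto_snd)
      have he := ((continuous_enorm.tendsto _).comp hd).ennrpow_const p
      simpa [ENNReal.zero_rpow_of_pos hp0] using he
    have := ENNReal.Tendsto.const_mul h3 (Or.inr (hC j))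
    simpa using this
  filter_upwards [h2.eventually (eventually_le_nhds hε2)] with kl hkl
  calc _ ≤ _ := hle j kl
    _ ≤ ε / 2 + ε / 2 := add_le_add hj hkl
    _ = ε := ENNReal.add_halves ε

lemma convex_adm (hp : 1 ≤ p) : Convex ℝ (Adm Ω p s) := by
  intro u hu v hv a b _ _ _
  exact Adm.add hp (Adm.smul (by linarith) a hu) (Adm.smul (by linarith) b hv)

lemma enorm_convex_rpow_le (hp : 1 ≤ p) {a b : ℝ} (ha : 0 ≤ a) (hb : 0 ≤ b) (hab : a + b = 1)
    (x y : ℝ) : ‖a * x + b * y‖ₑ ^ p ≤ ENNReal.ofReal a * ‖x‖ₑ ^ p + ENNReal.ofReal b * ‖y‖ₑ ^ p := by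
  have hp0 : 0 ≤ p := by linarith
  simp only [enorm_rpow_eq hp0]
  rw [← ENNReal.ofReal_mul ha, ← ENNReal.ofReal_mul hb,
    ← ENNReal.ofReal_add (by positivity) (by positivity)]
  refine ENNReal.ofReal_le_ofReal ?_
  have h1 := (convexOn_rpow hp).2 (mem_Ici.2 (abs_nonneg x)) (mem_Ici.2 (abs_nonneg y)) ha hb hab
  simp only [smul_eq_mul] at h1
  refine le_trans (Real.rpow_le_rpow (abs_nonneg _) ?_ hp0) h1
  refine (abs_add_le _ _).trans (le_of_eq ?_)
  rw [abs_mul, abs_mul, abs_of_nonneg ha, abs_of_nonneg hb]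

lemma pint_convex_le (hp : 1 ≤ p) {u v w : E n → ℝ} {a b : ℝ} (ha : 0 ≤ a) (hb : 0 ≤ b)
    (hab : a + b = 1) (hu : AEStronglyMeasurable u volume) (hw : AEStronglyMeasurable w volume)
    {L : ℝ≥0∞} (h1 : pint p (u - w) ≤ L) (h2 : pint p (v - w) ≤ L) :
    pint p (a • u + b • v - w) ≤ L := by
  calc pint p (a • u + b • v - w)
      ≤ ∫⁻ x, (ENNReal.ofReal a * ‖(u - w) x‖ₑ ^ p + ENNReal.ofReal b * ‖(v - w) x‖ₑ ^ p) := by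
        refine lintegral_mono fun x => ?_
        refine le_trans (le_of_eq ?_) (enorm_convex_rpow_le hp ha hb hab _ _)
        congr 2
        simp only [Pi.sub_apply, Pi.add_apply, Pi.smul_apply, smul_eq_mul]
        linear_combination w x * hab
    _ = ENNReal.ofReal a * pint p (u - w) + ENNReal.ofReal b * pint p (v - w) := by
        rw [lintegral_add_left' (((hu.sub hw).enorm.pow_const p).const_mul _),
          lintegral_const_mul' _ _ ENNReal.ofReal_ne_top,
          lintegral_const_mul' _ _ ENNReal.ofReal_ne_top]
        rfl
    _ ≤ ENNReal.ofReal a * L + ENNReal.ofReal b * L := by gcongr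
    _ = L := by rw [← add_mul, ← ENNReal.ofReal_add ha hb, hab]; simp

/-- The admissible set is sequentially weakly closed: bounded sequences that converge in `L^p` have
their limit in it. -/
lemma adm_of_tendsto (hp : 2 ≤ p)
    {w : ℕ → E n → ℝ} {v : E n → ℝ} (hw : ∀ k, w k ∈ Adm Ω p s)
    (hv : AEStronglyMeasurable v volume) (hwv : Tendsto (fun k => pint p (w k - v)) atTop (𝓝 0))
    {R : ℝ≥0∞} (hR : R ≠ ⊤) (hwR : ∀ k, gag p s (w k) ≤ R) : v ∈ Adm Ω p s := by
  have hp1 : 1 ≤ p := by linarith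
  have hp0 : 0 < p := by linarith
  have hv0 : ∀ᵐ x, x ∉ Ω → v x = 0 := by
    obtain ⟨ns, -, hae⟩ := exists_subseq_tendsto_ae hp0 (fun k => (hw k).1) hv hwv
    filter_upwards [hae, ae_all_iff.2 fun k => (hw k).2.1] with x hx hx0 hxΩ
    refine tendsto_nhds_unique hx ?_
    simp only [hx0 _ hxΩ]
    exact tendsto_const_nhds
  refine ⟨hv, hv0, ?_⟩
  -- A Mazur argument without weak topologies. Convex combinations of tails stay in `Adm`, and they
  -- stay near `v` in `L^p` because balls are convex; among them, elements of almost least energy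
  -- will converge to `v` in energy as well.
  set T : ℕ → Set (E n → ℝ) := fun k => convexHull ℝ (w '' Ici k) with hT
  have hTw : ∀ k, w k ∈ T k := fun k => subset_convexHull ℝ _ (mem_image_of_mem w self_mem_Ici)
  have hTadm : ∀ k, T k ⊆ Adm Ω p s := fun k =>
    convexHull_min (by rintro _ ⟨j, -, rfl⟩; exact hw j) (convex_adm hp1)
  have hTanti : ∀ {k l}, k ≤ l → T l ⊆ T k := fun h =>
    convexHull_mono (image_mono (Ici_subset_Ici.2 h))
  have hTp : ∀ (L : ℝ≥0∞) (k : ℕ), (∀ j, k ≤ j → pint p (w j - v) ≤ L) →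
      ∀ u ∈ T k, pint p (u - v) ≤ L := by
    intro L k hk
    have hconv : Convex ℝ {u | AEStronglyMeasurable u volume ∧ pint p (u - v) ≤ L} := by
      intro u hu u' hu' a b ha hb hab
      exact ⟨(hu.1.const_smul a).add (hu'.1.const_smul b),
        pint_convex_le hp1 ha hb hab hu.1 hv hu.2 hu'.2⟩
    have : T k ⊆ {u | AEStronglyMeasurable u volume ∧ pint p (u - v) ≤ L} :=
      convexHull_min (by rintro _ ⟨j, hj, rfl⟩; exact ⟨(hw j).1, hk j hj⟩) hconv
    exact fun u hu => (this hu).2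
  set d : ℕ → ℝ≥0∞ := fun k => ⨅ u ∈ T k, gag p s u with hd
  have hdR : ∀ k, d k ≤ R := fun k => (iInf₂_le _ (hTw k)).trans (hwR k)
  have hdmono : Monotone d := fun k l h => biInf_mono (hTanti h)
  have hdt : ∀ k, d k ≠ ⊤ := fun k => ne_top_of_le_ne_top hR (hdR k)
  set D := ⨆ k, d k with hD
  have hDt : D ≠ ⊤ := ne_top_of_le_ne_top hR (iSup_le hdR)
  have hdD : Tendsto d atTop (𝓝 D) := tendsto_atTop_iSup hdmono
  -- The tolerance is `⊤` at `k = 0`, which is harmless since only large `k` matter.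
  have hex : ∀ k : ℕ, ∃ u ∈ T k, gag p s u ≤ d k + (k : ℝ≥0∞)⁻¹ := by
    intro k
    have : d k < d k + (k : ℝ≥0∞)⁻¹ := ENNReal.lt_add_right (hdt k) (by simp)
    conv_lhs at this => rw [hd]
    simp only [iInf_lt_iff] at this
    obtain ⟨u, hu, h⟩ := this
    exact ⟨u, hu, h.le⟩
  choose z hzT hz using hex
  have hzadm : ∀ k, z k ∈ Adm Ω p s := fun k => hTadm k (hzT k)
  have hzv : Tendsto (fun k => pint p (z k - v)) atTop (𝓝 0) := by
    rw [ENNReal.tendsto_nhds_zero]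
    intro ε hε
    obtain ⟨N, hN⟩ := eventually_atTop.1 (hwv.eventually (eventually_le_nhds hε))
    filter_upwards [eventually_ge_atTop N] with k hk
    exact hTp ε k (fun j hj => hN j (hk.trans hj)) _ (hzT k)
  have hhalf : ‖(2⁻¹ : ℝ)‖ₑ ^ p ≠ 0 := by
    rw [enorm_rpow_eq hp0.le]
    simp only [ne_eq, ENNReal.ofReal_eq_zero, not_le]
    positivity
  have hhalft : ‖(2⁻¹ : ℝ)‖ₑ ^ p ≠ ⊤ := ENNReal.rpow_ne_top_of_nonneg hp0.le (by simp)
  -- The midpoint of `z k` and `z l` lies in `T k`, so its energy is at least `d k`; Clarkson then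
  -- bounds the energy of the difference by a gap that tends to zero.
  have hcl : ∀ k l, k ≤ l → d k + ‖(2⁻¹ : ℝ)‖ₑ ^ p * gag p s (z k - z l) ≤ D + (k : ℝ≥0∞)⁻¹ := by
    intro k l hkl
    have hmid : (2⁻¹ : ℝ) • (z k + z l) ∈ T k := by
      rw [smul_add]
      exact convex_convexHull ℝ _ (hzT k) (hTanti hkl (hzT l)) (by norm_num) (by norm_num)
        (by norm_num)
    have h1 : d k ≤ gag p s ((2⁻¹ : ℝ) • (z k + z l)) := iInf₂_le _ hmid
    have h2 := gag_clarkson (s := s) hp (hzadm k).1 (hzadm l).1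
    rw [gag_smul hp0.le _ (z k - z l)] at h2
    calc _ ≤ _ := add_le_add_left h1 _
      _ ≤ _ := h2
      _ ≤ 2⁻¹ * ((D + (k : ℝ≥0∞)⁻¹) + (D + (k : ℝ≥0∞)⁻¹)) := by
          gcongr
          · exact (hz k).trans (by gcongr; exact le_iSup d k)
          · refine (hz l).trans (add_le_add (le_iSup d l) ?_)
            gcongr
      _ = D + (k : ℝ≥0∞)⁻¹ := by
          rw [← two_mul, ← mul_assoc, ENNReal.inv_mul_cancel (by simp) (by simp), one_mul]
  have hlim : Tendsto (fun k : ℕ => (‖(2⁻¹ : ℝ)‖ₑ ^ p)⁻¹ * (D + (k : ℝ≥0∞)⁻¹ - d k)) atTop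
      (𝓝 0) := by
    have h1 : Tendsto (fun k : ℕ => D + (k : ℝ≥0∞)⁻¹ - d k) atTop (𝓝 (D + 0 - D)) := by
      refine ENNReal.Tendsto.sub ?_ hdD (Or.inl (by simpa using hDt))
      exact tendsto_const_nhds.add ENNReal.tendsto_inv_nat_nhds_zero
    have h2 := ENNReal.Tendsto.const_mul (a := (‖(2⁻¹ : ℝ)‖ₑ ^ p)⁻¹) h1
      (Or.inr (ENNReal.inv_ne_top.2 hhalf))
    simpa using h2
  -- Letting `l → ∞`, lower semicontinuity replaces `z l` by `v`; completeness of the energy space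
  -- is not needed.
  have hgz : ∀ k, gag p s (z k - v) ≤ (‖(2⁻¹ : ℝ)‖ₑ ^ p)⁻¹ * (D + (k : ℝ≥0∞)⁻¹ - d k) := by
    intro k
    refine gag_le_of_tendsto hp0 (w := fun l => z k - z l) (fun l => (hzadm k).1.sub (hzadm l).1)
      ((hzadm k).1.sub hv) ?_ ?_
    · refine hzv.congr fun l => ?_
      rw [← pint_neg]
      congr 1
      abel
    · filter_upwards [eventually_ge_atTop k] with l hl
      rw [← ENNReal.div_eq_inv_mul, ENNReal.le_div_iff_mul_le (Or.inl hhalf) (Or.inl hhalft),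
        mul_comm]
      exact ENNReal.le_sub_of_add_le_left (hdt k) (hcl k l hl)
  have hgz0 : Tendsto (fun k => gag p s (z k - v)) atTop (𝓝 0) :=
    tendsto_of_tendsto_of_tendsto_of_le_of_le tendsto_const_nhds hlim (fun _ => zero_le) hgz
  intro ε hε
  obtain ⟨δ, hδ, hδε⟩ := exists_mul_le (C := 2 ^ (p - 1) * 3)
    (ENNReal.mul_ne_top (two_rpow_ne_top hp1) (by simp)) hε
  obtain ⟨k, hk1, hk2⟩ := ((hzv.eventually (eventually_le_nhds hδ)).and
    (hgz0.eventually (eventually_le_nhds hδ))).exists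
  obtain ⟨φ, hφ, hφδ⟩ := (hzadm k).2.2 δ hδ
  refine ⟨φ, hφ, ?_⟩
  have e : v - φ = (z k - φ) - (z k - v) := by abel
  have hm := (hzadm k).1.sub hφ.aestronglyMeasurable
  rw [e]
  calc _ ≤ _ := add_le_add (pint_sub_le hp1 hm) (gag_sub_le hp1 hm)
    _ = 2 ^ (p - 1) * ((pint p (z k - φ) + gag p s (z k - φ)) + pint p (z k - v)
        + gag p s (z k - v)) := by ring
    _ ≤ 2 ^ (p - 1) * (δ + δ + δ) := by gcongr
    _ = 2 ^ (p - 1) * 3 * δ := by ring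
    _ ≤ ε := hδε

end

/-! ### Convergence in `L^r`, absolute values, and weighted power integrals. -/

section

variable {n : ℕ} {p s m r : ℝ} {Ω : Set (E n)}

/-- Split at the point `T` where `ε T^(m₃-m₂) = 1`: below it the lowest power dominates, above it
the highest one does. -/
lemma rpow_le_mul_rpow_add {m₁ m₂ m₃ : ℝ} (h1 : 0 < m₁) (h12 : m₁ ≤ m₂) (h23 : m₂ < m₃) {ε : ℝ}
    (hε : 0 < ε) : ∃ C : ℝ, 0 ≤ C ∧ ∀ t : ℝ, 0 ≤ t → t ^ m₂ ≤ C * t ^ m₁ + ε * t ^ m₃ := by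
  set T := (1 / ε) ^ (1 / (m₃ - m₂)) with hT
  have hT0 : 0 < T := by positivity
  have hTm : T ^ (m₃ - m₂) = 1 / ε := by
    rw [hT, ← Real.rpow_mul (by positivity), one_div_mul_cancel (by linarith), Real.rpow_one]
  refine ⟨T ^ (m₂ - m₁), by positivity, fun t ht => ?_⟩
  rcases ht.eq_or_lt with rfl | ht
  · simp [Real.zero_rpow h1.ne', Real.zero_rpow (by linarith : m₂ ≠ 0),
      Real.zero_rpow (by linarith : m₃ ≠ 0)]
  rcases le_total t T with h | h
  · have e : t ^ m₂ = t ^ (m₂ - m₁) * t ^ m₁ := by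
      rw [← Real.rpow_add ht]; congr 1; ring
    have : t ^ (m₂ - m₁) ≤ T ^ (m₂ - m₁) := Real.rpow_le_rpow ht.le h (by linarith)
    rw [e]
    have h2 : 0 < t ^ m₁ := by positivity
    have h3 : 0 < ε * t ^ m₃ := by positivity
    nlinarith
  · have e : t ^ m₃ = t ^ (m₃ - m₂) * t ^ m₂ := by
      rw [← Real.rpow_add ht]; congr 1; ring
    have : T ^ (m₃ - m₂) ≤ t ^ (m₃ - m₂) := Real.rpow_le_rpow hT0.le h (by linarith)
    rw [hTm, div_le_iff₀ hε] at this
    rw [e]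
    have h2 : 0 < t ^ m₂ := by positivity
    have h3 : 0 < T ^ (m₂ - m₁) * t ^ m₁ := by positivity
    nlinarith

/-- Interpolation: the `r`-th power is at most a large multiple of the `p`-th power, which tends to
zero, plus a small multiple of the critical power, which Sobolev keeps bounded. -/
lemma tendsto_pint_of_bounded_gag (hp : 1 ≤ p) (hs0 : 0 < s) (hs1 : s < 1) (hn : p * s < n)
    (hpr : p ≤ r) (hrP : r < critExp n p s) {w : ℕ → E n → ℝ} {v : E n → ℝ}
    (hw : ∀ k, w k ∈ Adm Ω p s) (hv : v ∈ Adm Ω p s) {R : ℝ≥0∞} (hR : R ≠ ⊤)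
    (hwR : ∀ k, gag p s (w k) ≤ R) (h : Tendsto (fun k => pint p (w k - v)) atTop (𝓝 0)) :
    Tendsto (fun k => pint r (w k - v)) atTop (𝓝 0) := by
  have hp0 : 0 < p := by linarith
  have hps : 0 < p * s := by positivity
  have hn0 : 0 < n := by exact_mod_cast (by linarith : (0 : ℝ) < n)
  obtain ⟨C, hC, H⟩ := sobolev_critical hp hs0 hs1 hn
  set P := critExp n p s with hP
  have hP0 : 0 < P := by linarith
  have hr0 : 0 < r := by linarith
  set K := C * (2 ^ (p - 1) * (R + gag p s v)) ^ (P / p) with hK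
  have hKt : K ≠ ⊤ := by
    refine ENNReal.mul_ne_top hC (ENNReal.rpow_ne_top_of_nonneg (by positivity) ?_)
    exact ENNReal.mul_ne_top (two_rpow_ne_top hp)
      (ENNReal.add_ne_top.2 ⟨hR, (Adm.gag_lt_top hn0 hs0 hs1 hp hv).ne⟩)
  have hKb : ∀ k, pint P (w k - v) ≤ K := fun k => by
    refine (H Ω _ (Adm.sub hp (hw k) hv)).trans ?_
    refine mul_le_mul_right (ENNReal.rpow_le_rpow ?_ (by positivity)) _
    refine (gag_sub_le hp (hw k).1).trans ?_
    gcongr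
    exact hwR k
  rw [ENNReal.tendsto_nhds_zero]
  intro ε hε
  have hε2 : 0 < ε / 2 := ENNReal.half_pos hε.ne'
  obtain ⟨δ, hδ, hδε⟩ : ∃ δ : ℝ, 0 < δ ∧ K * ENNReal.ofReal δ ≤ ε / 2 := by
    obtain ⟨δ, h1, h2⟩ := exists_mul_le hKt hε2
    refine ⟨(min δ 1).toReal, ENNReal.toReal_pos (by simp [h1.ne']) (by simp), ?_⟩
    rw [ENNReal.ofReal_toReal (by simp)]
    exact (mul_le_mul_right (min_le_left _ _) _).trans h2
  obtain ⟨C', hC', H'⟩ := rpow_le_mul_rpow_add hp0 hpr hrP hδ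
  have hle : ∀ k, pint r (w k - v) ≤ ENNReal.ofReal C' * pint p (w k - v) + ε / 2 := by
    intro k
    calc pint r (w k - v) ≤ ∫⁻ x, (ENNReal.ofReal C' * ‖(w k - v) x‖ₑ ^ p
          + ENNReal.ofReal δ * ‖(w k - v) x‖ₑ ^ P) := by
          refine lintegral_mono fun x => ?_
          dsimp only
          rw [enorm_rpow_eq hr0.le, enorm_rpow_eq hp0.le, enorm_rpow_eq hP0.le,
            ← ENNReal.ofReal_mul hC', ← ENNReal.ofReal_mul hδ.le,
            ← ENNReal.ofReal_add (by positivity) (by positivity)]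
          exact ENNReal.ofReal_le_ofReal (H' _ (abs_nonneg _))
      _ = ENNReal.ofReal C' * pint p (w k - v) + ENNReal.ofReal δ * pint P (w k - v) := by
          rw [lintegral_add_left' ((((hw k).1.sub hv.1).enorm.pow_const p).const_mul _),
            lintegral_const_mul' _ _ ENNReal.ofReal_ne_top,
            lintegral_const_mul' _ _ ENNReal.ofReal_ne_top]
          rfl
      _ ≤ _ := by
          gcongr
          rw [mul_comm]
          exact (mul_le_mul_left (hKb k) _).trans hδε
  have h1 := ENNReal.Tendsto.const_mul (a := ENNReal.ofReal C') h (Or.inr ENNReal.ofReal_ne_top)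
  rw [mul_zero] at h1
  filter_upwards [h1.eventually (eventually_le_nhds hε2)] with k hk
  calc _ ≤ _ := hle k
    _ ≤ ε / 2 + ε / 2 := by gcongr
    _ = ε := ENNReal.add_halves ε

/-- A smooth approximation of the absolute value. -/
def smoothAbs (ε t : ℝ) : ℝ := √(t ^ 2 + ε ^ 2) - ε

lemma contDiff_smoothAbs {ε : ℝ} (hε : 0 < ε) : ContDiff ℝ ∞ (smoothAbs ε) := by
  unfold smoothAbs
  refine ContDiff.sub (ContDiff.sqrt (by fun_prop) fun t => ?_) contDiff_const
  positivity

/-- After squaring, this is the Cauchy–Schwarz inequality for `(a, ε)` and `(b, ε)`. As a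
contraction, the smoothing does not raise the Gagliardo energy. -/
lemma abs_smoothAbs_sub_le (ε a b : ℝ) : |smoothAbs ε a - smoothAbs ε b| ≤ |a - b| := by
  simp only [smoothAbs, sub_sub_sub_cancel_right]
  rw [← sq_le_sq]
  have hA := Real.sq_sqrt (by positivity : 0 ≤ a ^ 2 + ε ^ 2)
  have hB := Real.sq_sqrt (by positivity : 0 ≤ b ^ 2 + ε ^ 2)
  have hAB : a * b + ε ^ 2 ≤ √(a ^ 2 + ε ^ 2) * √(b ^ 2 + ε ^ 2) := by
    rw [← Real.sqrt_mul (by positivity)]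
    refine Real.le_sqrt_of_sq_le ?_
    nlinarith [sq_nonneg ((a - b) * ε)]
  nlinarith

lemma abs_smoothAbs_sub_abs_le {ε : ℝ} (hε : 0 < ε) (a : ℝ) : |(smoothAbs ε a - |a|)| ≤ ε := by
  have h1 : |a| ≤ √(a ^ 2 + ε ^ 2) := Real.abs_le_sqrt (by nlinarith)
  have h2 : √(a ^ 2 + ε ^ 2) ≤ |a| + ε := by
    rw [Real.sqrt_le_left (by positivity)]
    nlinarith [sq_abs a, abs_nonneg a]
  rw [abs_le, smoothAbs]
  constructor <;> linarith

lemma IsTest.smoothAbs {ε : ℝ} (hε : 0 < ε) {φ : E n → ℝ} (h : IsTest Ω φ) :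
    IsTest Ω (fun x => smoothAbs ε (φ x)) := by
  have h0 : FracKirchhoff.smoothAbs ε 0 = 0 := by simp [FracKirchhoff.smoothAbs, Real.sqrt_sq hε.le]
  exact ⟨(contDiff_smoothAbs hε).comp h.1, h.2.1.comp_left h0,
    (tsupport_comp_subset h0 φ).trans h.2.2⟩

lemma gag_le_of_abs_le (hp : 0 ≤ p) {u v : E n → ℝ} (h : ∀ x y, |u x - u y| ≤ |v x - v y|) :
    gag p s u ≤ gag p s v := by
  refine lintegral_mono fun z => ?_
  gcongr 1
  refine ENNReal.rpow_le_rpow ?_ hp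
  rw [Real.enorm_eq_ofReal_abs, Real.enorm_eq_ofReal_abs]
  exact ENNReal.ofReal_le_ofReal (h _ _)

lemma gag_abs_le (hp : 0 ≤ p) (u : E n → ℝ) : gag p s (fun x => |u x|) ≤ gag p s u :=
  gag_le_of_abs_le hp fun x y => abs_abs_sub_abs_le_abs_sub (u x) (u y)

/-- The space is stable under taking absolute values. -/
lemma Adm.abs (hp : 2 ≤ p) (hs0 : 0 < s) (hs1 : s < 1) (hn : 0 < n) (hΩm : MeasurableSet Ω)
    (hΩv : volume Ω < ⊤) {u : E n → ℝ} (hu : u ∈ Adm Ω p s) : (fun x => |u x|) ∈ Adm Ω p s := by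
  have hp1 : 1 ≤ p := by linarith
  have hp0 : 0 < p := by linarith
  obtain ⟨φ, hφ, hφ1, hφ2⟩ := exists_test_seq hu
  obtain ⟨N, hN⟩ := eventually_atTop.1 (hφ2.eventually (eventually_le_nhds one_pos))
  have hu' : AEStronglyMeasurable (fun x => |u x|) volume :=
    continuous_abs.comp_aestronglyMeasurable hu.1
  set ε : ℕ → ℝ := fun k => 1 / ((k : ℝ) + 1) with hε
  have hε0 : ∀ k, 0 < ε k := fun k => by positivity
  -- These are test functions of bounded energy converging to `|u|` in `L^p`; weak closedness asks
  -- for no more. The shift by `N` makes the energy bound valid for every `k`.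
  set ψ : ℕ → E n → ℝ := fun k x => smoothAbs (ε k) (φ (k + N) x) with hψ
  have hψt : ∀ k, IsTest Ω (ψ k) := fun k => (hφ _).smoothAbs (hε0 k)
  refine adm_of_tendsto hp (w := ψ) (R := 2 ^ (p - 1) * (1 + gag p s u))
    (fun k => Adm.of_isTest hp0 (hψt k)) hu' ?_ ?_ fun k => ?_
  · have hle : ∀ k, pint p (ψ k - fun x => |u x|) ≤
        2 ^ (p - 1) * (ENNReal.ofReal (ε k ^ p) * volume Ω + pint p (φ (k + N) - u)) := by
      intro k
      have e : (ψ k - fun x => |u x|) = (ψ k - fun x => |φ (k + N) x|)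
          + ((fun x => |φ (k + N) x|) - fun x => |u x|) := by abel
      have hm : AEStronglyMeasurable (ψ k - fun x => |φ (k + N) x|) volume :=
        (hψt k).aestronglyMeasurable.sub
          (continuous_abs.comp_aestronglyMeasurable (hφ _).aestronglyMeasurable)
      rw [e]
      refine (pint_add_le hp1 hm).trans ?_
      gcongr
      · rw [← setLIntegral_eq_pint hΩm hp0, ← setLIntegral_const]
        · refine lintegral_mono fun x => ?_
          dsimp only
          rw [enorm_rpow_eq hp0.le]
          exact ENNReal.ofReal_le_ofReal (Real.rpow_le_rpow (abs_nonneg _)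
            (abs_smoothAbs_sub_abs_le (hε0 k) _) hp0.le)
        · refine .of_forall fun x hx => ?_
          simp [(hψt k).eq_zero hx, (hφ (k + N)).eq_zero hx]
      · refine lintegral_mono fun x => ENNReal.rpow_le_rpow ?_ hp0.le
        rw [Real.enorm_eq_ofReal_abs, Real.enorm_eq_ofReal_abs]
        exact ENNReal.ofReal_le_ofReal (abs_abs_sub_abs_le_abs_sub _ _)
    have hlim : Tendsto (fun k => 2 ^ (p - 1) * (ENNReal.ofReal (ε k ^ p) * volume Ω
        + pint p (φ (k + N) - u))) atTop (𝓝 0) := by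
      have h1 : Tendsto (fun k => ENNReal.ofReal (ε k ^ p)) atTop (𝓝 0) := by
        have := (tendsto_one_div_add_atTop_nhds_zero_nat (𝕜 := ℝ)).rpow_const (p := p)
          (Or.inr hp0.le)
        rw [Real.zero_rpow hp0.ne'] at this
        simpa [hε] using ENNReal.tendsto_ofReal this
      have h2 := ENNReal.Tendsto.mul_const (b := volume Ω) h1 (Or.inr hΩv.ne)
      have h3 := h2.add (hφ1.comp (tendsto_add_atTop_nat N))
      have h4 := ENNReal.Tendsto.const_mul (a := 2 ^ (p - 1)) h3 (Or.inr (two_rpow_ne_top hp1))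
      simpa using h4
    exact tendsto_of_tendsto_of_tendsto_of_le_of_le tendsto_const_nhds hlim (fun _ => zero_le) hle
  · exact ENNReal.mul_ne_top (two_rpow_ne_top hp1)
      (ENNReal.add_ne_top.2 ⟨by simp, (Adm.gag_lt_top hn hs0 hs1 hp1 hu).ne⟩)
  · refine (gag_le_of_abs_le hp0.le (v := φ (k + N)) fun x y => abs_smoothAbs_sub_le _ _ _).trans ?_
    have e : φ (k + N) = (φ (k + N) - u) + u := by abel
    have h1 := gag_add_le (s := s) (v := u) hp1 ((hφ (k + N)).aestronglyMeasurable.sub hu.1)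
    rw [← e] at h1
    refine h1.trans ?_
    gcongr
    exact hN _ (Nat.le_add_left _ _)

/-- A weight on `Ω` for which `∫ |wt| |u|^m` is controlled by the `L^r` norm. -/
def WeightBound (Ω : Set (E n)) (wt : E n → ℝ) (m r : ℝ) (K : ℝ≥0∞) : Prop :=
  AEStronglyMeasurable wt (volume.restrict Ω) ∧ K ≠ ⊤ ∧ ∀ u : E n → ℝ,
    AEStronglyMeasurable u volume →
    ∫⁻ x in Ω, ‖wt x‖ₑ * ‖u x‖ₑ ^ m ≤ K * pint r u ^ (m / r)

lemma weightBound_of_memLp {f : E n → ℝ} {q : ℝ} (hq : 0 < q) (hqr : q < r)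
    (hf : MemLp f (ENNReal.ofReal (r / (r - q))) (volume.restrict Ω)) :
    WeightBound Ω f q r (eLpNorm f (ENNReal.ofReal (r / (r - q))) (volume.restrict Ω)) := by
  refine ⟨hf.1, hf.2.ne, fun u hu => ?_⟩
  have hrq : 0 < r - q := by linarith
  have hr : 0 < r := by linarith
  have hpos : 0 < r / (r - q) := by positivity
  -- Hölder pairs `f ∈ L^(r/(r-q))` with `|u|^q ∈ L^(r/q)`.
  have hc : (r / (r - q)).HolderConjugate (r / q) := by
    rw [Real.holderConjugate_iff]
    refine ⟨by rw [lt_div_iff₀ hrq]; linarith, ?_⟩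
    field_simp
    ring
  have h := ENNReal.lintegral_mul_le_Lp_mul_Lq (volume.restrict Ω) hc hf.1.enorm
    (hu.restrict.enorm.pow_const q)
  refine h.trans ?_
  rw [eLpNorm_eq_lintegral_rpow_enorm_toReal (by simpa using hpos) (by simp),
    ENNReal.toReal_ofReal hpos.le]
  gcongr
  rw [one_div_div]
  refine ENNReal.rpow_le_rpow ?_ (by positivity)
  refine (lintegral_mono fun x => ?_).trans (setLIntegral_le_lintegral Ω _)
  rw [← ENNReal.rpow_mul, mul_div_cancel₀ _ hq.ne']

lemma weightBound_of_memLp_top {g : E n → ℝ} (hr : 0 < r)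
    (hg : MemLp g ∞ (volume.restrict Ω)) :
    WeightBound Ω g r r (eLpNorm g ∞ (volume.restrict Ω)) := by
  refine ⟨hg.1, hg.2.ne, fun u hu => ?_⟩
  rw [div_self hr.ne', ENNReal.rpow_one]
  calc ∫⁻ x in Ω, ‖g x‖ₑ * ‖u x‖ₑ ^ r
      ≤ ∫⁻ x in Ω, eLpNorm g ∞ (volume.restrict Ω) * ‖u x‖ₑ ^ r := by
        refine lintegral_mono_ae ?_
        filter_upwards [ae_le_eLpNormEssSup (f := g) (μ := volume.restrict Ω)] with x hx
        rw [eLpNorm_exponent_top]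
        gcongr
    _ ≤ _ := by
        rw [lintegral_const_mul' _ _ hg.2.ne]
        gcongr
        exact setLIntegral_le_lintegral _ _

namespace WeightBound

variable {wt : E n → ℝ} {K : ℝ≥0∞}

lemma aesm_mul (hW : WeightBound Ω wt m r K) {u : E n → ℝ} (hu : AEStronglyMeasurable u volume) :
    AEStronglyMeasurable (fun x => wt x * |u x| ^ m) (volume.restrict Ω) :=
  hW.1.mul (((continuous_abs.comp_aestronglyMeasurable
    hu.restrict).aemeasurable.pow_const m).aestronglyMeasurable)

lemma enorm_mul_rpow (hm : 0 ≤ m) (a b : ℝ) : ‖a * |b| ^ m‖ₑ = ‖a‖ₑ * ‖b‖ₑ ^ m := by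
  rw [enorm_mul, enorm_rpow_eq hm, Real.enorm_of_nonneg (r := |b| ^ m) (by positivity)]

lemma integrable (hm : 0 < m) (hr : 0 < r) (hW : WeightBound Ω wt m r K) {u : E n → ℝ}
    (hu : AEStronglyMeasurable u volume) (hur : pint r u < ⊤) :
    Integrable (fun x => wt x * |u x| ^ m) (volume.restrict Ω) := by
  refine ⟨hW.aesm_mul hu, ?_⟩
  rw [HasFiniteIntegral]
  simp_rw [enorm_mul_rpow hm.le]
  exact (hW.2.2 u hu).trans_lt (ENNReal.mul_lt_top hW.2.1.lt_top
    (ENNReal.rpow_lt_top_of_nonneg (by positivity) hur.ne))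

lemma abs_integral_le (hm : 0 < m) (hr : 0 < r) (hW : WeightBound Ω wt m r K) {u : E n → ℝ}
    (hu : AEStronglyMeasurable u volume) (hur : pint r u < ⊤) :
    |∫ x in Ω, wt x * |u x| ^ m| ≤ K.toReal * (pint r u).toReal ^ (m / r) := by
  have h := (enorm_integral_le_lintegral_enorm (μ := volume.restrict Ω)
    fun x => wt x * |u x| ^ m)
  simp_rw [enorm_mul_rpow hm.le] at h
  have h2 := ENNReal.toReal_mono (ENNReal.mul_ne_top hW.2.1
    (ENNReal.rpow_ne_top_of_nonneg (by positivity) hur.ne)) (h.trans (hW.2.2 u hu))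
  rwa [toReal_enorm, Real.norm_eq_abs, ENNReal.toReal_mul, ← ENNReal.toReal_rpow] at h2

/-- By homogeneity: if `|a - b| < δ |b|`, continuity of `t ↦ t^m` at one applies to `|a| / |b|`;
otherwise both `|a|` and `|b|` are at most `(1 + 1/δ) |a - b|`. -/
lemma exists_abs_rpow_sub_le (hm : 0 < m) {ε : ℝ} (hε : 0 < ε) :
    ∃ C : ℝ, 0 ≤ C ∧ ∀ a b : ℝ, |(|a| ^ m - |b| ^ m)| ≤ ε * |b| ^ m + C * |a - b| ^ m := by
  have hcont : ContinuousAt (fun t : ℝ => t ^ m) 1 :=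
    Real.continuousAt_rpow_const _ _ (Or.inl one_ne_zero)
  obtain ⟨δ, hδ, H⟩ := Metric.continuousAt_iff.1 hcont ε hε
  refine ⟨(1 + 1 / δ) ^ m, by positivity, fun a b => ?_⟩
  have hab : |(|a| - |b|)| ≤ |a - b| := abs_abs_sub_abs_le_abs_sub a b
  rcases lt_or_ge |a - b| (δ * |b|) with h | h
  · have hb : 0 < |b| := by
      by_contra hb
      have : |b| = 0 := le_antisymm (not_lt.1 hb) (abs_nonneg _)
      rw [this, mul_zero] at h
      exact absurd h (not_lt.2 (abs_nonneg _))
    have h1 : dist (|a| / |b|) 1 < δ := by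
      rw [Real.dist_eq, div_sub_one hb.ne', abs_div, abs_abs, div_lt_iff₀ hb]
      exact hab.trans_lt h
    have h2 := H h1
    rw [Real.dist_eq, Real.one_rpow, Real.div_rpow (abs_nonneg _) (abs_nonneg _),
      div_sub_one (by positivity), abs_div, abs_of_pos (a := |b| ^ m) (by positivity),
      div_lt_iff₀ (by positivity)] at h2
    have : 0 ≤ (1 + 1 / δ) ^ m * |a - b| ^ m := by positivity
    linarith
  · have hb : |b| ≤ |a - b| / δ := by
      rw [le_div_iff₀ hδ]; linarith
    have h1 : |b| ≤ (1 + 1 / δ) * |a - b| := by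
      have := abs_nonneg (a - b)
      have e : (1 + 1 / δ) * |a - b| = |a - b| + |a - b| / δ := by ring
      linarith
    have h2 : |a| ≤ (1 + 1 / δ) * |a - b| := by
      have e : (1 + 1 / δ) * |a - b| = |a - b| + |a - b| / δ := by ring
      have := (abs_le.1 hab).2
      linarith
    have h3 := Real.rpow_le_rpow (abs_nonneg _) h1 hm.le
    have h4 := Real.rpow_le_rpow (abs_nonneg _) h2 hm.le
    rw [Real.mul_rpow (by positivity) (abs_nonneg _)] at h3 h4
    have h5 : 0 ≤ |a| ^ m := by positivity
    have h6 : 0 ≤ |b| ^ m := by positivity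
    have h7 : 0 ≤ ε * |b| ^ m := by positivity
    rw [abs_le]
    constructor <;> linarith

/-- Continuity of the weighted power integrals with respect to `L^r` convergence. -/
lemma tendsto_integral (hm : 0 < m) (hr : 0 < r) (hW : WeightBound Ω wt m r K)
    {w : ℕ → E n → ℝ} {u : E n → ℝ} (hw : ∀ k, AEStronglyMeasurable (w k) volume)
    (hwr : ∀ k, pint r (w k) < ⊤) (hu : AEStronglyMeasurable u volume) (hur : pint r u < ⊤)
    (h : Tendsto (fun k => pint r (w k - u)) atTop (𝓝 0)) :
    Tendsto (fun k => ∫ x in Ω, wt x * |w k x| ^ m) atTop (𝓝 (∫ x in Ω, wt x * |u x| ^ m)) := by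
  rw [tendsto_iff_edist_tendsto_0, ENNReal.tendsto_nhds_zero]
  intro ε hε
  have hε2 : 0 < ε / 2 := ENNReal.half_pos hε.ne'
  set I := ∫⁻ x in Ω, ‖wt x‖ₑ * ‖u x‖ₑ ^ m with hI
  have hIt : I ≠ ⊤ := ((hW.2.2 u hu).trans_lt (ENNReal.mul_lt_top hW.2.1.lt_top
    (ENNReal.rpow_lt_top_of_nonneg (by positivity) hur.ne))).ne
  obtain ⟨δ, hδ, hδε⟩ : ∃ δ : ℝ, 0 < δ ∧ I * ENNReal.ofReal δ ≤ ε / 2 := by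
    obtain ⟨δ, h1, h2⟩ := exists_mul_le hIt hε2
    refine ⟨(min δ 1).toReal, ENNReal.toReal_pos (by simp [h1.ne']) (by simp), ?_⟩
    rw [ENNReal.ofReal_toReal (by simp)]
    exact (mul_le_mul_right (min_le_left _ _) _).trans h2
  obtain ⟨C, hC, H⟩ := exists_abs_rpow_sub_le hm hδ
  -- The error splits into a small multiple of the fixed integral `I` and a term controlled by `pint
  -- r (w k - u)`; no almost-everywhere convergence is needed.
  have hle : ∀ k, edist (∫ x in Ω, wt x * |w k x| ^ m) (∫ x in Ω, wt x * |u x| ^ m) ≤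
      ε / 2 + ENNReal.ofReal C * (K * pint r (w k - u) ^ (m / r)) := by
    intro k
    rw [edist_eq_enorm_sub, ← integral_sub (hW.integrable hm hr (hw k) (hwr k))
      (hW.integrable hm hr hu hur)]
    have hmeas : AEMeasurable (fun x => ENNReal.ofReal δ * (‖wt x‖ₑ * ‖u x‖ₑ ^ m))
        (volume.restrict Ω) := ((hW.1.enorm).mul (hu.restrict.enorm.pow_const m)).const_mul _
    calc _ ≤ _ := enorm_integral_le_lintegral_enorm _
      _ ≤ ∫⁻ x in Ω, (ENNReal.ofReal δ * (‖wt x‖ₑ * ‖u x‖ₑ ^ m)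
          + ENNReal.ofReal C * (‖wt x‖ₑ * ‖(w k - u) x‖ₑ ^ m)) := by
          refine lintegral_mono fun x => ?_
          dsimp only
          rw [← mul_sub, enorm_mul, mul_left_comm, mul_left_comm (ENNReal.ofReal C), ← mul_add]
          gcongr
          rw [enorm_rpow_eq hm.le, enorm_rpow_eq hm.le, ← ENNReal.ofReal_mul hδ.le,
            ← ENNReal.ofReal_mul hC, ← ENNReal.ofReal_add (by positivity) (by positivity),
            Real.enorm_eq_ofReal_abs]
          exact ENNReal.ofReal_le_ofReal (H _ _)
      _ = ENNReal.ofReal δ * I + ENNReal.ofReal C * ∫⁻ x in Ω, ‖wt x‖ₑ * ‖(w k - u) x‖ₑ ^ m := by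
          rw [lintegral_add_left' hmeas, lintegral_const_mul' _ _ ENNReal.ofReal_ne_top,
            lintegral_const_mul' _ _ ENNReal.ofReal_ne_top]
      _ ≤ _ := by
          rw [mul_comm _ I]
          gcongr
          exact hW.2.2 _ ((hw k).sub hu)
  have h1 : Tendsto (fun k => ENNReal.ofReal C * (K * pint r (w k - u) ^ (m / r))) atTop
      (𝓝 0) := by
    have h2 := h.ennrpow_const (m / r)
    rw [ENNReal.zero_rpow_of_pos (by positivity)] at h2
    have h3 := ENNReal.Tendsto.const_mul (a := ENNReal.ofReal C)
      (ENNReal.Tendsto.const_mul (a := K) h2 (Or.inr hW.2.1)) (Or.inr ENNReal.ofReal_ne_top)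
    simpa using h3
  filter_upwards [h1.eventually (eventually_le_nhds hε2)] with k hk
  calc _ ≤ _ := hle k
    _ ≤ ε / 2 + ε / 2 := by gcongr
    _ = ε := ENNReal.add_halves ε

end WeightBound

/-- Differentiation of weighted power integrals along lines. -/
lemma hasDerivAt_integral_abs_rpow {α : Type*} [MeasurableSpace α] {μ : Measure α} (hm : 1 < m)
    {w u φ : α → ℝ} (hw : AEStronglyMeasurable w μ) (hu : AEStronglyMeasurable u μ)
    (hφ : AEStronglyMeasurable φ μ) (hwu : Integrable (fun x => w x * |u x| ^ m) μ)
    (hwφ : Integrable (fun x => w x * |φ x| ^ m) μ) :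
    HasDerivAt (fun τ : ℝ => ∫ x, w x * |u x + τ * φ x| ^ m ∂μ)
      (m * ∫ x, w x * |u x| ^ (m - 2) * u x * φ x ∂μ) 0 := by
  have hm0 : 0 < m := by linarith
  have habs : ∀ {v : α → ℝ} (c : ℝ), AEStronglyMeasurable v μ →
      AEStronglyMeasurable (fun x => |v x| ^ c) μ := fun c hv =>
    (((continuous_abs.comp_aestronglyMeasurable hv).aemeasurable.pow_const c).aestronglyMeasurable)
  have hline : ∀ τ : ℝ, AEStronglyMeasurable (fun x => u x + τ * φ x) μ := fun τ =>
    hu.add (hφ.const_mul τ)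
  have key := hasDerivAt_integral_of_dominated_loc_of_deriv_le (μ := μ) (𝕜 := ℝ)
    (F := fun τ x => w x * |u x + τ * φ x| ^ m)
    (F' := fun τ x => w x * (m * |u x + τ * φ x| ^ (m - 2) * (u x + τ * φ x) * φ x))
    (x₀ := 0) (s := Metric.ball 0 1)
    -- For `|τ| < 1` the derivative is at most `m |w| (|u| + |φ|)^m` in size, and convexity splits
    -- the power.
    (bound := fun x => m * 2 ^ (m - 1) * (‖w x * |u x| ^ m‖ + ‖w x * |φ x| ^ m‖))
    (Metric.ball_mem_nhds _ one_pos)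
    (.of_forall fun τ => hw.mul (habs m (hline τ))) (by simpa using hwu)
    (by
      refine hw.mul ?_
      exact (((aestronglyMeasurable_const.mul (habs (m - 2) (hline 0))).mul (hline 0)).mul hφ))
    (by
      refine .of_forall fun x τ hτ => ?_
      have hτ1 : |τ| ≤ 1 := by
        rw [mem_ball_zero_iff, Real.norm_eq_abs] at hτ; exact hτ.le
      set y := u x + τ * φ x with hy
      have hyle : |y| ≤ |u x| + |φ x| := by
        refine (abs_add_le _ _).trans ?_
        rw [abs_mul]
        have := abs_nonneg (φ x)
        nlinarith
      -- Both sides vanish at `y = 0` whatever value `0 ^ (m - 2)` takes, so exponents `m < 2` are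
      -- covered.
      have hpow : |y| ^ (m - 2) * |y| = |y| ^ (m - 1) := by
        rcases eq_or_ne y 0 with h0 | h0
        · simp [h0, Real.zero_rpow (by linarith : m - 1 ≠ 0)]
        · rw [← Real.rpow_add_one (abs_pos.2 h0).ne']; congr 1; ring
      have hb : |y| ^ (m - 1) * |φ x| ≤ 2 ^ (m - 1) * (|u x| ^ m + |φ x| ^ m) := by
        have h0 : 0 ≤ |u x| + |φ x| := by positivity
        calc |y| ^ (m - 1) * |φ x| ≤ (|u x| + |φ x|) ^ (m - 1) * (|u x| + |φ x|) := by
              gcongr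
              linarith [abs_nonneg (u x)]
          _ = (|u x| + |φ x|) ^ m := by
              rcases h0.eq_or_lt with h | h
              · rw [← h]; simp [Real.zero_rpow hm0.ne']
              · rw [← Real.rpow_add_one h.ne']; congr 1; ring
          _ ≤ _ := by
              have := NNReal.rpow_add_le_mul_rpow_add_rpow ⟨|u x|, abs_nonneg _⟩
                ⟨|φ x|, abs_nonneg _⟩ hm.le
              exact_mod_cast this
      simp only [Real.norm_eq_abs, abs_mul,
        abs_of_nonneg (Real.rpow_nonneg (abs_nonneg (u x)) m),
        abs_of_nonneg (Real.rpow_nonneg (abs_nonneg (φ x)) m),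
        abs_of_nonneg (Real.rpow_nonneg (abs_nonneg y) (m - 2)), abs_of_pos hm0]
      calc |w x| * (m * |y| ^ (m - 2) * |y| * |φ x|)
          = |w x| * m * (|y| ^ (m - 1) * |φ x|) := by rw [← hpow]; ring
        _ ≤ |w x| * m * (2 ^ (m - 1) * (|u x| ^ m + |φ x| ^ m)) := by gcongr
        _ = _ := by ring)
    ((hwu.norm.add hwφ.norm).const_mul _)
    (by
      refine .of_forall fun x τ _ => ?_
      have h1 : HasDerivAt (fun τ : ℝ => u x + τ * φ x) (φ x) τ := by
        simpa using ((hasDerivAt_id τ).mul_const (φ x)).const_add (u x)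
      have h2 := (hasDerivAt_abs_rpow (u x + τ * φ x) hm).comp τ h1
      exact h2.const_mul (w x))
  have e : ∫ x, w x * (m * |u x + 0 * φ x| ^ (m - 2) * (u x + 0 * φ x) * φ x) ∂μ
      = m * ∫ x, w x * |u x| ^ (m - 2) * u x * φ x ∂μ := by
    rw [← integral_const_mul]
    congr 1
    ext x
    simp only [zero_mul, add_zero]
    ring
  rw [← e]
  exact key.2

end

/-! ### Test functions that detect the positive part of a weight. -/

section

variable {n : ℕ} {p s m r : ℝ} {Ω : Set (E n)}

lemma exists_isTest_eq_one {K U : Set (E n)} (hK : IsCompact K) (hU : IsOpen U) (hKU : K ⊆ U)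
    (hUΩ : U ⊆ Ω) : ∃ φ : E n → ℝ, IsTest Ω φ ∧ (∀ x, φ x ∈ Icc (0 : ℝ) 1) ∧
      (∀ x ∈ K, φ x = 1) ∧ ∀ x ∉ U, φ x = 0 := by
  obtain ⟨K', hK', hKK', hK'U⟩ := exists_compact_between hK hU hKU
  obtain ⟨φ, h1, h2, h3, h4⟩ := exists_contMDiff_support_eq_eq_one_iff
    (modelWithCornersSelf ℝ (E n)) isOpen_interior hK.isClosed hKK'
  have hsup : tsupport φ ⊆ K' := by
    rw [tsupport, h3]
    exact closure_minimal interior_subset hK'.isClosed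
  refine ⟨φ, ⟨contMDiff_iff_contDiff.1 h1, hK'.of_isClosed_subset (isClosed_tsupport φ) hsup,
    hsup.trans (hK'U.trans hUΩ)⟩, fun x => h2 (mem_range_self x), fun x hx => (h4 x).1 hx,
    fun x hx => image_eq_zero_of_notMem_tsupport fun h => hx (hK'U (hsup h))⟩

/-- If the weight is positive on a set of positive measure, some test function has positive
weighted power integral. -/
lemma exists_isTest_integral_pos (hm : 0 < m) (hΩo : IsOpen Ω) {wt : E n → ℝ}
    (hwt : Integrable wt (volume.restrict Ω))
    (hpos : ¬ ∀ᵐ x ∂(volume.restrict Ω), max (wt x) 0 = 0) :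
    ∃ φ, IsTest Ω φ ∧ 0 < ∫ x in Ω, wt x * |φ x| ^ m := by
  set g := hwt.1.mk wt with hg
  have hgm : Measurable g := hwt.1.stronglyMeasurable_mk.measurable
  have hgwt : wt =ᵐ[volume.restrict Ω] g := hwt.1.ae_eq_mk
  set A := Ω ∩ {x | 0 < g x} with hA
  have hAm : MeasurableSet A := hΩo.measurableSet.inter (measurableSet_lt measurable_const hgm)
  have hA0 : 0 < volume A := by
    rw [pos_iff_ne_zero]
    intro h0
    apply hpos
    have h1 : ∀ᵐ x ∂(volume.restrict Ω), x ∉ A := by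
      rw [ae_iff]
      simp only [not_not]
      exact le_antisymm ((Measure.restrict_apply_le _ _).trans h0.le) zero_le
    filter_upwards [h1, hgwt, ae_restrict_mem hΩo.measurableSet] with x hx1 hx2 hx3
    rw [hx2]
    refine max_eq_right (not_lt.1 fun h => hx1 ⟨hx3, h⟩)
  obtain ⟨K, hKA, hK, hK0⟩ := hAm.exists_lt_isCompact hA0
  have hKΩ : K ⊆ Ω := hKA.trans inter_subset_left
  have hKi : IntegrableOn wt K volume := hwt.mono_measure (Measure.restrict_mono hKΩ le_rfl)
  set c := ∫ x in K, wt x with hc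
  have hc0 : 0 < c := by
    have e : c = ∫ x in K, g x := integral_congr_ae
      (ae_mono (Measure.restrict_mono hKΩ le_rfl) hgwt)
    rw [e, setIntegral_pos_iff_support_of_nonneg_ae]
    · refine hK0.trans_le (measure_mono fun x hx => ⟨(hKA hx).2.ne', hx⟩)
    · exact (ae_restrict_iff' hK.measurableSet).2 (.of_forall fun x hx => (hKA hx).2.le)
    · exact hKi.congr (ae_mono (Measure.restrict_mono hKΩ le_rfl) hgwt)
  -- By absolute continuity of the integral, the transition layer `U \ K`, where the sign of `wt` is
  -- uncontrolled, can be made to cost less than the gain `c` on `K`.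
  obtain ⟨δ, hδ, hδc⟩ := exists_pos_setLIntegral_lt_of_measure_lt (μ := volume.restrict Ω)
    (f := fun x => ‖wt x‖ₑ) hwt.2.ne (ENNReal.ofReal_pos.2 hc0).ne'
  obtain ⟨U, hKU, hU, hUv⟩ := K.exists_isOpen_lt_add (hK.measure_lt_top (μ := volume)).ne hδ.ne'
  obtain ⟨φ, hφ, hφI, hφ1, hφ0⟩ := exists_isTest_eq_one hK (hU.inter hΩo) (subset_inter hKU hKΩ)
    inter_subset_right
  have hUKm : MeasurableSet (U \ K) := hU.measurableSet.diff hK.measurableSet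
  have hsmall : ∫ x in U \ K, |wt x| ∂(volume.restrict Ω) < c := by
    have h1 : volume (U \ K) < δ := by
      rw [measure_sdiff hKU hK.measurableSet.nullMeasurableSet hK.measure_lt_top.ne]
      exact ENNReal.sub_lt_of_lt_add (measure_mono hKU) (by rwa [add_comm])
    have h2 := hδc (U \ K) ((Measure.restrict_apply_le _ _).trans_lt h1)
    rw [integral_eq_lintegral_of_nonneg_ae (.of_forall fun x => abs_nonneg _)
      (continuous_abs.comp_aestronglyMeasurable hwt.1).restrict]
    simp_rw [← Real.enorm_eq_ofReal_abs]
    rw [← ENNReal.ofReal_lt_ofReal_iff hc0, ENNReal.ofReal_toReal h2.ne_top]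
    exact h2
  refine ⟨φ, hφ, ?_⟩
  have hφm : AEStronglyMeasurable (fun x => |φ x| ^ m) (volume.restrict Ω) :=
    ((hφ.1.continuous.abs).rpow_const fun _ => Or.inr hm.le).aestronglyMeasurable
  have hle1 : ∀ x, |φ x| ^ m ≤ 1 := fun x =>
    Real.rpow_le_one (abs_nonneg _) (by rw [abs_of_nonneg (hφI x).1]; exact (hφI x).2) hm.le
  have hint : Integrable (fun x => wt x * |φ x| ^ m) (volume.restrict Ω) := by
    refine hwt.mono (hwt.1.mul hφm) (.of_forall fun x => ?_)
    rw [norm_mul, Real.norm_of_nonneg (r := |φ x| ^ m) (by positivity)]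
    exact mul_le_of_le_one_right (norm_nonneg _) (hle1 x)
  have hi1 : Integrable (K.indicator wt) (volume.restrict Ω) := hwt.indicator hK.measurableSet
  have hi2 : Integrable ((U \ K).indicator fun x => |wt x|) (volume.restrict Ω) :=
    hwt.abs.indicator hUKm
  have hcomp : ∫ x in Ω, (K.indicator wt x - (U \ K).indicator (fun x => |wt x|) x) ≤
      ∫ x in Ω, wt x * |φ x| ^ m := by
    refine integral_mono (hi1.sub hi2) hint fun x => ?_
    dsimp only
    by_cases hxK : x ∈ K
    · simp [hxK, hφ1 x hxK]
    by_cases hxU : x ∈ U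
    · have h1 : x ∈ U \ K := ⟨hxU, hxK⟩
      simp only [hxK, not_false_eq_true, indicator_of_notMem, h1, indicator_of_mem, zero_sub]
      have h2 : |wt x * |φ x| ^ m| ≤ |wt x| := by
        rw [abs_mul, abs_of_nonneg (a := |φ x| ^ m) (by positivity)]
        exact mul_le_of_le_one_right (abs_nonneg _) (hle1 x)
      linarith [neg_abs_le (wt x * |φ x| ^ m)]
    · have h1 : x ∉ U \ K := fun h => hxU h.1
      simp [hxK, h1, hφ0 x fun h => hxU h.1, Real.zero_rpow hm.ne']
  rw [integral_sub hi1 hi2, integral_indicator hK.measurableSet, integral_indicator hUKm,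
    Measure.restrict_restrict hK.measurableSet, inter_eq_self_of_subset_left hKΩ] at hcomp
  linarith

end

/-! ### Real-variable analysis of the fiber maps. -/

section

/-- The energy as a function of `N = ‖u‖^p`, `F = λ ∫ f |u|^q` and `G = ∫ g |u|^r`. -/
def energy (p q r a b N F G : ℝ) : ℝ := a / p * N + b / (2 * p) * N ^ 2 - F / q - G / r

/-- The derivative of the fiber map at one. -/
def nehariDefect (a b N F G : ℝ) : ℝ := a * N + b * N ^ 2 - F - G

/-- The second derivative of the fiber map at one, on the Nehari set. -/
def secondDefect (p q r a b N G : ℝ) : ℝ :=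
  (p - q) * a * N + (2 * p - q) * b * N ^ 2 - (r - q) * G

/-- The fiber map. -/
def ray (p q r a b N F G t : ℝ) : ℝ := energy p q r a b (t ^ p * N) (t ^ q * F) (t ^ r * G)

/-- The function whose level sets are the critical points of the fiber map. -/
def level (p q r a b N G t : ℝ) : ℝ :=
  a * N * t ^ (p - q) + b * N ^ 2 * t ^ (2 * p - q) - G * t ^ (r - q)

/-- The derivative of `level`, up to a positive factor. -/
def levelSlope (p q r a b N G t : ℝ) : ℝ :=
  (p - q) * a * N + (2 * p - q) * b * N ^ 2 * t ^ p - (r - q) * G * t ^ (r - p)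

/-- Parameters of the problem. -/
structure Params (p q r a b : ℝ) : Prop where
  q1 : 1 < q
  qp : q < p
  pr : 2 * p < r
  a0 : 0 < a
  b0 : 0 < b

/-- The fiber map has no degenerate critical point. -/
def Nondegenerate (p q r a b N F G : ℝ) : Prop :=
  ∀ t, 0 < t → secondDefect p q r a b (t ^ p * N) (t ^ r * G) = 0 →
    0 < nehariDefect a b (t ^ p * N) (t ^ q * F) (t ^ r * G)

variable {p q r a b N F G t : ℝ}

namespace Params

lemma p0 (h : Params p q r a b) : 0 < p := by linarith [h.q1, h.qp]

lemma r0 (h : Params p q r a b) : 0 < r := by linarith [h.p0, h.pr]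

lemma sq_scaled (ht : 0 < t) : (t ^ p * N) ^ 2 = t ^ (2 * p) * N ^ 2 := by
  rw [mul_pow, ← Real.rpow_natCast (t ^ p), ← Real.rpow_mul ht.le]
  congr 2
  push_cast
  ring

lemma nehariDefect_scaled (ht : 0 < t) :
    nehariDefect a b (t ^ p * N) (t ^ q * F) (t ^ r * G)
      = t ^ q * (level p q r a b N G t - F) := by
  have e1 : t ^ p = t ^ q * t ^ (p - q) := by rw [← Real.rpow_add ht]; congr 1; ring
  have e2 : t ^ (2 * p) = t ^ q * t ^ (2 * p - q) := by rw [← Real.rpow_add ht]; congr 1; ring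
  have e3 : t ^ r = t ^ q * t ^ (r - q) := by rw [← Real.rpow_add ht]; congr 1; ring
  rw [nehariDefect, level, sq_scaled ht, e1, e2, e3]
  ring

lemma secondDefect_scaled (ht : 0 < t) :
    secondDefect p q r a b (t ^ p * N) (t ^ r * G) = t ^ p * levelSlope p q r a b N G t := by
  have e2 : t ^ (2 * p) = t ^ p * t ^ p := by rw [← Real.rpow_add ht]; congr 1; ring
  have e3 : t ^ r = t ^ p * t ^ (r - p) := by rw [← Real.rpow_add ht]; congr 1; ring
  rw [secondDefect, levelSlope, sq_scaled ht, e2, e3]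
  ring

lemma secondDefect_eq_slope : secondDefect p q r a b N G = levelSlope p q r a b N G 1 := by
  simp [secondDefect, levelSlope]

lemma nehariDefect_eq_level : nehariDefect a b N F G = level p q r a b N G 1 - F := by
  simp [nehariDefect, level]
  ring

lemma ray_one : ray p q r a b N F G 1 = energy p q r a b N F G := by simp [ray]

lemma hasDerivAt_level (ht : 0 < t) :
    HasDerivAt (level p q r a b N G) (t ^ (p - q - 1) * levelSlope p q r a b N G t) t := by
  have h1 := (Real.hasDerivAt_rpow_const (p := p - q) (Or.inl ht.ne')).const_mul (a * N)
  have h2 := (Real.hasDerivAt_rpow_const (p := 2 * p - q) (Or.inl ht.ne')).const_mul (b * N ^ 2)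
  have h3 := (Real.hasDerivAt_rpow_const (p := r - q) (Or.inl ht.ne')).const_mul G
  have e2 : t ^ (2 * p - q - 1) = t ^ (p - q - 1) * t ^ p := by
    rw [← Real.rpow_add ht]; congr 1; ring
  have e3 : t ^ (r - q - 1) = t ^ (p - q - 1) * t ^ (r - p) := by
    rw [← Real.rpow_add ht]; congr 1; ring
  rw [e2] at h2
  rw [e3] at h3
  refine ((h1.add h2).sub h3).congr_deriv ?_
  rw [levelSlope]
  ring

lemma hasDerivAt_ray (h : Params p q r a b) (ht : 0 < t) :
    HasDerivAt (ray p q r a b N F G) (t ^ (q - 1) * (level p q r a b N G t - F)) t := by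
  have hp := h.p0.ne'
  have hq : q ≠ 0 := by linarith [h.q1]
  have hr := h.r0.ne'
  have h1 := (Real.hasDerivAt_rpow_const (p := p) (Or.inl ht.ne')).const_mul (a / p * N)
  have h2 := (Real.hasDerivAt_rpow_const (p := 2 * p) (Or.inl ht.ne')).const_mul
    (b / (2 * p) * N ^ 2)
  have h3 := (Real.hasDerivAt_rpow_const (p := q) (Or.inl ht.ne')).const_mul (F / q)
  have h4 := (Real.hasDerivAt_rpow_const (p := r) (Or.inl ht.ne')).const_mul (G / r)
  have e1 : t ^ (p - 1) = t ^ (q - 1) * t ^ (p - q) := by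
    rw [← Real.rpow_add ht]; congr 1; ring
  have e2 : t ^ (2 * p - 1) = t ^ (q - 1) * t ^ (2 * p - q) := by
    rw [← Real.rpow_add ht]; congr 1; ring
  have e4 : t ^ (r - 1) = t ^ (q - 1) * t ^ (r - q) := by
    rw [← Real.rpow_add ht]; congr 1; ring
  rw [e1] at h1
  rw [e2] at h2
  rw [e4] at h4
  refine ((((h1.add h2).sub h3).sub h4).congr_deriv (f' := _) ?_).congr_of_eventuallyEq ?_
  · rw [level]
    field_simp
    ring
  · filter_upwards [lt_mem_nhds ht] with τ hτ
    simp only [ray, energy, sq_scaled hτ, Pi.add_apply, Pi.sub_apply]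
    ring

/-- From `y` down to `x` the `G` term scales by exactly `(x/y)^(r-p)`, while the constant term and
the `t^p` term shrink by no more than that factor because `r - p > p`. Hence the slope at `x`
exceeds `(x/y)^(r-p)` times the slope at `y`, and `level` can only rise and then fall. -/
lemma slope_pos_of_lt (h : Params p q r a b) (hN : 0 < N) {x y : ℝ} (hx : 0 < x) (hxy : x < y)
    (hy : 0 ≤ levelSlope p q r a b N G y) : 0 < levelSlope p q r a b N G x := by
  have hp := h.p0
  have hy0 : 0 < y := hx.trans hxy
  have hA : 0 < (p - q) * a * N := mul_pos (mul_pos (by linarith [h.qp]) h.a0) hN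
  have hB : 0 < (2 * p - q) * b * N ^ 2 :=
    mul_pos (mul_pos (by linarith [h.qp]) h.b0) (by positivity)
  have hd : x / y < 1 := (div_lt_one hy0).2 hxy
  have hd0 : 0 < x / y := by positivity
  have h1 : (x / y) ^ (r - p) < 1 := Real.rpow_lt_one hd0.le hd (by linarith [h.pr])
  have h2 : (x / y) ^ (r - p) ≤ (x / y) ^ p :=
    Real.rpow_le_rpow_of_exponent_ge hd0 hd.le (by linarith [h.pr])
  have ex : x = y * (x / y) := by field_simp
  have e1 : x ^ p = y ^ p * (x / y) ^ p := by
    conv_lhs => rw [ex]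
    rw [Real.mul_rpow hy0.le hd0.le]
  have e2 : x ^ (r - p) = y ^ (r - p) * (x / y) ^ (r - p) := by
    conv_lhs => rw [ex]
    rw [Real.mul_rpow hy0.le hd0.le]
  have h3 : 0 < (x / y) ^ (r - p) := by positivity
  rw [levelSlope] at hy ⊢
  rw [e1, e2]
  have h4 : 0 < y ^ p := by positivity
  have h5 : (2 * p - q) * b * N ^ 2 * y ^ p * (x / y) ^ (r - p)
      ≤ (2 * p - q) * b * N ^ 2 * y ^ p * (x / y) ^ p := by gcongr
  have h6 : (p - q) * a * N * (x / y) ^ (r - p) < (p - q) * a * N := mul_lt_of_lt_one_right hA h1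
  have h7 := mul_nonneg hy h3.le
  nlinarith

lemma slope_neg_of_lt (h : Params p q r a b) (hN : 0 < N) {x y : ℝ} (hx : 0 < x) (hxy : x < y)
    (hx' : levelSlope p q r a b N G x ≤ 0) : levelSlope p q r a b N G y < 0 := by
  by_contra hy
  exact absurd (h.slope_pos_of_lt hN hx hxy (not_lt.1 hy)) (not_lt.2 hx')

lemma slope_pos_of_nonpos (h : Params p q r a b) (hN : 0 < N) (hG : G ≤ 0) (ht : 0 < t) :
    0 < levelSlope p q r a b N G t := by
  have hA : 0 < (p - q) * a * N := mul_pos (mul_pos (by linarith [h.qp]) h.a0) hN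
  have hB : 0 < (2 * p - q) * b * N ^ 2 :=
    mul_pos (mul_pos (by linarith [h.qp, h.p0]) h.b0) (by positivity)
  have h1 : 0 < t ^ p := by positivity
  have h2 : 0 < t ^ (r - p) := by positivity
  have h3 : (r - q) * G * t ^ (r - p) ≤ 0 :=
    mul_nonpos_of_nonpos_of_nonneg
      (mul_nonpos_of_nonneg_of_nonpos (by linarith [h.qp, h.pr, h.p0]) hG) h2.le
  have h4 := mul_pos hB h1
  rw [levelSlope]
  linarith

lemma continuousOn_level : ContinuousOn (level p q r a b N G) (Ioi 0) := fun _ ht =>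
  (hasDerivAt_level ht).continuousAt.continuousWithinAt

lemma level_le_of_slope_nonneg (h : Params p q r a b) (hN : 0 < N) {x y : ℝ} (hx : 0 < x)
    (hxy : x ≤ y) (hy : 0 ≤ levelSlope p q r a b N G y) :
    level p q r a b N G x ≤ level p q r a b N G y := by
  refine monotoneOn_of_deriv_nonneg (convex_Icc x y)
    (continuousOn_level.mono fun z hz => hx.trans_le hz.1) ?_ ?_ (left_mem_Icc.2 hxy)
    (right_mem_Icc.2 hxy) hxy
  · intro z hz
    rw [interior_Icc] at hz
    exact (hasDerivAt_level (hx.trans hz.1)).differentiableAt.differentiableWithinAt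
  · intro z hz
    rw [interior_Icc] at hz
    have hz0 := hx.trans hz.1
    rw [(hasDerivAt_level hz0).deriv]
    exact mul_nonneg (by positivity) (h.slope_pos_of_lt hN hz0 hz.2 hy).le

lemma level_le_of_slope_nonpos (h : Params p q r a b) (hN : 0 < N) {x y : ℝ} (hx : 0 < x)
    (hxy : x ≤ y) (hx' : levelSlope p q r a b N G x ≤ 0) :
    level p q r a b N G y ≤ level p q r a b N G x := by
  refine antitoneOn_of_deriv_nonpos (convex_Icc x y)
    (continuousOn_level.mono fun z hz => hx.trans_le hz.1) ?_ ?_ (left_mem_Icc.2 hxy)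
    (right_mem_Icc.2 hxy) hxy
  · intro z hz
    rw [interior_Icc] at hz
    exact (hasDerivAt_level (hx.trans hz.1)).differentiableAt.differentiableWithinAt
  · intro z hz
    rw [interior_Icc] at hz
    have hz0 := hx.trans hz.1
    rw [(hasDerivAt_level hz0).deriv]
    exact mul_nonpos_of_nonneg_of_nonpos (by positivity)
      (h.slope_neg_of_lt hN hx hz.1 hx').le

lemma ray_le_of_level_ge (h : Params p q r a b) {x y : ℝ} (hx : 0 < x) (hxy : x ≤ y)
    (hF : ∀ z ∈ Ioo x y, F ≤ level p q r a b N G z) :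
    ray p q r a b N F G x ≤ ray p q r a b N F G y := by
  refine monotoneOn_of_deriv_nonneg (convex_Icc x y) (fun z hz =>
    (h.hasDerivAt_ray (hx.trans_le hz.1)).continuousAt.continuousWithinAt) ?_ ?_
    (left_mem_Icc.2 hxy) (right_mem_Icc.2 hxy) hxy
  · intro z hz
    rw [interior_Icc] at hz
    exact (h.hasDerivAt_ray (hx.trans hz.1)).differentiableAt.differentiableWithinAt
  · intro z hz
    rw [interior_Icc] at hz
    have hz0 := hx.trans hz.1
    rw [(h.hasDerivAt_ray hz0).deriv]
    exact mul_nonneg (by positivity) (sub_nonneg.2 (hF z hz))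

lemma ray_le_of_level_le (h : Params p q r a b) {x y : ℝ} (hx : 0 < x) (hxy : x ≤ y)
    (hF : ∀ z ∈ Ioo x y, level p q r a b N G z ≤ F) :
    ray p q r a b N F G y ≤ ray p q r a b N F G x := by
  refine antitoneOn_of_deriv_nonpos (convex_Icc x y) (fun z hz =>
    (h.hasDerivAt_ray (hx.trans_le hz.1)).continuousAt.continuousWithinAt) ?_ ?_
    (left_mem_Icc.2 hxy) (right_mem_Icc.2 hxy) hxy
  · intro z hz
    rw [interior_Icc] at hz
    exact (h.hasDerivAt_ray (hx.trans hz.1)).differentiableAt.differentiableWithinAt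
  · intro z hz
    rw [interior_Icc] at hz
    have hz0 := hx.trans hz.1
    rw [(h.hasDerivAt_ray hz0).deriv]
    exact mul_nonpos_of_nonneg_of_nonpos (by positivity) (sub_nonpos.2 (hF z hz))

lemma exists_rpow_ge {c : ℝ} (hc : 0 < c) (D : ℝ) : ∃ t : ℝ, 1 ≤ t ∧ ∀ τ, t ≤ τ → D ≤ τ ^ c := by
  obtain ⟨t, ht⟩ := eventually_atTop.1 ((tendsto_rpow_atTop hc).eventually_ge_atTop D)
  exact ⟨max 1 t, le_max_left _ _, fun τ hτ => ht τ ((le_max_right _ _).trans hτ)⟩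

lemma exists_slope_eq_zero (h : Params p q r a b) (hN : 0 < N) (hG : 0 < G) :
    ∃ T, 0 < T ∧ levelSlope p q r a b N G T = 0 := by
  have hp := h.p0
  have hA : 0 < (p - q) * a * N := mul_pos (mul_pos (by linarith [h.qp]) h.a0) hN
  have hB : 0 < (2 * p - q) * b * N ^ 2 :=
    mul_pos (mul_pos (by linarith [h.qp]) h.b0) (by positivity)
  have hC : 0 < (r - q) * G := mul_pos (by linarith [h.qp, h.pr]) hG
  -- At such a `t ≥ 1` the `G` term is at least the sum of the two positive coefficients times
  -- `t^p`, so the slope is nonpositive.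
  obtain ⟨t, ht1, ht⟩ := exists_rpow_ge (by linarith [h.pr] : 0 < r - 2 * p)
    (((p - q) * a * N + (2 * p - q) * b * N ^ 2) / ((r - q) * G))
  have ht0 : 0 < t := by linarith
  have hneg : levelSlope p q r a b N G t ≤ 0 := by
    have h1 := ht t le_rfl
    rw [div_le_iff₀ hC] at h1
    have e3 : t ^ (r - p) = t ^ (r - 2 * p) * t ^ p := by
      rw [← Real.rpow_add ht0]; congr 1; ring
    have h2 : 1 ≤ t ^ p := Real.one_le_rpow ht1 hp.le
    rw [levelSlope, e3]
    nlinarith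
  have hcont : ContinuousOn (levelSlope p q r a b N G) (Icc 0 t) := by
    unfold levelSlope
    have h1 : Continuous fun t : ℝ => t ^ p := Real.continuous_rpow_const hp.le
    have h2 : Continuous fun t : ℝ => t ^ (r - p) :=
      Real.continuous_rpow_const (by linarith [h.pr])
    fun_prop
  have h0 : levelSlope p q r a b N G 0 = (p - q) * a * N := by
    simp [levelSlope, Real.zero_rpow hp.ne', Real.zero_rpow (by linarith [h.pr] : r - p ≠ 0)]
  obtain ⟨T, hT, hT0⟩ := intermediate_value_Icc' ht0.le hcont ⟨hneg, h0 ▸ hA.le⟩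
  refine ⟨T, lt_of_le_of_ne hT.1 ?_, hT0⟩
  rintro rfl
  linarith

/-- A zero of the slope is the peak of `level`; nondegeneracy says exactly that the peak lies
strictly above `F`. -/
lemma lt_level_of_slope_eq_zero (hnd : Nondegenerate p q r a b N F G) (ht : 0 < t)
    (hs : levelSlope p q r a b N G t = 0) : F < level p q r a b N G t := by
  have := hnd t ht (by rw [secondDefect_scaled ht, hs, mul_zero])
  rw [nehariDefect_scaled ht] at this
  have h2 := pos_of_mul_pos_right this (by positivity)
  linarith

lemma level_ge (h : Params p q r a b) (hG : G ≤ 0) (ht : 0 < t) :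
    a * N * t ^ (p - q) ≤ level p q r a b N G t := by
  rw [level]
  have h1 : G * t ^ (r - q) ≤ 0 := mul_nonpos_of_nonpos_of_nonneg hG (by positivity)
  have h2 : 0 ≤ b * N ^ 2 * t ^ (2 * p - q) := by
    have := h.b0
    positivity
  linarith

/-- A point of the fiber with `level = F` and positive slope. -/
lemma exists_level_eq_slope_pos (h : Params p q r a b) (hN : 0 < N) (hF : 0 < F)
    (hnd : Nondegenerate p q r a b N F G) :
    ∃ t, 0 < t ∧ level p q r a b N G t = F ∧ 0 < levelSlope p q r a b N G t := by
  have hp := h.p0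
  have key : ∀ T, 0 < T → F ≤ level p q r a b N G T →
      ∃ t, 0 < t ∧ t ≤ T ∧ level p q r a b N G t = F := by
    intro T hT hFT
    have hcont : ContinuousOn (level p q r a b N G) (Icc 0 T) := by
      unfold level
      have h1 : Continuous fun t : ℝ => t ^ (p - q) :=
        Real.continuous_rpow_const (by linarith [h.qp])
      have h2 : Continuous fun t : ℝ => t ^ (r - q) :=
        Real.continuous_rpow_const (by linarith [h.pr, h.qp])
      have h3 : Continuous fun t : ℝ => t ^ (2 * p - q) :=
        Real.continuous_rpow_const (by linarith [h.qp])
      fun_prop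
    have h0 : level p q r a b N G 0 = 0 := by
      simp [level, Real.zero_rpow (by linarith [h.qp] : p - q ≠ 0),
        Real.zero_rpow (by linarith [h.qp] : 2 * p - q ≠ 0),
        Real.zero_rpow (by linarith [h.qp, h.pr] : r - q ≠ 0)]
    obtain ⟨t, ht, htF⟩ := intermediate_value_Icc hT.le hcont ⟨by rw [h0]; exact hF.le, hFT⟩
    refine ⟨t, lt_of_le_of_ne ht.1 ?_, ht.2, htF⟩
    rintro rfl
    linarith
  -- For `G ≤ 0` the slope is positive everywhere and `level` is unbounded; for `G > 0` the crossing
  -- is taken to the left of the peak.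
  rcases le_or_gt G 0 with hG | hG
  · obtain ⟨T, hT1, hT⟩ := exists_rpow_ge (by linarith [h.qp] : 0 < p - q) (F / (a * N))
    have hT0 : 0 < T := by linarith
    have h1 := hT T le_rfl
    rw [div_le_iff₀ (mul_pos h.a0 hN)] at h1
    obtain ⟨t, ht, -, htF⟩ := key T hT0 (by
      have := h.level_ge (N := N) hG hT0
      linarith)
    exact ⟨t, ht, htF, h.slope_pos_of_nonpos hN hG ht⟩
  · obtain ⟨T, hT0, hT⟩ := h.exists_slope_eq_zero hN hG
    have hlt := lt_level_of_slope_eq_zero hnd hT0 hT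
    obtain ⟨t, ht, htT, htF⟩ := key T hT0 hlt.le
    refine ⟨t, ht, htF, h.slope_pos_of_lt hN ht (lt_of_le_of_ne htT ?_) hT.ge⟩
    rintro rfl
    linarith

/-- A point of the fiber with `level = F` and negative slope. -/
lemma exists_level_eq_slope_neg (h : Params p q r a b) (hN : 0 < N) (hG : 0 < G)
    (hnd : Nondegenerate p q r a b N F G) :
    ∃ t, 0 < t ∧ level p q r a b N G t = F ∧ levelSlope p q r a b N G t < 0 := by
  have hp := h.p0
  obtain ⟨T, hT0, hT⟩ := h.exists_slope_eq_zero hN hG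
  have hlt := lt_level_of_slope_eq_zero hnd hT0 hT
  -- Beyond `τ ≥ 1` the `G` term outweighs the two positive terms together with `|F|`, so `level`
  -- has fallen to `F` or below, whatever the sign of `F`.
  obtain ⟨τ, hτ1, hτ⟩ := exists_rpow_ge (by linarith [h.pr] : 0 < r - 2 * p)
    ((a * N + b * N ^ 2 + |F|) / G)
  set y := max T τ with hy
  have hy1 : 1 ≤ y := hτ1.trans (le_max_right _ _)
  have hy0 : 0 < y := by linarith
  have hyF : level p q r a b N G y ≤ F := by
    have h1 := hτ y (le_max_right _ _)
    rw [div_le_iff₀ hG] at h1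
    have e1 : y ^ (r - q) = y ^ (2 * p - q) * y ^ (r - 2 * p) := by
      rw [← Real.rpow_add hy0]; congr 1; ring
    have h2 : y ^ (p - q) ≤ y ^ (2 * p - q) := Real.rpow_le_rpow_of_exponent_le hy1 (by linarith)
    have h3 : 1 ≤ y ^ (2 * p - q) := Real.one_le_rpow hy1 (by linarith [h.qp])
    have h4 : a * N * y ^ (p - q) ≤ a * N * y ^ (2 * p - q) :=
      mul_le_mul_of_nonneg_left h2 (mul_pos h.a0 hN).le
    have h5 := mul_le_mul_of_nonneg_left h1 (by linarith : 0 ≤ y ^ (2 * p - q))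
    have h6 : |F| ≤ |F| * y ^ (2 * p - q) := le_mul_of_one_le_right (abs_nonneg F) h3
    have h7 := neg_abs_le F
    rw [level, e1]
    nlinarith
  obtain ⟨t, ht, htF⟩ := intermediate_value_Icc' (le_max_left T τ)
    (continuousOn_level.mono fun z hz => hT0.trans_le hz.1) ⟨hyF, hlt.le⟩
  have htT : T < t := lt_of_le_of_ne ht.1 (by rintro rfl; linarith)
  exact ⟨t, hT0.trans htT, htF, h.slope_neg_of_lt hN hT0 htT hT.le⟩

end Params

/-- The triple `(N, F, G)` belongs to an element of the positive part of the Nehari set. -/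
def TriplePlus (p q r a b N F G : ℝ) : Prop :=
  0 < N ∧ nehariDefect a b N F G = 0 ∧ 0 < secondDefect p q r a b N G

/-- The triple `(N, F, G)` belongs to an element of the negative part of the Nehari set. -/
def TripleMinus (p q r a b N F G : ℝ) : Prop :=
  0 < N ∧ nehariDefect a b N F G = 0 ∧ secondDefect p q r a b N G < 0

namespace Params

lemma triplePlus_scaled (hN : 0 < N) (ht : 0 < t) (h1 : level p q r a b N G t = F)
    (h2 : 0 < levelSlope p q r a b N G t) :
    TriplePlus p q r a b (t ^ p * N) (t ^ q * F) (t ^ r * G) := by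
  refine ⟨by positivity, ?_, ?_⟩
  · rw [nehariDefect_scaled ht, h1, sub_self, mul_zero]
  · rw [secondDefect_scaled ht]
    positivity

lemma tripleMinus_scaled (hN : 0 < N) (ht : 0 < t) (h1 : level p q r a b N G t = F)
    (h2 : levelSlope p q r a b N G t < 0) :
    TripleMinus p q r a b (t ^ p * N) (t ^ q * F) (t ^ r * G) := by
  refine ⟨by positivity, ?_, ?_⟩
  · rw [nehariDefect_scaled ht, h1, sub_self, mul_zero]
  · rw [secondDefect_scaled ht]
    exact mul_neg_of_pos_of_neg (by positivity) h2

/-- Eliminating `G` between the two defects writes `(r - q) F` as a sum of positive terms. -/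
lemma pos_of_triplePlus (h : Params p q r a b) (hT : TriplePlus p q r a b N F G) : 0 < F := by
  obtain ⟨hN, h1, h2⟩ := hT
  have hp := h.p0
  have h3 : 0 < (r - p) * (a * N) := mul_pos (by linarith [h.pr]) (mul_pos h.a0 hN)
  have h4 : 0 < (r - 2 * p) * (b * N ^ 2) :=
    mul_pos (by linarith [h.pr]) (mul_pos h.b0 (by positivity))
  have h5 : (r - q) * F = (r - p) * (a * N) + (r - 2 * p) * (b * N ^ 2)
      + secondDefect p q r a b N G := by
    rw [nehariDefect] at h1
    rw [secondDefect]
    linear_combination (q - r) * h1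
  have h6 : 0 < (r - q) * F := by rw [h5]; linarith
  exact pos_of_mul_pos_right h6 (by linarith [h.pr, h.qp])

lemma pos_of_tripleMinus (h : Params p q r a b) (hN : 0 < N)
    (hT : secondDefect p q r a b N G ≤ 0) : 0 < G := by
  by_contra hG
  have := h.slope_pos_of_nonpos hN (not_lt.1 hG) one_pos
  rw [← secondDefect_eq_slope] at this
  linarith

/-- Projection onto the positive part of the Nehari set does not increase the energy. -/
lemma exists_triplePlus_le (h : Params p q r a b) (hN : 0 < N) (hF : 0 < F)
    (hnd : Nondegenerate p q r a b N F G) (hs : 0 < secondDefect p q r a b N G) :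
    ∃ t, 0 < t ∧ TriplePlus p q r a b (t ^ p * N) (t ^ q * F) (t ^ r * G) ∧
      energy p q r a b (t ^ p * N) (t ^ q * F) (t ^ r * G) ≤ energy p q r a b N F G := by
  obtain ⟨t, ht, htF, hts⟩ := h.exists_level_eq_slope_pos hN hF hnd
  refine ⟨t, ht, triplePlus_scaled hN ht htF hts, ?_⟩
  rw [secondDefect_eq_slope] at hs
  rw [← ray_one (p := p) (q := q) (r := r) (a := a) (b := b) (N := N) (F := F) (G := G)]
  change ray p q r a b N F G t ≤ _
  -- Both `t` and one lie on the rising branch of `level`, which takes the value `F` at `t`. So the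
  -- ray falls before `t` and rises after it on this branch.
  rcases le_total t 1 with ht1 | ht1
  · refine h.ray_le_of_level_ge ht ht1 fun z hz => ?_
    have hz0 := ht.trans hz.1
    rw [← htF]
    exact h.level_le_of_slope_nonneg hN ht hz.1.le (h.slope_pos_of_lt hN hz0 hz.2 hs.le).le
  · refine h.ray_le_of_level_le one_pos ht1 fun z hz => ?_
    rw [← htF]
    exact h.level_le_of_slope_nonneg hN (one_pos.trans hz.1) hz.2.le hts.le

lemma level_mono (h : Params p q r a b) {N₀ : ℝ} (hN : 0 < N) (hNN : N ≤ N₀) (ht : 0 < t) :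
    level p q r a b N G t ≤ level p q r a b N₀ G t := by
  have := h.a0
  have := h.b0
  unfold level
  gcongr

lemma energy_mono (h : Params p q r a b) {N₀ : ℝ} (hN : 0 < N) (hNN : N ≤ N₀) :
    energy p q r a b N F G ≤ energy p q r a b N₀ F G := by
  have := h.a0
  have := h.b0
  have := h.p0
  unfold energy
  gcongr

lemma slope_mono (h : Params p q r a b) {N₀ : ℝ} (hN : 0 < N) (hNN : N ≤ N₀) (ht : 0 < t) :
    levelSlope p q r a b N G t ≤ levelSlope p q r a b N₀ G t := by
  have h1 : 0 ≤ (p - q) * a := (mul_pos (by linarith [h.qp]) h.a0).le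
  have h2 : 0 ≤ (2 * p - q) * b := (mul_pos (by linarith [h.qp, h.p0]) h.b0).le
  unfold levelSlope
  gcongr

/-- This replaces strong convergence: `N₀` stands for the limit of the norms along a minimizing
sequence, `N` for the possibly smaller value at the limit function. -/
lemma exists_triplePlus_le_of_le (h : Params p q r a b) {N₀ : ℝ} (hN : 0 < N) (hNN : N ≤ N₀)
    (hnd : Nondegenerate p q r a b N F G) (h0 : TriplePlus p q r a b N₀ F G) :
    ∃ t, 0 < t ∧ TriplePlus p q r a b (t ^ p * N) (t ^ q * F) (t ^ r * G) ∧
      energy p q r a b (t ^ p * N) (t ^ q * F) (t ^ r * G) ≤ energy p q r a b N₀ F G := by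
  obtain ⟨hN₀, h1, h2⟩ := h0
  have hF := h.pos_of_triplePlus ⟨hN₀, h1, h2⟩
  rw [nehariDefect_eq_level (p := p) (q := q) (r := r), sub_eq_zero] at h1
  rw [secondDefect_eq_slope] at h2
  have hs : 0 < secondDefect p q r a b N G := by
    rw [secondDefect_eq_slope]
    -- Otherwise the peak `T` for `N` lies at or before one, and `F` is below `level` for `N` at
    -- `T`, hence below `level` for `N₀` at `T`, which is at most its value `F` at one.
    by_contra hs
    have hG : 0 < G := by
      by_contra hG
      exact hs (h.slope_pos_of_nonpos hN (not_lt.1 hG) one_pos)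
    obtain ⟨T, hT0, hT⟩ := h.exists_slope_eq_zero hN hG
    have hT1 : T ≤ 1 := by
      by_contra hT1
      exact hs (h.slope_pos_of_lt hN one_pos (not_le.1 hT1) hT.ge)
    have h3 := lt_level_of_slope_eq_zero hnd hT0 hT
    have h4 := h.level_mono (G := G) hN hNN hT0
    have h5 := h.level_le_of_slope_nonneg hN₀ hT0 hT1 h2.le
    linarith
  obtain ⟨t, ht, h3, h4⟩ := h.exists_triplePlus_le hN hF hnd hs
  exact ⟨t, ht, h3, h4.trans (h.energy_mono hN hNN)⟩

/-- Lowering `N` lowers `level` and its slope, so the falling branch for `N` meets `F` at some `t ≤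
1`. The energy there is at most that of the `N₀` ray at `t`, which does not exceed its value at one.
-/
lemma exists_tripleMinus_le_of_le (h : Params p q r a b) {N₀ : ℝ} (hN : 0 < N) (hNN : N ≤ N₀)
    (hnd : Nondegenerate p q r a b N F G) (h0 : TripleMinus p q r a b N₀ F G) :
    ∃ t, 0 < t ∧ TripleMinus p q r a b (t ^ p * N) (t ^ q * F) (t ^ r * G) ∧
      energy p q r a b (t ^ p * N) (t ^ q * F) (t ^ r * G) ≤ energy p q r a b N₀ F G := by
  obtain ⟨hN₀, h1, h2⟩ := h0
  have hG := h.pos_of_tripleMinus hN₀ h2.le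
  rw [nehariDefect_eq_level (p := p) (q := q) (r := r), sub_eq_zero] at h1
  rw [secondDefect_eq_slope] at h2
  obtain ⟨T, hT0, hT⟩ := h.exists_slope_eq_zero hN hG
  have h3 := lt_level_of_slope_eq_zero hnd hT0 hT
  have hs1 : levelSlope p q r a b N G 1 < 0 := (h.slope_mono hN hNN one_pos).trans_lt h2
  have hT1 : T < 1 := by
    by_contra hT1
    rcases (not_lt.1 hT1).eq_or_lt with h5 | h5
    · rw [← h5] at hT; linarith
    · linarith [h.slope_pos_of_lt hN one_pos h5 hT.ge]
  have h6 : level p q r a b N G 1 ≤ F := h1 ▸ h.level_mono hN hNN one_pos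
  obtain ⟨t, ht, htF⟩ := intermediate_value_Icc' hT1.le
    (continuousOn_level.mono fun z hz => hT0.trans_le hz.1) ⟨h6, h3.le⟩
  have htT : T < t := lt_of_le_of_ne ht.1 (by rintro rfl; linarith)
  have ht0 : 0 < t := hT0.trans htT
  refine ⟨t, ht0, tripleMinus_scaled hN ht0 htF (h.slope_neg_of_lt hN hT0 htT hT.le), ?_⟩
  have h7 : energy p q r a b (t ^ p * N) (t ^ q * F) (t ^ r * G) ≤ ray p q r a b N₀ F G t :=
    h.energy_mono (by positivity) (by gcongr)
  refine h7.trans ?_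
  rw [← ray_one (p := p) (q := q) (r := r) (a := a) (b := b) (N := N₀) (F := F) (G := G)]
  refine h.ray_le_of_level_ge ht0 ht.2 fun z hz => ?_
  have hz0 := ht0.trans hz.1
  -- `level` for `N₀` is at least `F` at both ends of `[t, 1]`; being unimodal it stays above: a
  -- falling point is compared with one, a rising point with `t`.
  rcases le_total (levelSlope p q r a b N₀ G z) 0 with hz' | hz'
  · rw [← h1]
    exact h.level_le_of_slope_nonpos hN₀ hz0 hz.2.le hz'
  · calc F = level p q r a b N G t := htF.symm
      _ ≤ level p q r a b N₀ G t := h.level_mono hN hNN ht0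
      _ ≤ _ := h.level_le_of_slope_nonneg hN₀ ht0 hz.1.le hz'

/-- On the negative part of the Nehari set, one is a local maximum of the fiber map. -/
lemma eventually_ray_le (h : Params p q r a b) (h0 : TripleMinus p q r a b N F G) :
    ∀ᶠ t in 𝓝 (1 : ℝ), ray p q r a b N F G t ≤ energy p q r a b N F G := by
  obtain ⟨hN, h1, h2⟩ := h0
  rw [nehariDefect_eq_level (p := p) (q := q) (r := r), sub_eq_zero] at h1
  rw [secondDefect_eq_slope] at h2
  have hcont : ContinuousAt (levelSlope p q r a b N G) 1 := by
    unfold levelSlope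
    have e1 : ContinuousAt (fun t : ℝ => t ^ p) 1 :=
      Real.continuousAt_rpow_const _ _ (Or.inl one_ne_zero)
    have e2 : ContinuousAt (fun t : ℝ => t ^ (r - p)) 1 :=
      Real.continuousAt_rpow_const _ _ (Or.inl one_ne_zero)
    fun_prop
  rw [← ray_one (p := p) (q := q) (r := r) (a := a) (b := b) (N := N) (F := F) (G := G)]
  filter_upwards [hcont.eventually (gt_mem_nhds h2), lt_mem_nhds one_pos] with t ht ht0
  rcases le_total t 1 with ht1 | ht1
  · refine h.ray_le_of_level_ge ht0 ht1 fun z hz => ?_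
    rw [← h1]
    exact h.level_le_of_slope_nonpos hN (ht0.trans hz.1) hz.2.le
      (h.slope_neg_of_lt hN ht0 hz.1 ht.le).le
  · refine h.ray_le_of_level_le one_pos ht1 fun z hz => ?_
    rw [← h1]
    exact h.level_le_of_slope_nonpos hN one_pos hz.1.le h2.le

/-- Triples close to one in the negative part of the Nehari set are projected onto it by a factor
close to one. -/
lemma eventually_exists_tripleMinus (h : Params p q r a b) (h0 : TripleMinus p q r a b N F G)
    {α : Type*} {l : Filter α} {N' F' G' : α → ℝ} (hN' : Tendsto N' l (𝓝 N))
    (hF' : Tendsto F' l (𝓝 F)) (hG' : Tendsto G' l (𝓝 G)) {U : Set ℝ} (hU : U ∈ 𝓝 (1 : ℝ)) :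
    ∀ᶠ i in l, ∃ t ∈ U, 0 < t ∧
      TripleMinus p q r a b (t ^ p * N' i) (t ^ q * F' i) (t ^ r * G' i) := by
  obtain ⟨hN, h1, h2⟩ := h0
  rw [nehariDefect_eq_level (p := p) (q := q) (r := r), sub_eq_zero] at h1
  rw [secondDefect_eq_slope] at h2
  have hcont : ContinuousAt (levelSlope p q r a b N G) 1 := by
    unfold levelSlope
    have e1 : ContinuousAt (fun t : ℝ => t ^ p) 1 :=
      Real.continuousAt_rpow_const _ _ (Or.inl one_ne_zero)
    have e2 : ContinuousAt (fun t : ℝ => t ^ (r - p)) 1 :=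
      Real.continuousAt_rpow_const _ _ (Or.inl one_ne_zero)
    fun_prop
  obtain ⟨ε, hε, hεU⟩ := Metric.mem_nhds_iff.1
    (inter_mem (inter_mem hU (hcont.eventually (gt_mem_nhds h2))) (lt_mem_nhds (one_pos (α := ℝ))))
  rw [Real.ball_eq_Ioo] at hεU
  set x := 1 - ε / 2 with hx
  set y := 1 + ε / 2 with hy
  have hxU := hεU (⟨by linarith, by linarith⟩ : x ∈ Ioo (1 - ε) (1 + ε))
  have hyU := hεU (⟨by linarith, by linarith⟩ : y ∈ Ioo (1 - ε) (1 + ε))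
  have hx0 : 0 < x := hxU.2
  have hxs : levelSlope p q r a b N G x < 0 := hxU.1.2
  have hlevel : ∀ t, Tendsto (fun i => level p q r a b (N' i) (G' i) t) l
      (𝓝 (level p q r a b N G t)) := fun t => by
    unfold level
    exact (((hN'.const_mul a).mul_const _).add (((hN'.pow 2).const_mul b).mul_const _)).sub
      (hG'.mul_const _)
  have hslope : Tendsto (fun i => levelSlope p q r a b (N' i) (G' i) x) l
      (𝓝 (levelSlope p q r a b N G x)) := by
    unfold levelSlope
    exact ((hN'.const_mul _).add (((hN'.pow 2).const_mul _).mul_const _)).sub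
      ((hG'.const_mul _).mul_const _)
  -- Strictness places `F` strictly between the values of `level` at `x` and `y`, a condition that
  -- survives small perturbations and feeds the intermediate value theorem.
  have hstrict : ∀ {s t : ℝ}, 0 < s → s < t → levelSlope p q r a b N G s ≤ 0 →
      level p q r a b N G t < level p q r a b N G s := by
    intro s t hs hst hss
    refine strictAntiOn_of_deriv_neg (convex_Icc s t)
      (continuousOn_level.mono fun z hz => hs.trans_le hz.1) ?_ (left_mem_Icc.2 hst.le)
      (right_mem_Icc.2 hst.le) hst
    intro z hz
    rw [interior_Icc] at hz
    have hz0 := hs.trans hz.1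
    rw [(hasDerivAt_level hz0).deriv]
    exact mul_neg_of_pos_of_neg (by positivity) (h.slope_neg_of_lt hN hs hz.1 hss)
  have hxF : F < level p q r a b N G x := h1 ▸ hstrict hx0 (by linarith) hxs.le
  have hyF : level p q r a b N G y < F := h1 ▸ hstrict one_pos (by linarith) h2.le
  filter_upwards [hN'.eventually (lt_mem_nhds hN), hslope.eventually (gt_mem_nhds hxs),
    hF'.eventually_lt (hlevel x) hxF, (hlevel y).eventually_lt hF' hyF] with i i1 i2 i3 i4
  obtain ⟨t, ht, htF⟩ := intermediate_value_Icc' (by linarith : x ≤ y)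
    (continuousOn_level.mono fun z hz => hx0.trans_le hz.1) ⟨i4.le, i3.le⟩
  have htx : x < t := lt_of_le_of_ne ht.1 (by rintro h; rw [← h] at htF; linarith)
  have ht0 := hx0.trans htx
  refine ⟨t, (hεU ⟨by linarith, by linarith [ht.2]⟩).1.1, ht0,
    tripleMinus_scaled i1 ht0 htF (h.slope_neg_of_lt i1 hx0 htx i2.le)⟩

/-- The energy is negative on the positive part of the Nehari set. -/
lemma energy_neg_of_triplePlus (h : Params p q r a b) (h0 : TriplePlus p q r a b N F G) :
    energy p q r a b N F G < 0 := by
  obtain ⟨hN, h1, h2⟩ := h0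
  have hp := h.p0
  have hr := h.r0
  have hq : 0 < q := by linarith [h.q1]
  have hrq : 0 < r - q := by linarith [h.pr, h.qp]
  have hA : 0 < a * N := mul_pos h.a0 hN
  have hB : 0 < b * N ^ 2 := mul_pos h.b0 (by positivity)
  -- Rewritten through the two defects, each remaining coefficient has a definite sign because `q <
  -- p` and `2p < r`.
  have e : energy p q r a b N F G = -((p - q) * (r - p) / (p * q * r) * (a * N))
      - (2 * p - q) * (r - 2 * p) / (2 * p * q * r) * (b * N ^ 2)
      - secondDefect p q r a b N G / (q * r) + nehariDefect a b N F G / q := by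
    rw [energy, secondDefect, nehariDefect]
    field_simp
    ring
  have h3 : 0 < (p - q) * (r - p) / (p * q * r) * (a * N) :=
    mul_pos (div_pos (mul_pos (by linarith [h.qp]) (by linarith [h.pr])) (by positivity)) hA
  have h4 : 0 < (2 * p - q) * (r - 2 * p) / (2 * p * q * r) * (b * N ^ 2) :=
    mul_pos (div_pos (mul_pos (by linarith [h.qp]) (by linarith [h.pr])) (by positivity)) hB
  have h5 : 0 < secondDefect p q r a b N G / (q * r) := by positivity
  rw [e, h1, zero_div]
  linarith

lemma energy_of_nehari (h : Params p q r a b) (h1 : nehariDefect a b N F G = 0) :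
    energy p q r a b N F G = (1 / p - 1 / r) * (a * N) + (1 / (2 * p) - 1 / r) * (b * N ^ 2)
      - (1 / q - 1 / r) * F := by
  have hp := h.p0
  have hr := h.r0
  have hq : 0 < q := by linarith [h.q1]
  have : G = a * N + b * N ^ 2 - F := by rw [nehariDefect] at h1; linarith
  rw [energy, this]
  field_simp
  ring

end Params

end

/-! ### The threshold, coercivity, and the Nehari sets in terms of triples. -/

section

variable {n : ℕ} {p s q r a b lam : ℝ} {Ω : Set (E n)} {f g : E n → ℝ}

namespace Params

variable {N F G cf cg : ℝ}

/-- A nonpositive second defect makes the `G` term dominate `(p - q) a N`; as `G` is at most of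
order `N^(r/p)` with `r > p`, this bounds `N` from below. It yields the threshold and also keeps the
negative part away from zero. -/
lemma le_rpow_of_secondDefect (h : Params p q r a b) (hcg : 0 < cg) (hN : 0 < N)
    (hG : G ≤ cg * N ^ (r / p)) (hs : secondDefect p q r a b N G ≤ 0) :
    (p - q) * a / ((r - q) * cg) ≤ N ^ ((r - p) / p) := by
  have hp := h.p0
  have hrq : 0 < r - q := by linarith [h.pr, h.qp]
  have hB : 0 < (2 * p - q) * b * N ^ 2 :=
    mul_pos (mul_pos (by linarith [h.qp]) h.b0) (by positivity)
  have e : N ^ (r / p) = N ^ ((r - p) / p) * N := by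
    rw [← Real.rpow_add_one hN.ne']
    congr 1
    field_simp
    ring
  rw [e] at hG
  rw [div_le_iff₀ (by positivity)]
  have h1 : (p - q) * a * N ≤ (r - q) * (cg * (N ^ ((r - p) / p) * N)) := by
    have := mul_le_mul_of_nonneg_left hG hrq.le
    rw [secondDefect] at hs
    linarith
  refine le_of_mul_le_mul_right (h1.trans (le_of_eq ?_)) hN
  ring

/-- Below the threshold there are no degenerate critical points of the fiber maps. -/
lemma nondegenerate (h : Params p q r a b) (hcf : 0 < cf) (hcg : 0 < cg) (hN : 0 < N)
    (hF : F ≤ lam * (cf * N ^ (q / p))) (hG : G ≤ cg * N ^ (r / p))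
    (hlam : lam < (r - p) / cf * (a / (r - q)) ^ ((r - q) / (r - p))
      * ((p - q) / cg) ^ ((p - q) / (r - p))) :
    Nondegenerate p q r a b N F G := by
  have hp := h.p0
  have hrq : 0 < r - q := by linarith [h.pr, h.qp]
  have hrp : 0 < r - p := by linarith [h.pr]
  have hpq : 0 < p - q := by linarith [h.qp]
  have ha := h.a0
  intro t ht hs
  -- The bounds on `F` and `G` are invariant under dilation, so it suffices to treat the scaled
  -- triple at one.
  have hscale : ∀ c : ℝ, (t ^ p * N) ^ (c / p) = t ^ c * N ^ (c / p) := fun c => by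
    rw [Real.mul_rpow (by positivity) hN.le, ← Real.rpow_mul ht.le]
    congr 2
    field_simp
  have hF' : t ^ q * F ≤ lam * (cf * (t ^ p * N) ^ (q / p)) := by
    rw [hscale]
    have := mul_le_mul_of_nonneg_left hF (by positivity : 0 ≤ t ^ q)
    linarith
  have hG' : t ^ r * G ≤ cg * (t ^ p * N) ^ (r / p) := by
    rw [hscale]
    have := mul_le_mul_of_nonneg_left hG (by positivity : 0 ≤ t ^ r)
    linarith
  have hN' : 0 < t ^ p * N := by positivity
  generalize t ^ p * N = N' at hs hF' hG' hN' ⊢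
  generalize t ^ q * F = F' at hF' ⊢
  generalize t ^ r * G = G' at hs hG' ⊢
  have h1 := h.le_rpow_of_secondDefect hcg hN' hG' hs.le
  have h2 : ((p - q) * a / ((r - q) * cg)) ^ ((p - q) / (r - p)) ≤ N' ^ ((p - q) / p) := by
    have := Real.rpow_le_rpow (by positivity) h1 (by positivity : 0 ≤ (p - q) / (r - p))
    rw [← Real.rpow_mul hN'.le] at this
    refine this.trans (le_of_eq ?_)
    congr 1
    field_simp
  -- The threshold is rearranged so that the lower bound for `N' ^ ((p - q) / p)` appears as a
  -- factor.
  have h3 : (r - p) / cf * (a / (r - q)) ^ ((r - q) / (r - p)) * ((p - q) / cg) ^ ((p - q) / (r - p))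
      = (r - p) / cf * (a / (r - q)) * ((p - q) * a / ((r - q) * cg)) ^ ((p - q) / (r - p)) := by
    have e1 : (p - q) * a / ((r - q) * cg) = a / (r - q) * ((p - q) / cg) := by field_simp
    have e2 : (r - q) / (r - p) = 1 + (p - q) / (r - p) := by field_simp; ring
    rw [e1, Real.mul_rpow (by positivity) (by positivity), e2, Real.rpow_add (by positivity),
      Real.rpow_one]
    ring
  rw [h3] at hlam
  have h4 : N' ^ ((p - q) / p) * N' ^ (q / p) = N' := by
    rw [← Real.rpow_add hN']
    conv_rhs => rw [← Real.rpow_one N']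
    congr 1
    field_simp
    ring
  have h5 : F' < (r - p) * (a / (r - q)) * N' := by
    calc F' ≤ lam * (cf * N' ^ (q / p)) := hF'
      _ < ((r - p) / cf * (a / (r - q)) * ((p - q) * a / ((r - q) * cg)) ^ ((p - q) / (r - p)))
          * (cf * N' ^ (q / p)) := by gcongr
      _ ≤ ((r - p) / cf * (a / (r - q)) * N' ^ ((p - q) / p)) * (cf * N' ^ (q / p)) := by gcongr
      _ = (r - p) * (a / (r - q)) * (N' ^ ((p - q) / p) * N' ^ (q / p)) := by
          field_simp
      _ = _ := by rw [h4]
  have h6 : 0 ≤ (r - 2 * p) * (b * N' ^ 2) :=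
    mul_nonneg (by linarith [h.pr]) (mul_nonneg h.b0.le (by positivity))
  -- `G'` is eliminated through the vanishing second defect. The `b` term is nonnegative and simply
  -- dropped, which is why the threshold does not involve `b`.
  have h7 : (r - q) * nehariDefect a b N' F' G' = (r - p) * (a * N') + (r - 2 * p) * (b * N' ^ 2)
      - (r - q) * F' + secondDefect p q r a b N' G' := by
    rw [nehariDefect, secondDefect]
    ring
  have h8 : (r - q) * F' < (r - p) * (a * N') := by
    have := mul_lt_mul_of_pos_left h5 hrq
    refine this.trans_le (le_of_eq ?_)
    field_simp
  have h9 : 0 < (r - q) * nehariDefect a b N' F' G' := by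
    rw [h7, hs]
    linarith
  exact pos_of_mul_pos_right h9 hrq.le

/-- Coercivity of the energy on the Nehari set. -/
lemma exists_bound_of_energy_le (h : Params p q r a b) (hcf : 0 < cf) (hlam : 0 < lam) (e : ℝ) :
    ∃ R : ℝ, 0 ≤ R ∧ ∀ N F G : ℝ, 0 < N → nehariDefect a b N F G = 0 →
      F ≤ lam * (cf * N ^ (q / p)) → energy p q r a b N F G ≤ e → N ≤ R := by
  have hp := h.p0
  have hr := h.r0
  have hq : 0 < q := by linarith [h.q1]
  have ha := h.a0
  set α := (1 / p - 1 / r) * a with hα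
  have hα0 : 0 < α := mul_pos (sub_pos.2 (one_div_lt_one_div_of_lt hp (by linarith [h.pr]))) ha
  set β := (1 / q - 1 / r) * (lam * cf) with hβ
  have hqr : 0 < 1 / q - 1 / r := sub_pos.2 (one_div_lt_one_div_of_lt hq (by linarith [h.pr, h.qp]))
  have hβ0 : 0 < β := mul_pos hqr (by positivity)
  have hθ : 0 < 1 - q / p := by
    rw [sub_pos, div_lt_one hp]; exact h.qp
  -- The identity on the Nehari set gives `α N ≤ e + β N^(q/p)`. Beyond `t` the last term is at most
  -- `α N / 2`, and beyond `2 e / α` the first is less than `α N / 2`.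
  obtain ⟨t, ht1, ht⟩ := exists_rpow_ge hθ (2 * β / α)
  refine ⟨max t (2 * e / α), le_trans (by linarith) (le_max_left _ _), fun N F G hN h1 hF he => ?_⟩
  by_contra hlt
  rw [not_le, max_lt_iff] at hlt
  have h2 := ht N hlt.1.le
  rw [div_le_iff₀ hα0] at h2
  have h3 : N ^ (1 - q / p) * N ^ (q / p) = N := by
    rw [← Real.rpow_add hN]
    simp
  have h4 := mul_le_mul_of_nonneg_right h2 (by positivity : 0 ≤ N ^ (q / p))
  have h5 : 2 * e < N * α := (div_lt_iff₀ hα0).1 hlt.2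
  rw [h.energy_of_nehari h1] at he
  have h6 : 0 ≤ (1 / (2 * p) - 1 / r) * (b * N ^ 2) :=
    mul_nonneg (sub_pos.2 (one_div_lt_one_div_of_lt (by linarith) h.pr)).le
      (mul_nonneg h.b0.le (by positivity))
  have h7 := mul_le_mul_of_nonneg_left hF hqr.le
  have h8 : (1 / p - 1 / r) * (a * N) = α * N := by rw [hα]; ring
  have h9 : (1 / q - 1 / r) * (lam * (cf * N ^ (q / p))) = β * N ^ (q / p) := by rw [hβ]; ring
  have h10 : N ^ (1 - q / p) * α * N ^ (q / p) = α * N := by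
    rw [mul_comm _ α, mul_assoc, h3]
  rw [h10] at h4
  linarith

end Params

/-- The hypotheses on the data of the problem. -/
structure Setting (p s q r a b : ℝ) (Ω : Set (E n)) (f g : E n → ℝ) : Prop where
  params : Params p q r a b
  s0 : 0 < s
  s1 : s < 1
  p2 : 2 ≤ p
  psn : p * s < n
  rcrit : r < critExp n p s
  isOpen : IsOpen Ω
  nonempty : Ω.Nonempty
  bounded : Bornology.IsBounded Ω
  memLp_f : MemLp f (ENNReal.ofReal (r / (r - q))) (volume.restrict Ω)
  memLp_g : MemLp g ∞ (volume.restrict Ω)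
  f_pos : ¬ (∀ᵐ x ∂(volume.restrict Ω), max (f x) 0 = 0)
  g_pos : ¬ (∀ᵐ x ∂(volume.restrict Ω), max (g x) 0 = 0)

/-- The `p`-th power of the norm of `X₀`. -/
def normPow (p s : ℝ) (u : E n → ℝ) : ℝ := (gag p s u).toReal

/-- The weighted power integral `∫_Ω w |u|^m`. -/
def powInt (Ω : Set (E n)) (w : E n → ℝ) (m : ℝ) (u : E n → ℝ) : ℝ := ∫ x in Ω, w x * |u x| ^ m

lemma normPow_smul (hp : 0 ≤ p) {t : ℝ} (ht : 0 ≤ t) (u : E n → ℝ) :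
    normPow p s (t • u) = t ^ p * normPow p s u := by
  rw [normPow, gag_smul hp, ENNReal.toReal_mul, enorm_rpow_eq hp, abs_of_nonneg ht,
    ENNReal.toReal_ofReal (by positivity), normPow]

lemma powInt_smul {w : E n → ℝ} {m t : ℝ} (ht : 0 ≤ t) (u : E n → ℝ) :
    powInt Ω w m (t • u) = t ^ m * powInt Ω w m u := by
  rw [powInt, powInt, ← integral_const_mul]
  congr 1
  ext x
  rw [Pi.smul_apply, smul_eq_mul, abs_mul, abs_of_nonneg ht, Real.mul_rpow ht (abs_nonneg _)]
  ring

lemma powInt_abs {w : E n → ℝ} {m : ℝ} (u : E n → ℝ) :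
    powInt Ω w m (fun x => |u x|) = powInt Ω w m u := by simp [powInt]

lemma powInt_congr {w : E n → ℝ} {m : ℝ} {u v : E n → ℝ} (h : u =ᵐ[volume] v) :
    powInt Ω w m u = powInt Ω w m v := by
  refine integral_congr_ae (ae_restrict_of_ae ?_)
  filter_upwards [h] with x hx
  rw [hx]

lemma powInt_eq_zero {w : E n → ℝ} {m : ℝ} (hm : m ≠ 0) {u : E n → ℝ} (h : u =ᵐ[volume] 0) :
    powInt Ω w m u = 0 := by
  rw [powInt_congr h]
  simp [powInt, Real.zero_rpow hm]

/-- The triple of the homogeneous quantities attached to `u` has the property `T`. -/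
def HasTriple (T : ℝ → ℝ → ℝ → Prop) (p s q r : ℝ) (Ω : Set (E n)) (f g : E n → ℝ) (lam : ℝ)
    (u : E n → ℝ) : Prop :=
  T (normPow p s u) (lam * powInt Ω f q u) (powInt Ω g r u)

lemma hasTriple_smul {T : ℝ → ℝ → ℝ → Prop} (hp : 0 ≤ p) {t : ℝ} (ht : 0 ≤ t) (u : E n → ℝ) :
    HasTriple T p s q r Ω f g lam (t • u) ↔ T (t ^ p * normPow p s u)
      (t ^ q * (lam * powInt Ω f q u)) (t ^ r * powInt Ω g r u) := by
  rw [HasTriple, normPow_smul hp ht, powInt_smul ht, powInt_smul ht, mul_left_comm]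

lemma Mhat_eq (a b t : ℝ) : Mhat a b t = a * t + b / 2 * t ^ 2 := by
  simp only [Mhat, M]
  rw [intervalIntegral.integral_add (by simp) (by
    exact (continuous_const.mul continuous_id).intervalIntegrable _ _)]
  rw [intervalIntegral.integral_const_mul, integral_id, intervalIntegral.integral_const]
  simp
  ring

namespace Setting

lemma n0 (h : Setting p s q r a b Ω f g) : 0 < n := by
  have : 0 < p * s := mul_pos h.params.p0 h.s0
  exact_mod_cast this.trans h.psn

lemma p1 (h : Setting p s q r a b Ω f g) : 1 ≤ p := by linarith [h.p2]

lemma q0 (h : Setting p s q r a b Ω f g) : 0 < q := by linarith [h.params.q1]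

lemma qr (h : Setting p s q r a b Ω f g) : q < r := by
  linarith [h.params.pr, h.params.qp, h.params.p0]

lemma measurableSet (h : Setting p s q r a b Ω f g) : MeasurableSet Ω := h.isOpen.measurableSet

lemma X0_eq (h : Setting p s q r a b Ω f g) : X0 Ω p s = Adm Ω p s :=
  X0_eq_adm h.n0 h.s0 h.s1 h.p1 h.isOpen h.nonempty h.bounded

lemma gag_lt_top (h : Setting p s q r a b Ω f g) {u : E n → ℝ} (hu : u ∈ Adm Ω p s) :
    gag p s u < ⊤ := Adm.gag_lt_top h.n0 h.s0 h.s1 h.p1 hu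

lemma ofReal_normPow (h : Setting p s q r a b Ω f g) {u : E n → ℝ} (hu : u ∈ Adm Ω p s) :
    ENNReal.ofReal (normPow p s u) = gag p s u := ENNReal.ofReal_toReal (h.gag_lt_top hu).ne

lemma J_eq (h : Setting p s q r a b Ω f g) {u : E n → ℝ} (hu : u ∈ Adm Ω p s) :
    J Ω p s a b q r f g lam u = energy p q r a b (normPow p s u) (lam * powInt Ω f q u)
      (powInt Ω g r u) := by
  have hp := h.params.p0.ne'
  rw [J, Mhat_eq, normX0_rpow h.params.p0 h.measurableSet hu, energy, normPow, powInt, powInt]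
  field_simp

lemma fiber_eq (h : Setting p s q r a b Ω f g) {u : E n → ℝ} (hu : u ∈ Adm Ω p s) {t : ℝ}
    (ht : 0 ≤ t) : fiber Ω p s a b q r f g lam u t
      = ray p q r a b (normPow p s u) (lam * powInt Ω f q u) (powInt Ω g r u) t := by
  rw [fiber, h.J_eq (Adm.smul h.params.p0.le t hu), normPow_smul h.params.p0.le ht,
    powInt_smul ht, powInt_smul ht, ray, mul_left_comm]

lemma lineDeriv_J (h : Setting p s q r a b Ω f g) {u : E n → ℝ} (hu : u ∈ Adm Ω p s) :
    lineDeriv ℝ (J Ω p s a b q r f g lam) u u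
      = nehariDefect a b (normPow p s u) (lam * powInt Ω f q u) (powInt Ω g r u) := by
  rw [lineDeriv]
  have h1 := h.params.hasDerivAt_ray (N := normPow p s u) (F := lam * powInt Ω f q u)
    (G := powInt Ω g r u) one_pos
  rw [Real.one_rpow, one_mul, ← Params.nehariDefect_eq_level] at h1
  have h2 : HasDerivAt (fun t : ℝ => 1 + t) 1 0 := by
    simpa using (hasDerivAt_id (0 : ℝ)).const_add 1
  have h3 := HasDerivAt.comp (0 : ℝ) (by simpa using h1) h2
  rw [mul_one] at h3
  refine (h3.congr_of_eventuallyEq ?_).deriv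
  filter_upwards [lt_mem_nhds (by norm_num : (-1 : ℝ) < 0)] with t ht
  rw [Function.comp_apply, ← h.fiber_eq hu (by linarith), fiber, add_smul, one_smul]

/-- The first derivative is `t^(q-1) (level - F)`; at one the Nehari condition kills the term where
the power is differentiated, leaving the slope of `level`. -/
lemma iteratedDeriv_fiber (h : Setting p s q r a b Ω f g) {u : E n → ℝ} (hu : u ∈ Adm Ω p s)
    (h0 : nehariDefect a b (normPow p s u) (lam * powInt Ω f q u) (powInt Ω g r u) = 0) :
    iteratedDeriv 2 (fiber Ω p s a b q r f g lam u) 1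
      = secondDefect p q r a b (normPow p s u) (powInt Ω g r u) := by
  rw [iteratedDeriv_succ, iteratedDeriv_one]
  have h1 : deriv (fiber Ω p s a b q r f g lam u) =ᶠ[𝓝 1] fun t => t ^ (q - 1) *
      (level p q r a b (normPow p s u) (powInt Ω g r u) t - lam * powInt Ω f q u) := by
    filter_upwards [lt_mem_nhds (one_pos (α := ℝ))] with t ht
    have h2 := h.params.hasDerivAt_ray (N := normPow p s u) (F := lam * powInt Ω f q u)
      (G := powInt Ω g r u) ht
    refine (h2.congr_of_eventuallyEq ?_).deriv
    filter_upwards [lt_mem_nhds ht] with τ hτ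
    exact h.fiber_eq hu hτ.le
  rw [h1.deriv_eq]
  have h2 := (Params.hasDerivAt_level (p := p) (q := q) (r := r) (a := a) (b := b)
    (N := normPow p s u) (G := powInt Ω g r u) one_pos).sub_const (lam * powInt Ω f q u)
  have h3 := (Real.hasDerivAt_rpow_const (x := 1) (p := q - 1) (Or.inl one_ne_zero)).mul h2
  rw [Params.nehariDefect_eq_level (p := p) (q := q) (r := r)] at h0
  refine h3.deriv.trans ?_
  rw [h0, Params.secondDefect_eq_slope]
  simp

lemma ae_eq_zero_iff (h : Setting p s q r a b Ω f g) {u : E n → ℝ} (hu : u ∈ Adm Ω p s) :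
    u =ᵐ[volume] 0 ↔ normPow p s u = 0 := by
  have hp := h.params.p0
  constructor
  · intro h0
    rw [normPow, gag_congr h0]
    simp [gag, ENNReal.zero_rpow_of_pos hp]
  · intro h0
    have hP := lt_critExp hp h.s0 h.psn
    obtain ⟨C, hC, H⟩ := sobolev_critical h.p1 h.s0 h.s1 h.psn
    have h1 : gag p s u = 0 := by
      rw [← h.ofReal_normPow hu, h0, ENNReal.ofReal_zero]
    have h2 := H Ω u hu
    have hPp : 0 < critExp n p s := hp.trans hP
    rw [h1, ENNReal.zero_rpow_of_pos (div_pos hPp hp), mul_zero, nonpos_iff_eq_zero, pint,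
      lintegral_eq_zero_iff' (hu.1.enorm.pow_const _)] at h2
    filter_upwards [h2] with x hx
    simpa [ENNReal.rpow_eq_zero_iff_of_pos hPp] using hx

lemma normPow_pos (h : Setting p s q r a b Ω f g) {u : E n → ℝ} (hu : u ∈ Adm Ω p s)
    (h0 : ¬ u =ᵐ[volume] 0) : 0 < normPow p s u :=
  lt_of_le_of_ne ENNReal.toReal_nonneg fun e => h0 ((h.ae_eq_zero_iff hu).2 e.symm)

/-- The bridge to the real-variable analysis: from here on the Nehari sets are conditions on three
numbers. -/
lemma mem_nehariPlus_iff (h : Setting p s q r a b Ω f g) {u : E n → ℝ} :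
    u ∈ NehariPlus Ω p s a b q r f g lam ↔
      u ∈ Adm Ω p s ∧ HasTriple (TriplePlus p q r a b) p s q r Ω f g lam u := by
  simp only [NehariPlus, Nehari, mem_ofPred_eq, h.X0_eq, HasTriple, TriplePlus]
  constructor
  · rintro ⟨⟨hu, h0, h1⟩, h2⟩
    rw [h.lineDeriv_J hu] at h1
    rw [h.iteratedDeriv_fiber hu h1] at h2
    exact ⟨hu, h.normPow_pos hu h0, h1, h2⟩
  · rintro ⟨hu, h0, h1, h2⟩
    refine ⟨⟨hu, fun h3 => h0.ne' ((h.ae_eq_zero_iff hu).1 h3), ?_⟩, ?_⟩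
    · rw [h.lineDeriv_J hu, h1]
    · rwa [h.iteratedDeriv_fiber hu h1]

lemma mem_nehariMinus_iff (h : Setting p s q r a b Ω f g) {u : E n → ℝ} :
    u ∈ NehariMinus Ω p s a b q r f g lam ↔
      u ∈ Adm Ω p s ∧ HasTriple (TripleMinus p q r a b) p s q r Ω f g lam u := by
  simp only [NehariMinus, Nehari, mem_ofPred_eq, h.X0_eq, HasTriple, TripleMinus]
  constructor
  · rintro ⟨⟨hu, h0, h1⟩, h2⟩
    rw [h.lineDeriv_J hu] at h1
    rw [h.iteratedDeriv_fiber hu h1] at h2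
    exact ⟨hu, h.normPow_pos hu h0, h1, h2⟩
  · rintro ⟨hu, h0, h1, h2⟩
    refine ⟨⟨hu, fun h3 => h0.ne' ((h.ae_eq_zero_iff hu).1 h3), ?_⟩, ?_⟩
    · rw [h.lineDeriv_J hu, h1]
    · rwa [h.iteratedDeriv_fiber hu h1]

lemma weightBound_f (h : Setting p s q r a b Ω f g) :
    WeightBound Ω f q r (eLpNorm f (ENNReal.ofReal (r / (r - q))) (volume.restrict Ω)) :=
  weightBound_of_memLp h.q0 h.qr h.memLp_f

lemma weightBound_g (h : Setting p s q r a b Ω f g) :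
    WeightBound Ω g r r (eLpNorm g ∞ (volume.restrict Ω)) :=
  weightBound_of_memLp_top h.params.r0 h.memLp_g

lemma pint_r_lt_top (h : Setting p s q r a b Ω f g) {u : E n → ℝ} (hu : u ∈ Adm Ω p s) :
    pint r u < ⊤ := by
  have hr := h.params.r0
  have hp := h.params.p0
  obtain ⟨C, hC, H⟩ := sobolev_subcritical h.p1 h.s0 h.s1 h.psn h.measurableSet
    h.bounded.measure_lt_top hr h.rcrit.le
  exact (H u hu).trans_lt (ENNReal.mul_lt_top hC.lt_top
    (ENNReal.rpow_lt_top_of_nonneg (by positivity) (h.gag_lt_top hu).ne))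

lemma normX0_eq (h : Setting p s q r a b Ω f g) {u : E n → ℝ} (hu : u ∈ Adm Ω p s) :
    normX0 Ω p s u = normPow p s u ^ (1 / p) := by
  rw [normX0, integral_gag h.params.p0.le hu.1,
    setLIntegral_Q_eq_gag h.measurableSet h.params.p0 hu.2.1, normPow]

lemma normL_eq (h : Setting p s q r a b Ω f g) {u : E n → ℝ} (hu : u ∈ Adm Ω p s) :
    normL Ω (ENNReal.ofReal r) u = (pint r u).toReal ^ (1 / r) := by
  have hr := h.params.r0
  rw [normL, eLpNorm_eq_lintegral_rpow_enorm_toReal (by simpa using hr) (by simp),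
    ENNReal.toReal_ofReal hr.le, setLIntegral_eq_pint h.measurableSet hr hu.2.1,
    ← ENNReal.toReal_rpow]

lemma exists_powInt_pos_f (h : Setting p s q r a b Ω f g) :
    ∃ u ∈ Adm Ω p s, 0 < powInt Ω f q u := by
  have hr := h.params.r0
  have hrq : 0 < r - q := by linarith [h.qr]
  have : IsFiniteMeasure (volume.restrict Ω) :=
    ⟨by simpa using h.bounded.measure_lt_top⟩
  have hfi : Integrable f (volume.restrict Ω) := h.memLp_f.integrable (by
    rw [ENNReal.one_le_ofReal, le_div_iff₀ hrq]
    linarith [h.q0])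
  obtain ⟨φ, hφ, h1⟩ := exists_isTest_integral_pos h.q0 h.isOpen hfi h.f_pos
  exact ⟨φ, Adm.of_isTest h.params.p0 hφ, h1⟩

lemma exists_powInt_pos_g (h : Setting p s q r a b Ω f g) :
    ∃ u ∈ Adm Ω p s, 0 < powInt Ω g r u := by
  have : IsFiniteMeasure (volume.restrict Ω) :=
    ⟨by simpa using h.bounded.measure_lt_top⟩
  have hgi : Integrable g (volume.restrict Ω) := h.memLp_g.integrable le_top
  obtain ⟨φ, hφ, h1⟩ := exists_isTest_integral_pos h.params.r0 h.isOpen hgi h.g_pos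
  exact ⟨φ, Adm.of_isTest h.params.p0 hφ, h1⟩

lemma pint_r_pos (h : Setting p s q r a b Ω f g) {u : E n → ℝ} (hu : u ∈ Adm Ω p s)
    (h0 : ¬ u =ᵐ[volume] 0) : 0 < (pint r u).toReal := by
  refine ENNReal.toReal_pos (fun h1 => h0 ?_) (h.pint_r_lt_top hu).ne
  rw [pint, lintegral_eq_zero_iff' (hu.1.enorm.pow_const _)] at h1
  filter_upwards [h1] with x hx
  simpa [ENNReal.rpow_eq_zero_iff_of_pos h.params.r0] using hx

lemma S_pos (h : Setting p s q r a b Ω f g) : 0 < S Ω p s r := by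
  have hr := h.params.r0
  have hp := h.params.p0
  obtain ⟨C, hC, H⟩ := sobolev_subcritical h.p1 h.s0 h.s1 h.psn h.measurableSet
    h.bounded.measure_lt_top hr h.rcrit.le
  set c := (C.toReal + 1) ^ (1 / r) with hc
  have hC0 : 0 < C.toReal + 1 := by positivity
  have hc0 : 0 < c := by positivity
  -- The real infimum of the empty set is zero, so a nonzero admissible function is required;
  -- `f_pos` provides one.
  refine lt_of_lt_of_le (by positivity : 0 < 1 / c) (le_csInf ?_ ?_)
  · obtain ⟨u, hu, hpos⟩ := h.exists_powInt_pos_f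
    exact ⟨_, u, h.X0_eq ▸ hu, fun h0 => hpos.ne' (powInt_eq_zero h.q0.ne' h0), rfl⟩
  · rintro _ ⟨u, hu, h0, rfl⟩
    rw [h.X0_eq] at hu
    rw [h.normX0_eq hu, h.normL_eq hu]
    have h1 := h.pint_r_pos hu h0
    rw [div_le_div_iff₀ hc0 (by positivity), one_mul]
    have hN := h.normPow_pos hu h0
    have h2 : (pint r u).toReal ≤ (C.toReal + 1) * normPow p s u ^ (r / p) := by
      have h3 := ENNReal.toReal_mono (ENNReal.mul_ne_top hC
        (ENNReal.rpow_ne_top_of_nonneg (by positivity) (h.gag_lt_top hu).ne)) (H u hu)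
      rw [ENNReal.toReal_mul, ← ENNReal.toReal_rpow] at h3
      refine h3.trans ?_
      rw [normPow]
      gcongr
      linarith
    calc (pint r u).toReal ^ (1 / r) ≤ ((C.toReal + 1) * normPow p s u ^ (r / p)) ^ (1 / r) := by
          gcongr
      _ = normPow p s u ^ (1 / p) * c := by
          rw [Real.mul_rpow hC0.le (by positivity), ← Real.rpow_mul hN.le, mul_comm]
          congr 2
          field_simp

lemma pint_r_le (h : Setting p s q r a b Ω f g) {u : E n → ℝ} (hu : u ∈ Adm Ω p s) :
    (pint r u).toReal ^ (1 / r) ≤ normPow p s u ^ (1 / p) / S Ω p s r := by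
  have hr := h.params.r0
  by_cases h0 : u =ᵐ[volume] 0
  · have : pint r u = 0 := by
      rw [pint_congr h0]
      simp [pint, ENNReal.zero_rpow_of_pos hr]
    rw [this]
    have h1 := h.S_pos
    have h2 : 0 ≤ normPow p s u := ENNReal.toReal_nonneg
    simp only [ENNReal.toReal_zero]
    rw [Real.zero_rpow (by positivity)]
    positivity
  · rw [le_div_iff₀ h.S_pos, mul_comm, ← le_div_iff₀ (by have := h.pint_r_pos hu h0; positivity),
      ← h.normX0_eq hu, ← h.normL_eq hu]
    refine csInf_le ⟨0, ?_⟩ ⟨u, h.X0_eq ▸ hu, h0, rfl⟩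
    rintro _ ⟨v, hv, -, rfl⟩
    rw [h.X0_eq] at hv
    rw [h.normX0_eq hv, h.normL_eq hv, normPow]
    positivity

lemma pint_r_rpow_le (h : Setting p s q r a b Ω f g) {u : E n → ℝ} (hu : u ∈ Adm Ω p s) {m : ℝ}
    (hm : 0 < m) :
    (pint r u).toReal ^ (m / r) ≤ normPow p s u ^ (m / p) / S Ω p s r ^ m := by
  have h1 := Real.rpow_le_rpow (by positivity) (h.pint_r_le hu) hm.le
  rw [Real.div_rpow (by rw [normPow]; positivity) h.S_pos.le, ← Real.rpow_mul (by positivity),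
    ← Real.rpow_mul (by rw [normPow]; positivity), one_div_mul_eq_div, one_div_mul_eq_div] at h1
  exact h1

lemma normL_f_pos (h : Setting p s q r a b Ω f g) :
    0 < normL Ω (ENNReal.ofReal (r / (r - q))) f := by
  have hrq : 0 < r - q := by linarith [h.qr]
  have := h.params.r0
  refine ENNReal.toReal_pos (fun h0 => h.f_pos ?_) h.memLp_f.2.ne
  rw [eLpNorm_eq_zero_iff h.memLp_f.1 (by simp; positivity)] at h0
  filter_upwards [h0] with x hx
  simp [hx]

lemma normL_g_pos (h : Setting p s q r a b Ω f g) : 0 < normL Ω ∞ g := by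
  refine ENNReal.toReal_pos (fun h0 => h.g_pos ?_) h.memLp_g.2.ne
  rw [eLpNorm_eq_zero_iff h.memLp_g.1 (by simp)] at h0
  filter_upwards [h0] with x hx
  simp [hx]

lemma abs_powInt_f_le (h : Setting p s q r a b Ω f g) {u : E n → ℝ} (hu : u ∈ Adm Ω p s) :
    |powInt Ω f q u| ≤ normL Ω (ENNReal.ofReal (r / (r - q))) f / S Ω p s r ^ q
      * normPow p s u ^ (q / p) := by
  refine (h.weightBound_f.abs_integral_le h.q0 h.params.r0 hu.1 (h.pint_r_lt_top hu)).trans ?_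
  rw [div_mul_eq_mul_div, mul_div_assoc]
  exact mul_le_mul_of_nonneg_left (h.pint_r_rpow_le hu h.q0) ENNReal.toReal_nonneg

lemma abs_powInt_g_le (h : Setting p s q r a b Ω f g) {u : E n → ℝ} (hu : u ∈ Adm Ω p s) :
    |powInt Ω g r u| ≤ normL Ω ∞ g / S Ω p s r ^ r * normPow p s u ^ (r / p) := by
  refine (h.weightBound_g.abs_integral_le h.params.r0 h.params.r0 hu.1
    (h.pint_r_lt_top hu)).trans ?_
  rw [div_mul_eq_mul_div, mul_div_assoc]
  exact mul_le_mul_of_nonneg_left (h.pint_r_rpow_le hu h.params.r0) ENNReal.toReal_nonneg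

/-- With the constants from the Sobolev bounds on the two power integrals, `lambda0` is literally
the threshold of `Params.nondegenerate`. -/
lemma lambda0_eq (h : Setting p s q r a b Ω f g) : lambda0 Ω p s a q r f g
    = (r - p) / (normL Ω (ENNReal.ofReal (r / (r - q))) f / S Ω p s r ^ q)
      * (a / (r - q)) ^ ((r - q) / (r - p))
      * ((p - q) / (normL Ω ∞ g / S Ω p s r ^ r)) ^ ((p - q) / (r - p)) := by
  have h1 := h.S_pos
  rw [lambda0]
  rw [div_div_eq_mul_div, div_div_eq_mul_div]

lemma lambda0_pos (h : Setting p s q r a b Ω f g) : 0 < lambda0 Ω p s a q r f g := by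
  have h1 := h.S_pos
  have h2 := h.normL_f_pos
  have h3 := h.normL_g_pos
  have h4 : 0 < r - p := by linarith [h.params.pr, h.params.p0]
  have h5 : 0 < p - q := by linarith [h.params.qp]
  have h6 : 0 < r - q := by linarith
  have h7 := h.params.a0
  rw [lambda0]
  positivity

end Setting

end

/-! ### The direct method on the two parts of the Nehari set. -/

section

variable {n : ℕ} {p s q r a b lam : ℝ} {Ω : Set (E n)} {f g : E n → ℝ}

namespace Params

variable {cf cg : ℝ} {N F G : ℕ → ℝ} {N' F' G' : ℝ}

lemma tendsto_nehariDefect (hN : Tendsto N atTop (𝓝 N')) (hF : Tendsto F atTop (𝓝 F'))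
    (hG : Tendsto G atTop (𝓝 G')) :
    Tendsto (fun k => nehariDefect a b (N k) (F k) (G k)) atTop (𝓝 (nehariDefect a b N' F' G')) :=
  (((hN.const_mul a).add ((hN.pow 2).const_mul b)).sub hF).sub hG

lemma tendsto_secondDefect (hN : Tendsto N atTop (𝓝 N')) (hG : Tendsto G atTop (𝓝 G')) :
    Tendsto (fun k => secondDefect p q r a b (N k) (G k)) atTop
      (𝓝 (secondDefect p q r a b N' G')) :=
  ((hN.const_mul _).add ((hN.pow 2).const_mul _)).sub (hG.const_mul _)

lemma tendsto_energy (hN : Tendsto N atTop (𝓝 N')) (hF : Tendsto F atTop (𝓝 F'))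
    (hG : Tendsto G atTop (𝓝 G')) :
    Tendsto (fun k => energy p q r a b (N k) (F k) (G k)) atTop
      (𝓝 (energy p q r a b N' F' G')) :=
  (((hN.const_mul _).add ((hN.pow 2).const_mul _)).sub (hF.div_const _)).sub (hG.div_const _)

lemma tendsto_rpow (hN : Tendsto N atTop (𝓝 N')) {c : ℝ} (hc : 0 ≤ c) :
    Tendsto (fun k => N k ^ c) atTop (𝓝 (N' ^ c)) :=
  (Real.continuousAt_rpow_const _ _ (Or.inr hc)).tendsto.comp hN

/-- The limit is nonzero because its energy is at most a negative number, and its second defect,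
nonnegative in the limit, cannot vanish by nondegeneracy. The limiting `N'` need not be the norm of
a function. -/
lemma triplePlus_of_tendsto (h : Params p q r a b)
    (hN : Tendsto N atTop (𝓝 N')) (hF : Tendsto F atTop (𝓝 F')) (hG : Tendsto G atTop (𝓝 G'))
    (hT : ∀ k, TriplePlus p q r a b (N k) (F k) (G k))
    (hF' : F' ≤ lam * (cf * N' ^ (q / p))) (hG' : G' ≤ cg * N' ^ (r / p))
    (hnd : 0 < N' → Nondegenerate p q r a b N' F' G')
    (hE : ∀ k, energy p q r a b N' F' G' ≤ energy p q r a b (N k) (F k) (G k)) :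
    TriplePlus p q r a b N' F' G' := by
  have hp := h.p0
  have hr := h.r0
  have hq : 0 < q := by linarith [h.q1]
  have h1 : nehariDefect a b N' F' G' = 0 :=
    tendsto_nhds_unique (tendsto_nehariDefect hN hF hG) (by simp [(hT _).2.1])
  have h2 : 0 ≤ secondDefect p q r a b N' G' :=
    ge_of_tendsto' (tendsto_secondDefect hN hG) fun k => (hT k).2.2.le
  have h3 : 0 ≤ N' := ge_of_tendsto' hN fun k => (hT k).1.le
  have h4 : 0 < N' := by
    refine h3.lt_of_ne' fun h0 => ?_
    subst h0
    rw [Real.zero_rpow (by positivity), mul_zero, mul_zero] at hF'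
    rw [Real.zero_rpow (by positivity), mul_zero] at hG'
    have h5 : F' + G' = 0 := by
      rw [nehariDefect] at h1
      linarith
    have h6 : F' = 0 := by linarith
    have h7 : G' = 0 := by linarith
    have h8 := (hE 0).trans_lt (h.energy_neg_of_triplePlus (hT 0))
    simp [energy, h6, h7] at h8
  refine ⟨h4, h1, h2.lt_of_ne' fun h0 => ?_⟩
  have := hnd h4 1 one_pos (by simpa using h0)
  simp [h1] at this

/-- Here the uniform lower bound on `N` prevents collapse to zero; the energy plays no role. -/
lemma tripleMinus_of_tendsto (h : Params p q r a b) (hcg : 0 < cg)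
    (hN : Tendsto N atTop (𝓝 N')) (hF : Tendsto F atTop (𝓝 F')) (hG : Tendsto G atTop (𝓝 G'))
    (hT : ∀ k, TripleMinus p q r a b (N k) (F k) (G k))
    (hGk : ∀ k, G k ≤ cg * N k ^ (r / p))
    (hnd : 0 < N' → Nondegenerate p q r a b N' F' G') :
    TripleMinus p q r a b N' F' G' := by
  have hp := h.p0
  have hrp : 0 < r - p := by linarith [h.pr]
  have h1 : nehariDefect a b N' F' G' = 0 :=
    tendsto_nhds_unique (tendsto_nehariDefect hN hF hG) (by simp [(hT _).2.1])
  have h2 : secondDefect p q r a b N' G' ≤ 0 :=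
    le_of_tendsto' (tendsto_secondDefect hN hG) fun k => (hT k).2.2.le
  have h3 : 0 ≤ N' := ge_of_tendsto' hN fun k => (hT k).1.le
  have hc : 0 < (p - q) * a / ((r - q) * cg) :=
    div_pos (mul_pos (by linarith [h.qp]) h.a0) (mul_pos (by linarith [h.qp]) hcg)
  have h4 : 0 < N' := by
    refine h3.lt_of_ne' fun h0 => ?_
    have h5 := ge_of_tendsto' (tendsto_rpow hN (by positivity : 0 ≤ (r - p) / p)) fun k =>
      h.le_rpow_of_secondDefect hcg (hT k).1 (hGk k) (hT k).2.2.le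
    rw [h0, Real.zero_rpow (by positivity)] at h5
    linarith
  refine ⟨h4, h1, h2.lt_of_ne fun h0 => ?_⟩
  have := hnd h4 1 one_pos (by simpa using h0)
  simp [h1] at this

end Params

namespace Setting

/-- The constant in the bound of the concave term. -/
def constF (p s q r : ℝ) (Ω : Set (E n)) (f : E n → ℝ) : ℝ :=
  normL Ω (ENNReal.ofReal (r / (r - q))) f / S Ω p s r ^ q

/-- The constant in the bound of the convex term. -/
def constG (p s r : ℝ) (Ω : Set (E n)) (g : E n → ℝ) : ℝ := normL Ω ∞ g / S Ω p s r ^ r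

lemma constF_pos (h : Setting p s q r a b Ω f g) : 0 < constF p s q r Ω f := by
  have := h.S_pos
  have := h.normL_f_pos
  unfold constF
  positivity

lemma constG_pos (h : Setting p s q r a b Ω f g) : 0 < constG p s r Ω g := by
  have := h.S_pos
  have := h.normL_g_pos
  unfold constG
  positivity

lemma powInt_f_le (h : Setting p s q r a b Ω f g) (hlam : 0 < lam) {u : E n → ℝ}
    (hu : u ∈ Adm Ω p s) :
    lam * powInt Ω f q u ≤ lam * (constF p s q r Ω f * normPow p s u ^ (q / p)) :=
  mul_le_mul_of_nonneg_left ((le_abs_self _).trans (h.abs_powInt_f_le hu)) hlam.le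

lemma powInt_g_le (h : Setting p s q r a b Ω f g) {u : E n → ℝ} (hu : u ∈ Adm Ω p s) :
    powInt Ω g r u ≤ constG p s r Ω g * normPow p s u ^ (r / p) :=
  (le_abs_self _).trans (h.abs_powInt_g_le hu)

lemma nondegenerate_of_le (h : Setting p s q r a b Ω f g) (hlam : lam < lambda0 Ω p s a q r f g)
    {N F G : ℝ} (hN : 0 < N) (hF : F ≤ lam * (constF p s q r Ω f * N ^ (q / p)))
    (hG : G ≤ constG p s r Ω g * N ^ (r / p)) : Nondegenerate p q r a b N F G :=
  h.params.nondegenerate h.constF_pos h.constG_pos hN hF hG (by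
    rw [h.lambda0_eq] at hlam
    exact hlam)

lemma nondegenerate (h : Setting p s q r a b Ω f g) (hlam0 : 0 < lam)
    (hlam : lam < lambda0 Ω p s a q r f g) {u : E n → ℝ} (hu : u ∈ Adm Ω p s)
    (hN : 0 < normPow p s u) :
    Nondegenerate p q r a b (normPow p s u) (lam * powInt Ω f q u) (powInt Ω g r u) :=
  h.nondegenerate_of_le hlam hN (h.powInt_f_le hlam0 hu) (h.powInt_g_le hu)

/-- Compactness of norm-bounded sequences, with convergence of the lower order terms. -/
lemma exists_limit (h : Setting p s q r a b Ω f g) {w : ℕ → E n → ℝ}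
    (hw : ∀ k, w k ∈ Adm Ω p s) {R : ℝ} (hR : ∀ k, normPow p s (w k) ≤ R) :
    ∃ ns : ℕ → ℕ, StrictMono ns ∧ ∃ v ∈ Adm Ω p s, ∃ N : ℝ,
      Tendsto (fun k => normPow p s (w (ns k))) atTop (𝓝 N) ∧
      Tendsto (fun k => powInt Ω f q (w (ns k))) atTop (𝓝 (powInt Ω f q v)) ∧
      Tendsto (fun k => powInt Ω g r (w (ns k))) atTop (𝓝 (powInt Ω g r v)) ∧
      normPow p s v ≤ N := by
  have hp := h.params.p0
  have hr := h.params.r0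
  obtain ⟨N, -, ms, hms, hN⟩ := isCompact_Icc.tendsto_subseq (x := fun k => normPow p s (w k))
    (s := Icc 0 R) fun k => ⟨ENNReal.toReal_nonneg, hR k⟩
  have hgag : ∀ k, gag p s (w k) ≤ ENNReal.ofReal R := fun k => by
    rw [← h.ofReal_normPow (hw k)]
    exact ENNReal.ofReal_le_ofReal (hR k)
  obtain ⟨ks, hks, v, hv, hlim⟩ := exists_subseq_tendsto_pint h.p1 h.s0 h.s1 h.psn h.measurableSet
    h.bounded (fun k => hw (ms k)) ENNReal.ofReal_ne_top fun k => hgag _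
  have hvA : v ∈ Adm Ω p s :=
    adm_of_tendsto h.p2 (fun k => hw _) hv hlim ENNReal.ofReal_ne_top fun k => hgag _
  have hlimr := tendsto_pint_of_bounded_gag h.p1 h.s0 h.s1 h.psn (by linarith [h.params.pr])
    h.rcrit (fun k => hw (ms (ks k))) hvA ENNReal.ofReal_ne_top (fun k => hgag _) hlim
  have hN' : Tendsto (fun k => normPow p s (w (ms (ks k)))) atTop (𝓝 N) :=
    hN.comp hks.tendsto_atTop
  refine ⟨ms ∘ ks, hms.comp hks, v, hvA, N, hN', ?_, ?_, ?_⟩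
  · exact h.weightBound_f.tendsto_integral h.q0 hr (fun k => (hw _).1)
      (fun k => h.pint_r_lt_top (hw _)) hv (h.pint_r_lt_top hvA) hlimr
  · exact h.weightBound_g.tendsto_integral hr hr (fun k => (hw _).1)
      (fun k => h.pint_r_lt_top (hw _)) hv (h.pint_r_lt_top hvA) hlimr
  · refine le_of_forall_pos_le_add fun ε hε => ?_
    have hN0 : 0 ≤ N := ge_of_tendsto' hN' fun k => ENNReal.toReal_nonneg
    refine ENNReal.toReal_le_of_le_ofReal (by positivity) ?_
    refine gag_le_of_tendsto hp (fun k => (hw (ms (ks k))).1) hv hlim ?_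
    filter_upwards [hN'.eventually (gt_mem_nhds (by linarith : N < N + ε))] with k hk
    rw [← h.ofReal_normPow (hw _)]
    exact ENNReal.ofReal_le_ofReal hk.le

/-- The direct method on a part of the Nehari set that is closed along minimizing sequences. -/
lemma exists_nonneg_minimizer (h : Setting p s q r a b Ω f g) (hlam0 : 0 < lam)
    (hlam : lam < lambda0 Ω p s a q r f g) {T : ℝ → ℝ → ℝ → Prop}
    (hT : ∀ N F G, T N F G → 0 < N ∧ nehariDefect a b N F G = 0)
    (hT0 : ∀ N F G, T N F G → F ≠ 0 ∨ G ≠ 0)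
    (hne : ∃ u ∈ Adm Ω p s, HasTriple T p s q r Ω f g lam u)
    (hproj : ∀ N N₀ F G, 0 < N → N ≤ N₀ → Nondegenerate p q r a b N F G → T N₀ F G →
      ∃ t, 0 < t ∧ T (t ^ p * N) (t ^ q * F) (t ^ r * G) ∧
        energy p q r a b (t ^ p * N) (t ^ q * F) (t ^ r * G) ≤ energy p q r a b N₀ F G)
    (hclosed : ∀ (N F G : ℕ → ℝ) (N' F' G' : ℝ), Tendsto N atTop (𝓝 N') →
      Tendsto F atTop (𝓝 F') → Tendsto G atTop (𝓝 G') → (∀ k, T (N k) (F k) (G k)) →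
      (∀ k, G k ≤ constG p s r Ω g * N k ^ (r / p)) →
      F' ≤ lam * (constF p s q r Ω f * N' ^ (q / p)) → G' ≤ constG p s r Ω g * N' ^ (r / p) →
      (∀ k, energy p q r a b N' F' G' ≤ energy p q r a b (N k) (F k) (G k)) → T N' F' G') :
    ∃ u ∈ Adm Ω p s, (∀ x, 0 ≤ u x) ∧ HasTriple T p s q r Ω f g lam u ∧
      ∀ w ∈ Adm Ω p s, HasTriple T p s q r Ω f g lam w →
        J Ω p s a b q r f g lam u ≤ J Ω p s a b q r f g lam w := by
  have hp := h.params.p0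
  have hr := h.params.r0
  have hq := h.q0
  have hqr : 0 ≤ 1 / q - 1 / r := sub_nonneg.2 (one_div_le_one_div_of_le hq h.qr.le)
  set 𝒜 : Set ℝ := J Ω p s a b q r f g lam ''
    {u | u ∈ Adm Ω p s ∧ HasTriple T p s q r Ω f g lam u} with h𝒜
  have hbdd : BddBelow 𝒜 := by
    -- Either the energy is nonnegative, or coercivity bounds the norm and hence the only negative
    -- term of the energy on the Nehari set.
    obtain ⟨R, hR0, hR⟩ := h.params.exists_bound_of_energy_le h.constF_pos hlam0 0
    refine ⟨min 0 (-((1 / q - 1 / r) * (lam * (constF p s q r Ω f * R ^ (q / p))))), ?_⟩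
    rintro _ ⟨u, ⟨hu, huT⟩, rfl⟩
    obtain ⟨hN, h1⟩ := hT _ _ _ huT
    have hF := h.powInt_f_le hlam0 hu
    rw [h.J_eq hu]
    rcases le_total (energy p q r a b (normPow p s u) (lam * powInt Ω f q u) (powInt Ω g r u)) 0
      with h2 | h2
    · refine (min_le_right _ _).trans ?_
      have h3 := hR _ _ _ hN h1 hF h2
      have h4 := h.constF_pos
      have h5 : lam * powInt Ω f q u ≤ lam * (constF p s q r Ω f * R ^ (q / p)) :=
        hF.trans (by gcongr)
      have h6 := mul_le_mul_of_nonneg_left h5 hqr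
      rw [h.params.energy_of_nehari h1]
      have h7 : 0 ≤ (1 / p - 1 / r) * (a * normPow p s u) :=
        mul_nonneg (sub_nonneg.2 (one_div_le_one_div_of_le hp (by linarith [h.params.pr])))
          (mul_nonneg h.params.a0.le hN.le)
      have h8 : 0 ≤ (1 / (2 * p) - 1 / r) * (b * normPow p s u ^ 2) :=
        mul_nonneg (sub_nonneg.2 (one_div_le_one_div_of_le (by positivity) h.params.pr.le))
          (mul_nonneg h.params.b0.le (by positivity))
      linarith
    · exact (min_le_left _ _).trans h2
  have hne' : 𝒜.Nonempty := by
    obtain ⟨u, hu, huT⟩ := hne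
    exact ⟨_, u, ⟨hu, huT⟩, rfl⟩
  obtain ⟨e, he, helim, heA⟩ := exists_seq_tendsto_sInf hne' hbdd
  choose w hw hwe using heA
  obtain ⟨R, hR0, hR⟩ := h.params.exists_bound_of_energy_le h.constF_pos hlam0 (e 0)
  have hwR : ∀ k, normPow p s (w k) ≤ R := fun k => by
    obtain ⟨hN, h1⟩ := hT _ _ _ (hw k).2
    refine hR _ _ _ hN h1 (h.powInt_f_le hlam0 (hw k).1) ?_
    rw [← h.J_eq (hw k).1, hwe]
    exact he (Nat.zero_le k)
  obtain ⟨ns, hns, v, hv, N, hN, hF, hG, hvN⟩ := h.exists_limit (fun k => (hw k).1) hwR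
  have hF := hF.const_mul lam
  -- The first entry is the limit `N` of the norms, not the norm of `v`; with that choice the
  -- infimum is attained by a triple of numbers.
  have hE : energy p q r a b N (lam * powInt Ω f q v) (powInt Ω g r v) = sInf 𝒜 := by
    refine tendsto_nhds_unique (Params.tendsto_energy hN hF hG) ?_
    refine (helim.comp hns.tendsto_atTop).congr fun k => ?_
    rw [← h.J_eq (hw _).1]
    exact (hwe _).symm
  have hFN : lam * powInt Ω f q v ≤ lam * (constF p s q r Ω f * N ^ (q / p)) :=
    le_of_tendsto_of_tendsto' hF
      (((Params.tendsto_rpow hN (by positivity)).const_mul _).const_mul _)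
      fun k => h.powInt_f_le hlam0 (hw _).1
  have hGN : powInt Ω g r v ≤ constG p s r Ω g * N ^ (r / p) :=
    le_of_tendsto_of_tendsto' hG ((Params.tendsto_rpow hN (by positivity)).const_mul _)
      fun k => h.powInt_g_le (hw _).1
  have hTN := hclosed _ _ _ _ _ _ hN hF hG (fun k => (hw (ns k)).2)
    (fun k => h.powInt_g_le (hw _).1) hFN hGN fun k => by
      rw [hE, ← h.J_eq (hw _).1]
      exact csInf_le hbdd ⟨_, hw _, rfl⟩
  have hv' := Adm.abs h.p2 h.s0 h.s1 h.n0 h.measurableSet h.bounded.measure_lt_top hv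
  set v' : E n → ℝ := fun x => |v x| with hv'def
  have hv0 : ¬ v =ᵐ[volume] 0 := fun h0 => by
    rcases hT0 _ _ _ hTN with h1 | h1
    · exact h1 (by rw [powInt_eq_zero hq.ne' h0, mul_zero])
    · exact h1 (powInt_eq_zero hr.ne' h0)
  have hv0' : ¬ v' =ᵐ[volume] 0 := fun h0 => hv0 (by
    filter_upwards [h0] with x hx
    simpa [v'] using hx)
  have hN0 := h.normPow_pos hv' hv0'
  have hNN : normPow p s v' ≤ N := by
    refine le_trans ?_ hvN
    exact ENNReal.toReal_mono (h.gag_lt_top hv).ne (gag_abs_le hp.le v)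
  have hnd := h.nondegenerate hlam0 hlam hv' hN0
  rw [powInt_abs, powInt_abs] at hnd
  -- `|v|` has the same power integrals and no larger norm than `N`, so its projection has at most
  -- the infimal energy and is the nonnegative minimizer.
  obtain ⟨t, ht, htT, htE⟩ := hproj _ _ _ _ hN0 hNN hnd hTN
  rw [hE] at htE
  refine ⟨t • v', Adm.smul hp.le t hv', fun x => ?_, ?_, fun w hw hwT => ?_⟩
  · exact mul_nonneg ht.le (abs_nonneg _)
  · rw [hasTriple_smul hp.le ht.le, powInt_abs, powInt_abs]
    exact htT
  · rw [h.J_eq (Adm.smul hp.le t hv'), normPow_smul hp.le ht.le, powInt_smul ht.le,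
      powInt_smul ht.le, powInt_abs, powInt_abs, mul_left_comm]
    exact htE.trans (csInf_le hbdd ⟨w, ⟨hw, hwT⟩, rfl⟩)

lemma exists_nonneg_minimizer_plus (h : Setting p s q r a b Ω f g) (hlam0 : 0 < lam)
    (hlam : lam < lambda0 Ω p s a q r f g) :
    ∃ u ∈ Adm Ω p s, (∀ x, 0 ≤ u x) ∧ HasTriple (TriplePlus p q r a b) p s q r Ω f g lam u ∧
      ∀ w ∈ Adm Ω p s, HasTriple (TriplePlus p q r a b) p s q r Ω f g lam w →
        J Ω p s a b q r f g lam u ≤ J Ω p s a b q r f g lam w := by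
  refine h.exists_nonneg_minimizer hlam0 hlam (fun N F G hT => ⟨hT.1, hT.2.1⟩)
    (fun N F G hT => Or.inl (h.params.pos_of_triplePlus hT).ne') ?_
    (fun N N₀ F G hN hNN hnd hT => h.params.exists_triplePlus_le_of_le hN hNN hnd hT)
    (fun N F G N' F' G' hN hF hG hT _ hF' hG' hE => h.params.triplePlus_of_tendsto hN hF hG hT
      hF' hG' (fun h0 => h.nondegenerate_of_le hlam h0 hF' hG') hE)
  obtain ⟨u, hu, hpos⟩ := h.exists_powInt_pos_f
  have hN := h.normPow_pos hu fun h0 => hpos.ne' (powInt_eq_zero h.q0.ne' h0)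
  obtain ⟨t, ht, h1, h2⟩ := h.params.exists_level_eq_slope_pos hN (mul_pos hlam0 hpos)
    (h.nondegenerate hlam0 hlam hu hN)
  exact ⟨t • u, Adm.smul h.params.p0.le t hu, (hasTriple_smul h.params.p0.le ht.le u).2
    (Params.triplePlus_scaled hN ht h1 h2)⟩

lemma exists_nonneg_minimizer_minus (h : Setting p s q r a b Ω f g) (hlam0 : 0 < lam)
    (hlam : lam < lambda0 Ω p s a q r f g) :
    ∃ u ∈ Adm Ω p s, (∀ x, 0 ≤ u x) ∧ HasTriple (TripleMinus p q r a b) p s q r Ω f g lam u ∧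
      ∀ w ∈ Adm Ω p s, HasTriple (TripleMinus p q r a b) p s q r Ω f g lam w →
        J Ω p s a b q r f g lam u ≤ J Ω p s a b q r f g lam w := by
  refine h.exists_nonneg_minimizer hlam0 hlam (fun N F G hT => ⟨hT.1, hT.2.1⟩)
    (fun N F G hT => Or.inr (h.params.pos_of_tripleMinus hT.1 hT.2.2.le).ne') ?_
    (fun N N₀ F G hN hNN hnd hT => h.params.exists_tripleMinus_le_of_le hN hNN hnd hT)
    (fun N F G N' F' G' hN hF hG hT hGk hF' hG' _ => h.params.tripleMinus_of_tendsto
      h.constG_pos hN hF hG hT hGk (fun h0 => h.nondegenerate_of_le hlam h0 hF' hG'))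
  obtain ⟨u, hu, hpos⟩ := h.exists_powInt_pos_g
  have hN := h.normPow_pos hu fun h0 => hpos.ne' (powInt_eq_zero h.params.r0.ne' h0)
  obtain ⟨t, ht, h1, h2⟩ := h.params.exists_level_eq_slope_neg hN hpos
    (h.nondegenerate hlam0 hlam hu hN)
  exact ⟨t • u, Adm.smul h.params.p0.le t hu, (hasTriple_smul h.params.p0.le ht.le u).2
    (Params.tripleMinus_scaled hN ht h1 h2)⟩

end Setting

end

/-! ### From minimizers to weak solutions. -/

section

variable {n : ℕ} {p s q r a b lam : ℝ} {Ω : Set (E n)} {f g : E n → ℝ}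

namespace Params

variable {N F G : ℝ → ℝ} {A B C : ℝ}

lemma hasDerivAt_energy (hN : HasDerivAt N A 0) (hF : HasDerivAt F B 0) (hG : HasDerivAt G C 0) :
    HasDerivAt (fun τ => energy p q r a b (N τ) (F τ) (G τ))
      (a / p * A + b / (2 * p) * (2 * N 0 * A) - B / q - C / r) 0 := by
  have h2 : HasDerivAt (fun τ => N τ ^ 2) (2 * N 0 * A) 0 :=
    (hN.pow 2).congr_deriv (by simp)
  exact (((hN.const_mul _).add (h2.const_mul _)).sub (hF.div_const q)).sub (hG.div_const r)

/-- Minimality on the positive part of the Nehari set forces a critical point. -/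
lemma deriv_energy_eq_zero_of_triplePlus (h : Params p q r a b) (hN : HasDerivAt N A 0)
    (hF : HasDerivAt F B 0) (hG : HasDerivAt G C 0)
    (h0 : TriplePlus p q r a b (N 0) (F 0) (G 0))
    (hnd : ∀ τ, 0 < N τ → Nondegenerate p q r a b (N τ) (F τ) (G τ))
    (hmin : ∀ τ t, 0 < t → TriplePlus p q r a b (t ^ p * N τ) (t ^ q * F τ) (t ^ r * G τ) →
      energy p q r a b (N 0) (F 0) (G 0)
        ≤ energy p q r a b (t ^ p * N τ) (t ^ q * F τ) (t ^ r * G τ)) :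
    a / p * A + b / (2 * p) * (2 * N 0 * A) - B / q - C / r = 0 := by
  -- Near zero, projection to the positive part does not increase the energy, so the constrained
  -- minimum is an unconstrained local minimum along the curve.
  refine IsLocalMin.hasDerivAt_eq_zero (f := fun τ => energy p q r a b (N τ) (F τ) (G τ)) ?_
    (hasDerivAt_energy hN hF hG)
  have hsd : ContinuousAt (fun τ => secondDefect p q r a b (N τ) (G τ)) 0 :=
    ((continuousAt_const.mul hN.continuousAt).add
      (continuousAt_const.mul (hN.continuousAt.pow 2))).sub
      (continuousAt_const.mul hG.continuousAt)
  filter_upwards [hN.continuousAt.eventually (lt_mem_nhds h0.1),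
    hF.continuousAt.eventually (lt_mem_nhds (h.pos_of_triplePlus h0)),
    hsd.eventually (lt_mem_nhds h0.2.2)] with τ h1 h2 h3
  obtain ⟨t, ht, htT, htE⟩ := h.exists_triplePlus_le h1 h2 (hnd τ h1) h3
  exact (hmin τ t ht htT).trans htE

/-- For small `τ > 0` some factor `t` near one projects the perturbed triple. The unperturbed ray at
`t` has at most the minimal energy, being near its local maximum, and the projected triple has at
least that energy. A negative derivative would reverse this comparison. -/
lemma deriv_energy_nonneg_of_tripleMinus (h : Params p q r a b) (hN : HasDerivAt N A 0)
    (hF : HasDerivAt F B 0) (hG : HasDerivAt G C 0)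
    (h0 : TripleMinus p q r a b (N 0) (F 0) (G 0))
    (hmin : ∀ τ t, 0 < t → TripleMinus p q r a b (t ^ p * N τ) (t ^ q * F τ) (t ^ r * G τ) →
      energy p q r a b (N 0) (F 0) (G 0)
        ≤ energy p q r a b (t ^ p * N τ) (t ^ q * F τ) (t ^ r * G τ)) :
    0 ≤ a / p * A + b / (2 * p) * (2 * N 0 * A) - B / q - C / r := by
  by_contra hneg
  rw [not_le] at hneg
  have h2 : HasDerivAt (fun τ => N τ ^ 2) (2 * N 0 * A) 0 :=
    (hN.pow 2).congr_deriv (by simp)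
  have slope : ∀ {φ : ℝ → ℝ} {D : ℝ}, HasDerivAt φ D 0 →
      Tendsto (fun x : ℝ × ℝ => x.1⁻¹ * (φ x.1 - φ 0)) (𝓝[>] 0 ×ˢ 𝓝 1) (𝓝 D) := by
    intro φ D hφ
    have := hφ.tendsto_slope_zero_right
    simp only [zero_add, smul_eq_mul] at this
    exact this.comp tendsto_fst
  have pow : ∀ c : ℝ, Tendsto (fun x : ℝ × ℝ => x.2 ^ c) (𝓝[>] 0 ×ˢ 𝓝 1) (𝓝 1) := fun c => by
    have := (Real.continuousAt_rpow_const 1 c (Or.inl one_ne_zero)).tendsto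
    rw [Real.one_rpow] at this
    exact this.comp tendsto_snd
  -- The difference quotient between the perturbed and unperturbed rays at the same `t` converges
  -- jointly as `τ → 0⁺` and `t → 1`, so no regularity of the projection factor in `τ` is needed.
  have hlim := (((((pow p).mul (slope hN)).const_mul (a / p)).add
    (((pow (2 * p)).mul (slope h2)).const_mul (b / (2 * p)))).sub
    (((pow q).mul (slope hF)).div_const q)).sub (((pow r).mul (slope hG)).div_const r)
  simp only [one_mul] at hlim
  obtain ⟨P, hP, R, hR, hPR⟩ := eventually_prod_iff.1 (hlim.eventually (gt_mem_nhds hneg))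
  have hR' : {t | R t} ∩ {t | ray p q r a b (N 0) (F 0) (G 0) t
      ≤ energy p q r a b (N 0) (F 0) (G 0)} ∈ 𝓝 (1 : ℝ) :=
    inter_mem hR (h.eventually_ray_le h0)
  have hmono : 𝓝[>] (0 : ℝ) ≤ 𝓝 0 := nhdsWithin_le_nhds
  obtain ⟨τ, ⟨hτP, t, ht, ht0, htT⟩, hτ⟩ := ((hP.and (h.eventually_exists_tripleMinus h0
    (hN.continuousAt.tendsto.mono_left hmono) (hF.continuousAt.tendsto.mono_left hmono)
    (hG.continuousAt.tendsto.mono_left hmono) hR')).and self_mem_nhdsWithin).exists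
  have hτ0 : 0 < τ := hτ
  have h3 := hPR hτP ht.1
  have h4 := hmin τ t ht0 htT
  have h5 : ray p q r a b (N 0) (F 0) (G 0) t ≤ energy p q r a b (N 0) (F 0) (G 0) := ht.2
  have h6 : energy p q r a b (t ^ p * N τ) (t ^ q * F τ) (t ^ r * G τ)
      - ray p q r a b (N 0) (F 0) (G 0) t
      = τ * (a / p * (t ^ p * (τ⁻¹ * (N τ - N 0)))
        + b / (2 * p) * (t ^ (2 * p) * (τ⁻¹ * (N τ ^ 2 - N 0 ^ 2)))
        - t ^ q * (τ⁻¹ * (F τ - F 0)) / q - t ^ r * (τ⁻¹ * (G τ - G 0)) / r) := by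
    rw [ray, energy, energy, sq_scaled ht0, sq_scaled ht0]
    have hp := h.p0
    have hr := h.r0
    have hq : 0 < q := by linarith [h.q1]
    field_simp
    ring
  have h7 := mul_neg_of_pos_of_neg hτ0 h3
  linarith

/-- Minimality on the negative part of the Nehari set forces a critical point. -/
lemma deriv_energy_eq_zero_of_tripleMinus (h : Params p q r a b) (hN : HasDerivAt N A 0)
    (hF : HasDerivAt F B 0) (hG : HasDerivAt G C 0)
    (h0 : TripleMinus p q r a b (N 0) (F 0) (G 0))
    (hmin : ∀ τ t, 0 < t → TripleMinus p q r a b (t ^ p * N τ) (t ^ q * F τ) (t ^ r * G τ) →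
      energy p q r a b (N 0) (F 0) (G 0)
        ≤ energy p q r a b (t ^ p * N τ) (t ^ q * F τ) (t ^ r * G τ)) :
    a / p * A + b / (2 * p) * (2 * N 0 * A) - B / q - C / r = 0 := by
  have hflip : ∀ {φ : ℝ → ℝ} {D : ℝ}, HasDerivAt φ D 0 → HasDerivAt (fun τ => φ (-τ)) (-D) 0 := by
    intro φ D hφ
    refine (HasDerivAt.comp (0 : ℝ) (h₂ := φ) (h₂' := D) ?_ (hasDerivAt_neg (0 : ℝ))).congr_deriv
      (by simp)
    simpa using hφ
  have h1 := h.deriv_energy_nonneg_of_tripleMinus hN hF hG h0 hmin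
  -- The reversed curve has the opposite derivative, which gives the other inequality.
  have h2 := h.deriv_energy_nonneg_of_tripleMinus (hflip hN) (hflip hF) (hflip hG)
    (by simpa using h0) (fun τ t ht hT => by simpa using hmin (-τ) t ht hT)
  rw [neg_zero] at h2
  have h3 : a / p * -A + b / (2 * p) * (2 * N 0 * -A) - -B / q - -C / r
      = -(a / p * A + b / (2 * p) * (2 * N 0 * A) - B / q - C / r) := by ring
  linarith

end Params

/-- In this form the kernel is a weight on the product space, so `hasDerivAt_integral_abs_rpow`
differentiates the energy just as it does the two lower-order terms. -/
lemma normPow_eq_integral (hp : 0 ≤ p) {u : E n → ℝ} (hu : AEStronglyMeasurable u volume) :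
    normPow p s u
      = ∫ z : E n × E n, ‖z.1 - z.2‖ ^ (-(n : ℝ) - p * s) * |u z.1 - u z.2| ^ p := by
  rw [integral_eq_lintegral_of_nonneg_ae (ae_of_all _ fun z => by positivity), normPow, gag]
  · congr 1
    refine lintegral_congr fun z => ?_
    rw [kern, enorm_rpow_eq hp, ← ENNReal.ofReal_mul (by positivity), mul_comm, neg_add']
  · have h1 : Measurable fun z : E n × E n => ‖z.1 - z.2‖ ^ (-(n : ℝ) - p * s) := by fun_prop
    exact (h1.aemeasurable.mul ((continuous_abs.measurable.comp_aemeasurable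
      (aemeasurable_diff hu)).pow_const p)).aestronglyMeasurable

lemma integrable_gag (hp : 0 ≤ p) {u : E n → ℝ} (hu : AEStronglyMeasurable u volume)
    (hu' : gag p s u < ⊤) : Integrable fun z : E n × E n =>
      ‖z.1 - z.2‖ ^ (-(n : ℝ) - p * s) * |u z.1 - u z.2| ^ p := by
  have h1 : Measurable fun z : E n × E n => ‖z.1 - z.2‖ ^ (-(n : ℝ) - p * s) := by fun_prop
  refine ⟨(h1.aemeasurable.mul ((continuous_abs.measurable.comp_aemeasurable
    (aemeasurable_diff hu)).pow_const p)).aestronglyMeasurable, ?_⟩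
  refine lt_of_eq_of_lt (lintegral_congr fun z => ?_) hu'
  rw [kern, enorm_rpow_eq hp, ← ENNReal.ofReal_mul (by positivity), neg_add',
    Real.enorm_of_nonneg (by positivity), mul_comm (|u z.1 - u z.2| ^ p)]

namespace Setting

lemma hasDerivAt_normPow (h : Setting p s q r a b Ω f g) {u φ : E n → ℝ} (hu : u ∈ Adm Ω p s)
    (hφ : φ ∈ Adm Ω p s) :
    HasDerivAt (fun τ : ℝ => normPow p s (u + τ • φ))
      (p * ∫ z : E n × E n, |u z.1 - u z.2| ^ (p - 2) * (u z.1 - u z.2) * (φ z.1 - φ z.2) *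
        ‖z.1 - z.2‖ ^ (-(n : ℝ) - p * s)) 0 := by
  have hp := h.params.p0
  have h1 : Measurable fun z : E n × E n => ‖z.1 - z.2‖ ^ (-(n : ℝ) - p * s) := by fun_prop
  have h2 := hasDerivAt_integral_abs_rpow (m := p) (by linarith [h.p2]) h1.aestronglyMeasurable
    (aemeasurable_diff hu.1).aestronglyMeasurable (aemeasurable_diff hφ.1).aestronglyMeasurable
    (integrable_gag hp.le hu.1 (h.gag_lt_top hu)) (integrable_gag hp.le hφ.1 (h.gag_lt_top hφ))
  refine (h2.congr_of_eventuallyEq (Eventually.of_forall fun τ => ?_)).congr_deriv ?_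
  · rw [normPow_eq_integral hp.le (hu.1.add (hφ.1.const_smul τ))]
    refine integral_congr_ae (ae_of_all _ fun z => ?_)
    simp only [Pi.add_apply, Pi.smul_apply, smul_eq_mul]
    congr 3
    ring
  · congr 1
    refine integral_congr_ae (ae_of_all _ fun z => ?_)
    ring

lemma hasDerivAt_powInt_f (h : Setting p s q r a b Ω f g) {u φ : E n → ℝ} (hu : u ∈ Adm Ω p s)
    (hφ : φ ∈ Adm Ω p s) :
    HasDerivAt (fun τ : ℝ => powInt Ω f q (u + τ • φ))
      (q * ∫ x in Ω, f x * |u x| ^ (q - 2) * u x * φ x) 0 :=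
  hasDerivAt_integral_abs_rpow h.params.q1 h.memLp_f.1 hu.1.restrict hφ.1.restrict
    (h.weightBound_f.integrable h.q0 h.params.r0 hu.1 (h.pint_r_lt_top hu))
    (h.weightBound_f.integrable h.q0 h.params.r0 hφ.1 (h.pint_r_lt_top hφ))

lemma hasDerivAt_powInt_g (h : Setting p s q r a b Ω f g) {u φ : E n → ℝ} (hu : u ∈ Adm Ω p s)
    (hφ : φ ∈ Adm Ω p s) :
    HasDerivAt (fun τ : ℝ => powInt Ω g r (u + τ • φ))
      (r * ∫ x in Ω, g x * |u x| ^ (r - 2) * u x * φ x) 0 :=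
  hasDerivAt_integral_abs_rpow (by linarith [h.params.q1, h.qr]) h.memLp_g.1 hu.1.restrict
    hφ.1.restrict
    (h.weightBound_g.integrable h.params.r0 h.params.r0 hu.1 (h.pint_r_lt_top hu))
    (h.weightBound_g.integrable h.params.r0 h.params.r0 hφ.1 (h.pint_r_lt_top hφ))

/-- A function at which the energy is stationary in all directions is a weak solution. -/
lemma isWeakSolution_of_deriv_eq_zero (h : Setting p s q r a b Ω f g) {u : E n → ℝ}
    (hu : u ∈ Adm Ω p s)
    (hcrit : ∀ φ ∈ Adm Ω p s, ∀ A B C : ℝ,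
      HasDerivAt (fun τ : ℝ => normPow p s (u + τ • φ)) A 0 →
      HasDerivAt (fun τ : ℝ => lam * powInt Ω f q (u + τ • φ)) B 0 →
      HasDerivAt (fun τ : ℝ => powInt Ω g r (u + τ • φ)) C 0 →
      a / p * A + b / (2 * p) * (2 * normPow p s u * A) - B / q - C / r = 0) :
    IsWeakSolution Ω p s a b q r f g lam u := by
  refine ⟨h.X0_eq ▸ hu, fun φ hφ => ?_⟩
  rw [h.X0_eq] at hφ
  have hp := h.params.p0
  have hr := h.params.r0
  have hq := h.q0
  rw [normX0_rpow hp h.measurableSet hu, M]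
  change (a + b * normPow p s u) * _ = _
  have h1 := hcrit φ hφ _ _ _ (h.hasDerivAt_normPow hu hφ)
    ((h.hasDerivAt_powInt_f hu hφ).const_mul lam) (h.hasDerivAt_powInt_g hu hφ)
  generalize (∫ z : E n × E n, |u z.1 - u z.2| ^ (p - 2) * (u z.1 - u z.2) * (φ z.1 - φ z.2) *
    ‖z.1 - z.2‖ ^ (-(n : ℝ) - p * s)) = K at h1 ⊢
  field_simp at h1
  linarith

lemma isWeakSolution_of_minimizer_plus (h : Setting p s q r a b Ω f g) (hlam0 : 0 < lam)
    (hlam : lam < lambda0 Ω p s a q r f g) {u : E n → ℝ} (hu : u ∈ Adm Ω p s)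
    (huT : HasTriple (TriplePlus p q r a b) p s q r Ω f g lam u)
    (hmin : ∀ w ∈ Adm Ω p s, HasTriple (TriplePlus p q r a b) p s q r Ω f g lam w →
      J Ω p s a b q r f g lam u ≤ J Ω p s a b q r f g lam w) :
    IsWeakSolution Ω p s a b q r f g lam u := by
  have hp := h.params.p0
  refine h.isWeakSolution_of_deriv_eq_zero hu fun φ hφ A B C hA hB hC => ?_
  have hline : ∀ τ : ℝ, u + τ • φ ∈ Adm Ω p s := fun τ =>
    Adm.add h.p1 hu (Adm.smul hp.le τ hφ)
  have := h.params.deriv_energy_eq_zero_of_triplePlus hA hB hC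
    (by simpa [HasTriple] using huT) (fun τ hτ => h.nondegenerate hlam0 hlam (hline τ) hτ)
    (fun τ t ht hT => by
      have hT' := (hasTriple_smul hp.le ht.le _).2 hT
      have hle := hmin _ (Adm.smul hp.le t (hline τ)) hT'
      rw [h.J_eq hu, h.J_eq (Adm.smul hp.le t (hline τ)), normPow_smul hp.le ht.le,
        powInt_smul ht.le, powInt_smul ht.le, mul_left_comm lam] at hle
      simpa using hle)
  simpa using this

lemma isWeakSolution_of_minimizer_minus (h : Setting p s q r a b Ω f g) {u : E n → ℝ}
    (hu : u ∈ Adm Ω p s)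
    (huT : HasTriple (TripleMinus p q r a b) p s q r Ω f g lam u)
    (hmin : ∀ w ∈ Adm Ω p s, HasTriple (TripleMinus p q r a b) p s q r Ω f g lam w →
      J Ω p s a b q r f g lam u ≤ J Ω p s a b q r f g lam w) :
    IsWeakSolution Ω p s a b q r f g lam u := by
  have hp := h.params.p0
  refine h.isWeakSolution_of_deriv_eq_zero hu fun φ hφ A B C hA hB hC => ?_
  have hline : ∀ τ : ℝ, u + τ • φ ∈ Adm Ω p s := fun τ =>
    Adm.add h.p1 hu (Adm.smul hp.le τ hφ)
  have := h.params.deriv_energy_eq_zero_of_tripleMinus hA hB hC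
    (by simpa [HasTriple] using huT)
    (fun τ t ht hT => by
      have hT' := (hasTriple_smul hp.le ht.le _).2 hT
      have hle := hmin _ (Adm.smul hp.le t (hline τ)) hT'
      rw [h.J_eq hu, h.J_eq (Adm.smul hp.le t (hline τ)), normPow_smul hp.le ht.le,
        powInt_smul ht.le, powInt_smul ht.le, mul_left_comm lam] at hle
      simpa using hle)
  simpa using this

lemma isSolution_of_isWeakSolution (h : Setting p s q r a b Ω f g) {u : E n → ℝ}
    (hu : u ∈ Adm Ω p s) (hu0 : ∀ x, 0 ≤ u x) (hN : 0 < normPow p s u)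
    (hw : IsWeakSolution Ω p s a b q r f g lam u) : IsSolution Ω p s a b q r f g lam u := by
  refine ⟨hw, ae_of_all _ hu0, fun h0 => hN.ne' ((h.ae_eq_zero_iff hu).1 ?_)⟩
  rw [ae_restrict_iff' h.measurableSet] at h0
  filter_upwards [h0, hu.2.1] with x hx hx'
  by_cases hxΩ : x ∈ Ω
  · exact hx hxΩ
  · exact hx' hxΩ

end Setting

end

end FracKirchhoff

end

/-! ### Conclusion. -/

theorem theorem1p2 (n : ℕ) (p s q r a b : ℝ)
    (hs0 : 0 < s) (hs1 : s < 1) (hp : 2 ≤ p)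
    (hn1 : p * s < n) (hn2 : (n : ℝ) < 2 * p * s)
    (hq1 : 1 < q) (hqp : q < p)
    (hr1 : 2 * p < r) (hr2 : r < n * p / (n - p * s))
    (ha : 0 < a) (hb : 0 < b)
    (Ω : Set (FracKirchhoff.E n)) (hΩo : IsOpen Ω) (hΩc : IsConnected Ω)
    (hΩb : Bornology.IsBounded Ω) (hΩs : FracKirchhoff.HasSmoothBoundary Ω)
    (f g : FracKirchhoff.E n → ℝ)
    (hf : MemLp f (ENNReal.ofReal (r / (r - q))) (volume.restrict Ω))
    (hg : MemLp g ∞ (volume.restrict Ω))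
    (hfpos : ¬ (∀ᵐ x ∂(volume.restrict Ω), max (f x) 0 = 0))
    (hgpos : ¬ (∀ᵐ x ∂(volume.restrict Ω), max (g x) 0 = 0)) :
    0 < FracKirchhoff.lambda0 Ω p s a q r f g ∧
    ∀ lam : ℝ, 0 < lam → lam < FracKirchhoff.lambda0 Ω p s a q r f g →
      ∃ u v : FracKirchhoff.E n → ℝ,
        FracKirchhoff.IsSolution Ω p s a b q r f g lam u ∧
        FracKirchhoff.IsSolution Ω p s a b q r f g lam v ∧
        ¬ (u =ᵐ[volume] v) ∧
        u ∈ FracKirchhoff.NehariPlus Ω p s a b q r f g lam ∧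
        IsMinOn (FracKirchhoff.J Ω p s a b q r f g lam)
          (FracKirchhoff.NehariPlus Ω p s a b q r f g lam) u ∧
        v ∈ FracKirchhoff.NehariMinus Ω p s a b q r f g lam ∧
        IsMinOn (FracKirchhoff.J Ω p s a b q r f g lam)
          (FracKirchhoff.NehariMinus Ω p s a b q r f g lam) v := by
  have h : FracKirchhoff.Setting p s q r a b Ω f g :=
    { params := ⟨hq1, hqp, hr1, ha, hb⟩
      s0 := hs0
      s1 := hs1
      p2 := hp
      psn := hn1
      rcrit := hr2
      isOpen := hΩo
      nonempty := hΩc.nonempty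
      bounded := hΩb
      memLp_f := hf
      memLp_g := hg
      f_pos := hfpos
      g_pos := hgpos }
  refine ⟨h.lambda0_pos, fun lam hlam0 hlam => ?_⟩
  obtain ⟨u, hu, hu0, huT, humin⟩ := h.exists_nonneg_minimizer_plus hlam0 hlam
  obtain ⟨v, hv, hv0, hvT, hvmin⟩ := h.exists_nonneg_minimizer_minus hlam0 hlam
  refine ⟨u, v,
    h.isSolution_of_isWeakSolution hu hu0 huT.1
      (h.isWeakSolution_of_minimizer_plus hlam0 hlam hu huT humin),
    h.isSolution_of_isWeakSolution hv hv0 hvT.1 (h.isWeakSolution_of_minimizer_minus hv hvT hvmin),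
    fun huv => ?_, h.mem_nehariPlus_iff.2 ⟨hu, huT⟩, fun w hw => ?_,
    h.mem_nehariMinus_iff.2 ⟨hv, hvT⟩, fun w hw => ?_⟩
  -- Functions equal almost everywhere have the same triple, whose second defect cannot be both
  -- positive and negative.
  · have h1 := huT.2.2
    rw [FracKirchhoff.normPow, FracKirchhoff.gag_congr huv, FracKirchhoff.powInt_congr huv] at h1
    exact absurd hvT.2.2 h1.le.not_gt
  · exact humin w (h.mem_nehariPlus_iff.1 hw).1 (h.mem_nehariPlus_iff.1 hw).2
  · exact hvmin w (h.mem_nehariMinus_iff.1 hw).1 (h.mem_nehariMinus_iff.1 hw).2
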